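/- **Definitions.** Strings are finite sequences of positive integers, and the weight of a string is the sum of its symbols. A necklace is a string that is lexicographically smallest among its rotations, and the aperiodic prefix of a string $\sigma$ is its shortest prefix $p$ with $\sigma=p^j$ for some $j\ge 1$. For $k,\ell,w$ let $\mathcal{G}_k(\ell,w^\uparrow)$ be the concatenation, in lexicographic order, of the aperiodic prefixes of all necklaces of length $\ell$ over $\{1,\dots,k\}$ of weight at least $w$. Let $\mathcal{G}_k(\ell,w_\downarrow)$ be obtained from $\mathcal{G}_k(\ell,(k\ell-w+\ell)^\uparrow)$ by replacing every symbol $x$ by $k-x+1$. The shifted difference representative of a multiset $\{m_1\le m_2\le\dots\le m_t\}$ of non-negative integers is the string $(m_1+1)(m_2-m_1+1)\cdots(m_t-m_{t-1}+1)$. A universal cycle for a finite set $S$ whose elements are represented by strings is a cyclic sequence of length $|S|$ that contains the representative of each element exactly once as a (cyclic) substring. The rank of an element is the starting index, in $\{1,\dots,|S|\}$, of its representative. Ranking means computing the rank of a given element; unranking means computing the element of a given rank. The machine model is the unit-cost RAM (a single program, which gets $n$ and $t$ as part of its input; space is the number of registers). **Theorem.** For all integers $n,t\ge 1$, the sequence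 $\mathcal{G}_n(t,(n+t-1)_\downarrow)$ is a universal cycle for the $t$-multisets of $\{0,1,\dots,n-1\}$ with respect to shifted difference representatives. Using $O(nt^3)$ space, it can be ranked in $O(n^2t^3)$ time and unranked in $O(n^2t^4\log(n+1))$ time, uniformly in $n,t\ge 1$ (for $n\ge 2$ the latter is $O(n^2t^4\log n)$). This holds both when the elements are given, respectively returned, as shifted difference representatives and when they are given, respectively returned, as multisets listed in non-decreasing order. -/

import Mathlib

/-! ### Strings, necklaces and the bounded-weight cycles

Strings are lists of natural numbers; `<` and `≤` on `List ℕ` are lexicographic. -/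

namespace UCycle

/-- All strings of length `n` over `{1, …, k}`, listed in lexicographic order. -/
def strings (k : ℕ) : ℕ → List (List ℕ)
  | 0 => [[]]
  | n + 1 => (List.range' 1 k).flatMap fun a => (strings k n).map fun s => a :: s

theorem mem_strings {k n : ℕ} {s : List ℕ} :
    s ∈ strings k n ↔ s.length = n ∧ ∀ x ∈ s, 1 ≤ x ∧ x ≤ k := by
  induction n generalizing s with
  | zero =>
    simp only [strings, List.mem_singleton]
    constructor
    · rintro rfl; simp
    · rintro ⟨h, -⟩; exact List.length_eq_zero_iff.mp h
  | succ n ih =>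
    simp only [strings, List.mem_flatMap, List.mem_range'_1, List.mem_map, ih]
    constructor
    · rintro ⟨a, ha, s', ⟨hl, hs⟩, rfl⟩
      refine ⟨by simp [hl], ?_⟩
      intro x hx
      rcases List.mem_cons.mp hx with rfl | hx
      · omega
      · exact hs x hx
    · rintro ⟨hl, hs⟩
      cases s with
      | nil => simp at hl
      | cons a s' =>
        have ha := hs a (by simp)
        exact ⟨a, by omega, s', ⟨by simpa using hl, fun x hx => hs x (by simp [hx])⟩, rfl⟩

theorem pairwise_strings (k n : ℕ) : (strings k n).Pairwise (· < ·) := by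
  induction n with
  | zero => simp [strings]
  | succ n ih =>
    simp only [strings, List.pairwise_flatMap, List.pairwise_map]
    refine ⟨fun a _ => ih.imp fun h => List.cons_lt_cons_iff.mpr (Or.inr ⟨rfl, h⟩), ?_⟩
    refine (List.pairwise_lt_range' (s := 1) (n := k)).imp ?_
    intro a b hab x hx y hy
    obtain ⟨x', -, rfl⟩ := List.mem_map.mp hx
    obtain ⟨y', -, rfl⟩ := List.mem_map.mp hy
    exact List.cons_lt_cons_iff.mpr (Or.inl hab)

/-- A necklace is a string that is lexicographically smallest among its rotations. -/
def IsNecklace (s : List ℕ) : Prop := ∀ i < s.length, s ≤ s.rotate i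

instance (s : List ℕ) : Decidable (IsNecklace s) :=
  inferInstanceAs (Decidable (∀ i < s.length, s ≤ s.rotate i))

/-- The necklaces of length `n` over `{1, …, k}` with weight (sum of symbols) at least `w`,
in lexicographic order. -/
def necklacesGE (k n w : ℕ) : List (List ℕ) :=
  (strings k n).filter fun s => IsNecklace s ∧ w ≤ s.sum

/-- The aperiodic prefix of `s`: the shortest prefix `p` such that `s` is a power of `p`
(`List.inits` lists the prefixes by increasing length). -/
def aperiodicPrefix (s : List ℕ) : List ℕ :=
  (s.inits.find? fun p => (List.replicate (s.length / p.length) p).flatten = s).getD s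

/-- The concatenation of the aperiodic prefixes of the necklaces of length `n` over `{1, …, k}`
with weight at least `w`, taken in lexicographic order. -/
def cycleGE (k n w : ℕ) : List ℕ := (necklacesGE k n w).flatMap aperiodicPrefix

/-- The complement of a string over `{1, …, k}` interchanges `x` and `k - x + 1`. -/
def complement (k : ℕ) (s : List ℕ) : List ℕ := s.map fun x => k + 1 - x

/-- The cycle for the strings of length `n` over `{1, …, k}` with weight at most `w`: the complement
of the cycle for weight at least `k n - w + n`. -/
def cycleLE (k n w : ℕ) : List ℕ := complement k (cycleGE k n (k * n + n - w))

/-! ### Universal cycles and ranks -/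

/-- The substring of length `len` of the cyclic sequence `U` starting at the `0`-based index `i`. -/
def window (U : List ℕ) (len i : ℕ) : List ℕ :=
  (List.range len).map fun j => U.getD ((i + j) % U.length) 0

/-- `U` is a universal cycle for `S`, the element `s` being represented by the string `rep s`: it has
length `|S|` and contains each representative exactly once as a (cyclic) substring. -/
def IsUniversalCycle {α : Type*} (U : List ℕ) (S : Set α) (rep : α → List ℕ) : Prop :=
  S.encard = U.length ∧
    ∀ s ∈ S, ∃! i, i < U.length ∧ window U (rep s).length i = rep s

/-- The rank of a string in a cyclic sequence: the (first) `1`-based index at which it starts. -/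
def rank (U s : List ℕ) : ℕ :=
  (List.range U.length).findIdx (fun i => window U s.length i = s) + 1

/-- The string of length `len` that has rank `r` in the cyclic sequence `U`. -/
def unrank (U : List ℕ) (len r : ℕ) : List ℕ := window U len (r - 1)

/-! ### Multisets and their difference representatives -/

/-- The `t`-multisets of `{0, …, n - 1}`. -/
def multisets (n t : ℕ) : Set (Multiset ℕ) := {m | m.card = t ∧ ∀ x ∈ m, x < n}

/-- The elements of a multiset in non-decreasing order. -/
def listing (m : Multiset ℕ) : List ℕ := m.sort (· ≤ ·)

/-- `diffs p [a₁, …, aₜ] = [a₁ - p, a₂ - a₁, …, aₜ - aₜ₋₁]`. -/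
def diffs : ℕ → List ℕ → List ℕ
  | _, [] => []
  | p, a :: l => (a - p) :: diffs a l

/-- The difference representative of a multiset with elements `m₁ ≤ … ≤ mₜ`:
the string `m₁, m₂ - m₁, …, mₜ - mₜ₋₁`. -/
def diffRep (m : Multiset ℕ) : List ℕ := diffs 0 (listing m)

/-- The difference representative with every symbol increased by one. -/
def shiftedDiffRep (m : Multiset ℕ) : List ℕ := (diffRep m).map (· + 1)

end UCycle

/-! ### The unit-cost RAM

A random access machine with registers `0, 1, 2, …` that hold natural numbers and are initially `0`,
direct and indirect addressing, a read-once input sequence and an output sequence. Programs are written with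
structured control flow. Every instruction and every evaluation of a test takes one unit of time,
whatever the size of the numbers. -/

namespace Ram

/-- Arithmetic operations (truncated subtraction, rounded-down division). -/
inductive Op
  | add | sub | mul | div

def Op.eval : Op → ℕ → ℕ → ℕ
  | .add, x, y => x + y
  | .sub, x, y => x - y
  | .mul, x, y => x * y
  | .div, x, y => x / y

/-- Programs; `R[i]` is the content of register `i`. -/
inductive Program
  /-- do nothing -/
  | skip
  /-- `R[d] := c` -/
  | const (d c : ℕ)
  /-- `R[d] := R[a]` -/
  | move (d a : ℕ)
  /-- `R[d] := R[a] o R[b]` -/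
  | op (o : Op) (d a b : ℕ)
  /-- `R[d] := R[R[a]]` -/
  | load (d a : ℕ)
  /-- `R[R[a]] := R[b]` -/
  | store (a b : ℕ)
  /-- remove the next number from the input and put it into `R[d]` -/
  | read (d : ℕ)
  /-- append `R[a]` to the output -/
  | write (a : ℕ)
  /-- run `p`, then `q` -/
  | seq (p q : Program)
  /-- if `R[a] ≠ 0` then run `p` else run `q` -/
  | ite (a : ℕ) (p q : Program)
  /-- while `R[a] ≠ 0` run `p` -/
  | loop (a : ℕ) (p : Program)

/-- A state of the machine: registers, remaining input, output so far. -/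
structure State where
  mem : ℕ → ℕ
  inp : List ℕ
  out : List ℕ

/-- Write `v` into register `d`. -/
def State.set (σ : State) (d v : ℕ) : State := { σ with mem := Function.update σ.mem d v }

/-- `Runs S p σ T τ`: started in state `σ`, the program `p` halts in state `τ` after exactly `T` units
of time, and every register that it reads or writes has index less than `S`. -/
inductive Runs (S : ℕ) : Program → State → ℕ → State → Prop
  | skip (σ : State) : Runs S .skip σ 1 σ
  | const (σ : State) (d c : ℕ) (hd : d < S) : Runs S (.const d c) σ 1 (σ.set d c)
  | move (σ : State) (d a : ℕ) (hd : d < S) (ha : a < S) :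
      Runs S (.move d a) σ 1 (σ.set d (σ.mem a))
  | op (σ : State) (o : Op) (d a b : ℕ) (hd : d < S) (ha : a < S) (hb : b < S) :
      Runs S (.op o d a b) σ 1 (σ.set d (o.eval (σ.mem a) (σ.mem b)))
  | load (σ : State) (d a : ℕ) (hd : d < S) (ha : a < S) (hi : σ.mem a < S) :
      Runs S (.load d a) σ 1 (σ.set d (σ.mem (σ.mem a)))
  | store (σ : State) (a b : ℕ) (ha : a < S) (hb : b < S) (hi : σ.mem a < S) :
      Runs S (.store a b) σ 1 (σ.set (σ.mem a) (σ.mem b))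
  | read (σ : State) (d x : ℕ) (l : List ℕ) (hd : d < S) (hx : σ.inp = x :: l) :
      Runs S (.read d) σ 1 { σ.set d x with inp := l }
  | write (σ : State) (a : ℕ) (ha : a < S) :
      Runs S (.write a) σ 1 { σ with out := σ.out ++ [σ.mem a] }
  | seq {p q : Program} {σ τ υ : State} {T T' : ℕ} (hp : Runs S p σ T τ) (hq : Runs S q τ T' υ) :
      Runs S (.seq p q) σ (T + T') υ
  | ite_true {a : ℕ} {p q : Program} {σ τ : State} {T : ℕ} (ha : a < S) (h : σ.mem a ≠ 0)
      (hp : Runs S p σ T τ) : Runs S (.ite a p q) σ (T + 1) τ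
  | ite_false {a : ℕ} {p q : Program} {σ τ : State} {T : ℕ} (ha : a < S) (h : σ.mem a = 0)
      (hq : Runs S q σ T τ) : Runs S (.ite a p q) σ (T + 1) τ
  | loop_done {a : ℕ} {p : Program} {σ : State} (ha : a < S) (h : σ.mem a = 0) :
      Runs S (.loop a p) σ 1 σ
  | loop_step {a : ℕ} {p : Program} {σ τ υ : State} {T T' : ℕ} (ha : a < S) (h : σ.mem a ≠ 0)
      (hp : Runs S p σ T τ) (hl : Runs S (.loop a p) τ T' υ) :
      Runs S (.loop a p) σ (T + T' + 1) υ

/-- On input `x`, with all registers `0`, the program `p` halts with output `y`, within time `T`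
and space (number of registers) `S`. -/
def Computes (p : Program) (x y : List ℕ) (T S : ℝ) : Prop :=
  ∃ (time space : ℕ) (τ : State),
    Runs space p ⟨fun _ => 0, x, []⟩ time τ ∧ τ.out = y ∧ (time : ℝ) ≤ T ∧ (space : ℝ) ≤ S

end Ram

/-! ### Structured programs with expressions and arrays

Programs are built over a store of named variables and three arrays, and reasoned about with
time-annotated Hoare triples. Variables `0, …, 31` live in the registers of the same number,
registers `32, …, 39` hold intermediate results, and entry `i` of array `k` lives in register
`40 + k + 3 * i`. -/

namespace Ram

/-! Mathematics of the cycle. Replacing `x` by `n - x` turns the necklaces involved into the strings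
of length `t` and sum less than `n` that are largest among their rotations, in decreasing order
(`maxNecklaces`). These strings of sum less than `n` are exactly the difference representatives of
the multisets. Up to adding one to every symbol, the cycle is the concatenation of their roots
(`diffCycle`). Replacing a tail of a max necklace `N` by zeros gives a max necklace again
(`IsMaxNecklace.take_append_zeros`). If it differs from `N`, the successor of `N` in the list lies
between the two and so keeps the untouched prefix. Hence the root of `N`, from index `i` on, is
followed by what is needed to read `N.rotate i`, unless `i` cuts off only zeros of the root
(`rotate_prefix_flatMap_root`). In the exceptional case the string is `0^m w` with `w 0^m = N`. It
occurs where necklaces with prefix `w` begin, because the necklace before them must end in `m`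
zeros, or else the window wraps around to the zeros at the end of the cycle (`zeros_append_occurs`,
`window_zeros_append`). So every string occurs. A root has as many symbols as its string has
rotations, so the cycle has as many positions as there are strings, and by pigeonhole each string
occurs once (`window_bijective`).

Counting. By the same correspondence, the position where a necklace starts is the number of strings
whose largest rotation exceeds it. Its complement is a number of strings all of whose rotations lie
below a prenecklace `y` of length `l`. Call `y 0, …, y (j - 1), c` with `j < l` and `c < y j` a
block. A string has all rotations below `y` exactly when it is a rotation of a nonempty
concatenation of blocks, and the rotation is unique if it is by less than the length of the first
block (`AllRotationsBelow.exists_blocks`, `rotate_blocks_ne`). Splitting off the first block gives a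
recurrence in length and weight. Cumulative sums over the weight remove the sum over `c`
(`blockCount_succ`, `countBelow_eq`), so one count takes `O(n t²)` time and `O(n t)` space.

Ranking finds the largest rotation, the length of its repeated part (by Duval's method), and then
needs one count: increasing the last symbol of the repeated part turns "exceeds" into "is at least"
while the string remains a prenecklace (`startOf_add_countBelow`). Unranking recovers the `t`
symbols of a window one by one. For each, it builds the necklace covering that position symbol by
symbol, trying symbols downwards from the largest admissible one. This needs at most about `n`
counts for each of `t` symbols, hence `O(n² t⁴)` time in all.

Programs. Both algorithms are written in a small language with expressions and arrays that expands
into RAM programs. The rules for `Triple` carry correctness, running time and register bound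
together. -/

/-- Variables, arrays, remaining input and output. -/
structure Store where
  var : ℕ → ℕ
  arr : ℕ → ℕ → ℕ
  inp : List ℕ
  out : List ℕ

namespace Store

def setVar (v : Store) (x a : ℕ) : Store := { v with var := fun y => if y = x then a else v.var y }

def setArr (v : Store) (k i a : ℕ) : Store :=
  { v with arr := fun k' i' => if k' = k ∧ i' = i then a else v.arr k' i' }

end Store

/-- Expressions over variables and arrays. -/
inductive Expr
  | lit (c : ℕ)
  | var (x : ℕ)
  | bin (o : Op) (e f : Expr)
  | get (k : ℕ) (e : Expr)

namespace Expr

def eval (v : Store) : Expr → ℕ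
  | lit c => c
  | var x => v.var x
  | bin o e f => o.eval (e.eval v) (f.eval v)
  | get k e => v.arr k (e.eval v)

/-- All array accesses in the expression have index less than `B`. -/
def Safe (B : ℕ) (v : Store) : Expr → Prop
  | lit _ => True
  | var _ => True
  | bin _ e f => e.Safe B v ∧ f.Safe B v
  | get _ e => e.Safe B v ∧ e.eval v < B

/-- The expression has valid names and can be evaluated within `r` registers. -/
def valid : ℕ → Expr → Bool
  | r, lit _ => 1 ≤ r
  | r, var x => 1 ≤ r && x < 32
  | r, bin _ e f => e.valid r && f.valid (r - 1)
  | r, get k e => k < 3 && 2 ≤ r && e.valid r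

/-- An array access takes four instructions for the address and one for the load. -/
def cost : Expr → ℕ
  | lit _ => 1
  | var _ => 1
  | bin _ e f => e.cost + f.cost + 1
  | get _ e => e.cost + 5

/-- Put into register `d` the address of the entry of array `k` whose index is in register `d`. -/
def addr (k d : ℕ) : Program :=
  .seq (.const (d + 1) 3) (.seq (.op .mul d d (d + 1))
    (.seq (.const (d + 1) (40 + k)) (.op .add d d (d + 1))))

/-- Evaluate the expression into register `d`. -/
def compile : ℕ → Expr → Program
  | d, lit c => .const d c
  | d, var x => .move d x
  | d, bin o e f => .seq (e.compile d) (.seq (f.compile (d + 1)) (.op o d d (d + 1)))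
  | d, get k e => .seq (e.compile d) (.seq (addr k d) (.load d d))

instance : OfNat Expr n := ⟨lit n⟩
instance : Add Expr := ⟨bin .add⟩
instance : Sub Expr := ⟨bin .sub⟩
instance : Mul Expr := ⟨bin .mul⟩
instance : Div Expr := ⟨bin .div⟩

variable (v : Store) (B : ℕ)

@[simp] theorem eval_var (x : ℕ) : (var x).eval v = v.var x := rfl
@[simp] theorem eval_get (k : ℕ) (e : Expr) : (get k e).eval v = v.arr k (e.eval v) := rfl
@[simp] theorem eval_ofNat (n : ℕ) [n.AtLeastTwo] :
    (ofNat(n) : Expr).eval v = OfNat.ofNat n := rfl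
@[simp] theorem eval_zero : (0 : Expr).eval v = 0 := rfl
@[simp] theorem eval_one : (1 : Expr).eval v = 1 := rfl
@[simp] theorem eval_add (e f : Expr) : (e + f).eval v = e.eval v + f.eval v := rfl
@[simp] theorem eval_sub (e f : Expr) : (e - f).eval v = e.eval v - f.eval v := rfl
@[simp] theorem eval_mul (e f : Expr) : (e * f).eval v = e.eval v * f.eval v := rfl
@[simp] theorem eval_div (e f : Expr) : (e / f).eval v = e.eval v / f.eval v := rfl

@[simp] theorem safe_var (x : ℕ) : (var x).Safe B v ↔ True := Iff.rfl
@[simp] theorem safe_get (k : ℕ) (e : Expr) :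
    (get k e).Safe B v ↔ e.Safe B v ∧ e.eval v < B := Iff.rfl
@[simp] theorem safe_ofNat (n : ℕ) [n.AtLeastTwo] :
    (ofNat(n) : Expr).Safe B v ↔ True := Iff.rfl
@[simp] theorem safe_zero : (0 : Expr).Safe B v ↔ True := Iff.rfl
@[simp] theorem safe_one : (1 : Expr).Safe B v ↔ True := Iff.rfl
@[simp] theorem safe_add (e f : Expr) : (e + f).Safe B v ↔ e.Safe B v ∧ f.Safe B v := Iff.rfl
@[simp] theorem safe_sub (e f : Expr) : (e - f).Safe B v ↔ e.Safe B v ∧ f.Safe B v := Iff.rfl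
@[simp] theorem safe_mul (e f : Expr) : (e * f).Safe B v ↔ e.Safe B v ∧ f.Safe B v := Iff.rfl
@[simp] theorem safe_div (e f : Expr) : (e / f).Safe B v ↔ e.Safe B v ∧ f.Safe B v := Iff.rfl

end Expr

/-! ### Correctness of compiled expressions. -/

/-- The state `σ` of the machine represents the store `v`. -/
structure Rep (σ : State) (v : Store) : Prop where
  var : ∀ x < 32, σ.mem x = v.var x
  arr : ∀ k < 3, ∀ i, σ.mem (40 + k + 3 * i) = v.arr k i
  inp : σ.inp = v.inp
  out : σ.out = v.out

/-- `τ` agrees with `σ` except for the temporary registers from `d` on. -/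
structure AgreeBelow (d : ℕ) (σ τ : State) : Prop where
  mem : ∀ a, a < d ∨ 40 ≤ a → τ.mem a = σ.mem a
  inp : τ.inp = σ.inp
  out : τ.out = σ.out

theorem AgreeBelow.trans {d d' : ℕ} {σ τ υ : State} (h : AgreeBelow d σ τ)
    (h' : AgreeBelow d' τ υ) (hd : d ≤ d') : AgreeBelow d σ υ :=
  ⟨fun a ha => (h'.mem a (by omega)).trans (h.mem a ha), h'.inp.trans h.inp, h'.out.trans h.out⟩

theorem AgreeBelow.rep {d : ℕ} {σ τ : State} {v : Store} (h : AgreeBelow d σ τ) (hd : 32 ≤ d)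
    (hr : Rep σ v) : Rep τ v :=
  ⟨fun x hx => (h.mem x (by omega)).trans (hr.var x hx),
    fun k hk i => (h.mem _ (by omega)).trans (hr.arr k hk i),
    h.inp.trans hr.inp, h.out.trans hr.out⟩

theorem agreeBelow_set {d d' : ℕ} (σ : State) (a : ℕ) (h1 : d ≤ d') (h2 : d' < 40) :
    AgreeBelow d σ (σ.set d' a) := by
  refine ⟨fun b hb => ?_, rfl, rfl⟩
  simp only [State.set]
  rw [Function.update_of_ne (by omega)]

theorem runs_addr {S k d : ℕ} (σ : State) (hS : 40 ≤ S) (hd : d + 2 ≤ 40) :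
    ∃ τ, Runs S (Expr.addr k d) σ 4 τ ∧ τ.mem d = 40 + k + 3 * σ.mem d ∧ AgreeBelow d σ τ := by
  have h1 : d < S := by omega
  have h2 : d + 1 < S := by omega
  refine ⟨_, .seq (.const _ _ _ h2) (.seq (.op _ _ _ _ _ h1 h1 h2)
    (.seq (.const _ _ _ h2) (.op _ _ _ _ _ h1 h1 h2))), ?_, ?_⟩
  · simp [State.set, Op.eval]; ring
  · refine ⟨fun b hb => ?_, rfl, rfl⟩
    simp only [State.set]
    iterate 4 rw [Function.update_of_ne (by omega)]

theorem Expr.pos_of_valid {r : ℕ} (e : Expr) (h : e.valid r = true) : 0 < r := by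
  induction e generalizing r <;> simp_all [valid] <;> omega

/-- Evaluation into register `d` disturbs only temporaries from `d` on. The value of a left operand
therefore survives in `d` while the right one is computed from `d + 1` on. -/
theorem Expr.runs_compile {B : ℕ} {v : Store} (e : Expr) : ∀ {d : ℕ} {σ : State}, Rep σ v →
    32 ≤ d → d ≤ 40 → e.valid (40 - d) = true → e.Safe B v →
    ∃ τ, Runs (40 + 3 * B) (e.compile d) σ e.cost τ ∧ τ.mem d = e.eval v ∧ AgreeBelow d σ τ := by
  induction e with
  | lit c =>
    intro d σ _ _ hd hv _
    simp only [valid, decide_eq_true_eq] at hv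
    exact ⟨_, .const _ _ _ (by omega), by simp [State.set, eval],
      agreeBelow_set σ _ le_rfl (by omega)⟩
  | var x =>
    intro d σ hr _ hd hv _
    simp only [valid, Bool.and_eq_true, decide_eq_true_eq] at hv
    exact ⟨_, .move _ _ _ (by omega) (by omega), by simp [State.set, hr.var x hv.2],
      agreeBelow_set σ _ le_rfl (by omega)⟩
  | bin o e f ihe ihf =>
    intro d σ hr h32 hd hv hs
    simp only [valid, Bool.and_eq_true] at hv
    have hd' := e.pos_of_valid hv.1
    have h1 := f.pos_of_valid hv.2
    obtain ⟨τ, hτ, hτe, hστ⟩ := ihe hr h32 hd hv.1 hs.1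
    obtain ⟨υ, hυ, hυf, hτυ⟩ := ihf (d := d + 1) (hστ.rep h32 hr) (by omega) (by omega)
      (by rw [← hv.2]; congr 1) hs.2
    refine ⟨υ.set d (o.eval (υ.mem d) (υ.mem (d + 1))), ?_, ?_,
      (hστ.trans hτυ (by omega)).trans (agreeBelow_set υ _ le_rfl (by omega)) le_rfl⟩
    · have := Runs.seq hτ (Runs.seq hυ (Runs.op υ o d d (d + 1) (S := 40 + 3 * B) (by omega)
        (by omega) (by omega)))
      rwa [← add_assoc] at this
    · simp [State.set, hυf, hτυ.mem d (by omega), hτe, eval]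
  | get k e ih =>
    intro d σ hr h32 hd hv hs
    simp only [valid, Bool.and_eq_true, decide_eq_true_eq] at hv
    obtain ⟨τ, hτ, hτe, hστ⟩ := ih hr h32 hd hv.2 hs.1
    obtain ⟨υ, hυ, hυd, hτυ⟩ := runs_addr (S := 40 + 3 * B) (k := k) (d := d) τ (by omega) (by omega)
    have hlt := hs.2
    have hr' := (hστ.trans hτυ le_rfl).rep h32 hr
    refine ⟨υ.set d (υ.mem (υ.mem d)), ?_, ?_,
      (hστ.trans hτυ le_rfl).trans (agreeBelow_set υ _ le_rfl (by omega)) le_rfl⟩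
    · exact Runs.seq hτ (Runs.seq hυ (Runs.load υ d d (by omega) (by omega)
        (by rw [hυd, hτe]; omega)))
    · simp only [State.set, Function.update_self, hυd, hτe, eval]
      exact hr'.arr k hv.1.1 _

/-! ### Compiled statements. -/

/-- `x := e` -/
def assign (x : ℕ) (e : Expr) : Program := .seq (e.compile 32) (.move x 32)

/-- `k[e] := f` -/
def put (k : ℕ) (e f : Expr) : Program :=
  .seq (e.compile 32) (.seq (Expr.addr k 32) (.seq (f.compile 33) (.store 32 33)))

/-- Append the value of `e` to the output. -/
def print (e : Expr) : Program := .seq (e.compile 32) (.write 32)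

/-- While `e` is nonzero, run `p`. -/
def whileDo (e : Expr) (p : Program) : Program :=
  .seq (e.compile 32) (.loop 32 (.seq p (e.compile 32)))

/-- If `e` is nonzero, run `p`, otherwise `q`. -/
def ifElse (e : Expr) (p q : Program) : Program := .seq (e.compile 32) (.ite 32 p q)

/-- The expression is valid, with a uniform bound on its cost. -/
def Expr.ok (e : Expr) : Bool := e.valid 7 && e.cost ≤ 90

/-- The requirement of `ok` to fit into 7 temporaries leaves room for `put`, which keeps an address
in register 32 while it evaluates into 33 to 39. -/
theorem Expr.run {B : ℕ} {v : Store} {e : Expr} {d : ℕ} {σ : State} (hr : Rep σ v)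
    (hv : e.ok = true) (hs : e.Safe B v) (h32 : 32 ≤ d) (hd : d ≤ 33) :
    ∃ T ≤ 90, ∃ τ, Runs (40 + 3 * B) (e.compile d) σ T τ ∧ τ.mem d = e.eval v ∧
      AgreeBelow d σ τ := by
  simp only [ok, Bool.and_eq_true, decide_eq_true_eq] at hv
  have hmono : ∀ (e : Expr) (r s : ℕ), r ≤ s → e.valid r = true → e.valid s = true := by
    intro e
    induction e with
    | lit c => intro r s h; simp only [valid, decide_eq_true_eq]; omega
    | var x => intro r s h; simp only [valid, Bool.and_eq_true, decide_eq_true_eq]; omega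
    | bin o e f ihe ihf =>
      intro r s h hv
      simp only [valid, Bool.and_eq_true] at hv ⊢
      exact ⟨ihe r s h hv.1, ihf (r - 1) (s - 1) (by omega) hv.2⟩
    | get k e ih =>
      intro r s h hv
      simp only [valid, Bool.and_eq_true, decide_eq_true_eq] at hv ⊢
      exact ⟨⟨hv.1.1, by omega⟩, ih r s h hv.2⟩
  obtain ⟨τ, h1, h2, h3⟩ := e.runs_compile hr h32 (by omega)
    (hmono e 7 _ (by omega) hv.1) hs
  exact ⟨_, hv.2, τ, h1, h2, h3⟩

/-! ### Hoare triples with time bounds. -/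

/-- Started in any state that represents `v`, the program `p` halts within time `T`, accessing array
entries with index less than `B` only, in a state that represents a store with property `Q`. -/
def Triple (B : ℕ) (p : Program) (v : Store) (T : ℕ) (Q : Store → Prop) : Prop :=
  ∀ σ, Rep σ v → ∃ T' ≤ T, ∃ τ v', Runs (40 + 3 * B) p σ T' τ ∧ Rep τ v' ∧ Q v'

namespace Triple

variable {B : ℕ} {v : Store} {p q : Program} {T T' : ℕ} {Q R : Store → Prop}

theorem mono (h : Triple B p v T Q) (hT : T ≤ T') (hQ : ∀ v', Q v' → R v') :
    Triple B p v T' R := fun σ hr => by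
  obtain ⟨T₁, h1, τ, v', h2, h3, h4⟩ := h σ hr
  exact ⟨T₁, h1.trans hT, τ, v', h2, h3, hQ _ h4⟩

theorem seq (hp : Triple B p v T R) (hq : ∀ v', R v' → Triple B q v' T' Q) :
    Triple B (.seq p q) v (T + T') Q := fun σ hr => by
  obtain ⟨T₁, h1, τ, v', h2, h3, h4⟩ := hp σ hr
  obtain ⟨T₂, h5, υ, v'', h6, h7, h8⟩ := hq v' h4 τ h3
  exact ⟨T₁ + T₂, by omega, υ, v'', .seq h2 h6, h7, h8⟩

theorem skip (hQ : Q v) : Triple B .skip v 1 Q := fun σ hr => ⟨1, le_rfl, σ, v, .skip σ, hr, hQ⟩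

theorem assign {x : ℕ} {e : Expr} (hx : x < 32) (he : e.ok = true) (hs : e.Safe B v)
    (hQ : Q (v.setVar x (e.eval v))) : Triple B (assign x e) v 100 Q := fun σ hr => by
  obtain ⟨T₁, h1, τ, h2, h3, h4⟩ := Expr.run hr he hs le_rfl (by omega)
  refine ⟨T₁ + 1, by omega, _, _, .seq h2 (.move τ x 32 (by omega) (by omega)), ?_, hQ⟩
  have hr' := h4.rep le_rfl hr
  refine ⟨fun y hy => ?_, fun k hk i => ?_, hr'.inp, hr'.out⟩
  · by_cases hyx : y = x
    · simp [State.set, Store.setVar, hyx, h3]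
    · simp [State.set, Store.setVar, hyx, hr'.var y hy]
  · simp only [State.set, Store.setVar]
    rw [Function.update_of_ne (by omega), hr'.arr k hk]

theorem put {k : ℕ} {e f : Expr} (hk : k < 3) (he : e.ok = true) (hf : f.ok = true)
    (hse : e.Safe B v) (hsf : f.Safe B v) (hi : e.eval v < B)
    (hQ : Q (v.setArr k (e.eval v) (f.eval v))) : Triple B (put k e f) v 200 Q := fun σ hr => by
  obtain ⟨T₁, h1, τ, h2, h3, h4⟩ := Expr.run hr he hse le_rfl (by omega)
  obtain ⟨υ, h5, h6, h7⟩ := runs_addr (S := 40 + 3 * B) (k := k) (d := 32) τ (by omega) (by omega)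
  have hυ := (h4.trans h7 le_rfl).rep le_rfl hr
  obtain ⟨T₂, h8, φ, h9, h10, h11⟩ := Expr.run hυ hf hsf (d := 33) (by omega) (by omega)
  have hφ := h11.rep (by omega) hυ
  have haddr : φ.mem 32 = 40 + k + 3 * e.eval v := by
    rw [h11.mem 32 (by omega), h6, h3]
  refine ⟨T₁ + (4 + (T₂ + 1)), by omega, _, _, .seq h2 (.seq h5 (.seq h9
    (.store φ 32 33 (by omega) (by omega) (by omega)))), ?_, hQ⟩
  rw [haddr, h10]
  refine ⟨fun y hy => ?_, fun k' hk' i => ?_, hφ.inp, hφ.out⟩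
  · simp only [State.set, Store.setArr]
    rw [Function.update_of_ne (by omega), hφ.var y hy]
  · simp only [State.set, Store.setArr]
    by_cases h : k' = k ∧ i = e.eval v
    · obtain ⟨rfl, rfl⟩ := h
      simp
    · rw [if_neg h, Function.update_of_ne (by omega), hφ.arr k' hk']

theorem read {x a : ℕ} {l : List ℕ} (hx : x < 32) (hl : v.inp = a :: l)
    (hQ : Q { v.setVar x a with inp := l }) : Triple B (.read x) v 1 Q := fun σ hr => by
  refine ⟨1, le_rfl, _, _, .read σ x a l (by omega) (hr.inp.trans hl), ?_, hQ⟩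
  refine ⟨fun y hy => ?_, fun k hk i => ?_, rfl, hr.out⟩
  · by_cases hyx : y = x
    · simp [State.set, Store.setVar, hyx]
    · simp [State.set, Store.setVar, hyx, hr.var y hy]
  · simp only [State.set, Store.setVar]
    rw [Function.update_of_ne (by omega), hr.arr k hk]

theorem print {e : Expr} (he : e.ok = true) (hs : e.Safe B v)
    (hQ : Q { v with out := v.out ++ [e.eval v] }) : Triple B (print e) v 100 Q := fun σ hr => by
  obtain ⟨T₁, h1, τ, h2, h3, h4⟩ := Expr.run hr he hs le_rfl (by omega)
  have hr' := h4.rep le_rfl hr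
  refine ⟨T₁ + 1, by omega, _, _, .seq h2 (.write τ 32 (by omega)), ?_, hQ⟩
  exact ⟨hr'.var, hr'.arr, hr'.inp, by simp [h3, hr'.out]⟩

theorem ifElse {e : Expr} (he : e.ok = true) (hs : e.Safe B v)
    (hp : e.eval v ≠ 0 → Triple B p v T Q) (hq : e.eval v = 0 → Triple B q v T Q) :
    Triple B (ifElse e p q) v (T + 100) Q := fun σ hr => by
  obtain ⟨T₁, h1, τ, h2, h3, h4⟩ := Expr.run hr he hs le_rfl (by omega)
  have hr' := h4.rep le_rfl hr
  by_cases h : e.eval v = 0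
  · obtain ⟨T₂, h5, υ, v', h6, h7, h8⟩ := hq h τ hr'
    exact ⟨T₁ + (T₂ + 1), by omega, υ, v', .seq h2 (.ite_false (by omega) (h3.trans h) h6), h7, h8⟩
  · obtain ⟨T₂, h5, υ, v', h6, h7, h8⟩ := hp h τ hr'
    exact ⟨T₁ + (T₂ + 1), by omega, υ, v', .seq h2 (.ite_true (by omega) (h3 ▸ h) h6), h7, h8⟩

/-- A loop that runs `N` times, with an invariant indexed by the number of completed rounds. -/
theorem whileDo {e : Expr} (I : ℕ → Store → Prop) (N : ℕ) (he : e.ok = true)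
    (hs : ∀ i ≤ N, ∀ v, I i v → e.Safe B v)
    (hstep : ∀ i < N, ∀ v, I i v → e.eval v ≠ 0 ∧ Triple B p v T (I (i + 1)))
    (hend : ∀ v, I N v → e.eval v = 0) (h0 : I 0 v) (hQ : ∀ v', I N v' → Q v') :
    Triple B (whileDo e p) v (N * (T + 100) + 100) Q := by
  -- Induction on the number `j` of rounds left. The body ends by evaluating the test again into
  -- register 32, which costs at most 90, and the loop step itself costs 1.
  have key : ∀ j ≤ N, ∀ (v : Store) (σ : State), I (N - j) v → Rep σ v → σ.mem 32 = e.eval v →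
      ∃ T' ≤ j * (T + 91) + 1, ∃ τ v', Runs (40 + 3 * B) (.loop 32 (.seq p (e.compile 32))) σ T' τ ∧
        Rep τ v' ∧ I N v' := by
    intro j
    induction j with
    | zero =>
      intro _ v σ hI hr hm
      exact ⟨1, by omega, σ, v, .loop_done (by omega) (hm.trans (hend v hI)), hr, hI⟩
    | succ j ih =>
      intro hj v σ hI hr hm
      obtain ⟨hne, ht⟩ := hstep _ (by omega) v hI
      obtain ⟨T₁, h1, τ, v', h2, h3, h4⟩ := ht σ hr
      rw [show N - (j + 1) + 1 = N - j by omega] at h4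
      obtain ⟨T₂, h5, υ, h6, h7, h8⟩ := Expr.run h3 he (hs _ (by omega) v' h4) le_rfl (by omega)
      obtain ⟨T₃, h9, φ, v'', h10, h11, h12⟩ := ih (by omega) v' υ h4 (h8.rep le_rfl h3) h7
      refine ⟨T₁ + T₂ + T₃ + 1, ?_, φ, v'', .loop_step (by omega) (by rwa [hm]) (.seq h2 h6) h10,
        h11, h12⟩
      rw [Nat.succ_mul]
      omega
  intro σ hr
  obtain ⟨T₁, h1, τ, h2, h3, h4⟩ := Expr.run hr he (hs 0 (by omega) v h0) le_rfl (by omega)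
  obtain ⟨T₂, h5, υ, v', h6, h7, h8⟩ := key N le_rfl v τ (by simpa using h0) (h4.rep le_rfl hr) h3
  refine ⟨T₁ + T₂, ?_, υ, v', .seq h2 h6, h7, hQ _ h8⟩
  nlinarith

end Triple

theorem computes_of_triple {B T : ℕ} {p : Program} {x y : List ℕ} {T' S' : ℝ}
    (h : Triple B p ⟨fun _ => 0, fun _ _ => 0, x, []⟩ T fun v => v.out = y)
    (hT : (T : ℝ) ≤ T') (hS : ((40 + 3 * B : ℕ) : ℝ) ≤ S') : Computes p x y T' S' := by
  obtain ⟨T₁, h1, τ, v', h2, h3, h4⟩ := h ⟨fun _ => 0, x, []⟩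
    ⟨fun _ _ => rfl, fun _ _ _ => rfl, rfl, rfl⟩
  exact ⟨T₁, _, τ, h2, h3.out.trans h4, (Nat.cast_le.mpr h1).trans hT, hS⟩

end Ram

namespace UCycle

/-! ### Strings all of whose rotations are smaller than a given prenecklace -/

/-- The string `y 0, …, y (j - 1)`. -/
def prefixOf (y : ℕ → ℕ) (j : ℕ) : List ℕ := (List.range j).map y

@[simp] theorem length_prefixOf (y : ℕ → ℕ) (j : ℕ) : (prefixOf y j).length = j := by
  simp [prefixOf]

@[simp] theorem getElem_prefixOf (y : ℕ → ℕ) (j i : ℕ) (h : i < (prefixOf y j).length) :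
    (prefixOf y j)[i] = y i := by
  simp [prefixOf]

theorem prefixOf_succ (y : ℕ → ℕ) (j : ℕ) : prefixOf y (j + 1) = prefixOf y j ++ [y j] := by
  simp [prefixOf, List.range_succ]

theorem sum_prefixOf (y : ℕ → ℕ) (j : ℕ) : (prefixOf y j).sum = ∑ i ∈ Finset.range j, y i := by
  induction j with
  | zero => simp [prefixOf]
  | succ j ih => rw [prefixOf_succ, List.sum_append, ih, Finset.sum_range_succ]; simp

theorem prefixOf_congr {y y' : ℕ → ℕ} {j : ℕ} (h : ∀ r < j, y r = y' r) :
    prefixOf y j = prefixOf y' j :=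
  List.map_congr_left fun r hr => h r (List.mem_range.mp hr)

theorem take_prefixOf (y : ℕ → ℕ) {i j : ℕ} (h : i ≤ j) :
    (prefixOf y j).take i = prefixOf y i := by
  simp [prefixOf, ← List.map_take, List.take_range, h]

theorem prefixOf_isPrefix (y : ℕ → ℕ) {i j : ℕ} (h : i ≤ j) : prefixOf y i <+: prefixOf y j :=
  take_prefixOf y h ▸ List.take_prefix _ _

theorem drop_prefixOf (y : ℕ → ℕ) (i j : ℕ) :
    (prefixOf y j).drop i = prefixOf (fun r => y (i + r)) (j - i) := by
  apply List.ext_getElem <;> simp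

/-- `z` starts with a string that agrees with `y` up to some index less than `l` and has a smaller
symbol there. -/
def HasBlock (y : ℕ → ℕ) (l : ℕ) (z : List ℕ) : Prop :=
  ∃ j < l, ∃ c < y j, prefixOf y j ++ [c] <+: z

/-- `y 0, …, y (l - 1)` is a prefix of a string that is maximal among its rotations: none of its
suffixes exceeds the prefix of the same length. -/
def IsPre (y : ℕ → ℕ) (l : ℕ) : Prop :=
  ∀ i, 1 ≤ i → ∀ q, i + q < l → (∀ r < q, y (i + r) = y r) → y (i + q) ≤ y q

/-- Concatenations of blocks `y 0, …, y (j - 1), c` with `j < l` and `c < y j`. -/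
inductive Blocks (y : ℕ → ℕ) (l : ℕ) : List ℕ → Prop
  | nil : Blocks y l []
  | cons {j c : ℕ} {z : List ℕ} (hj : j < l) (hc : c < y j) (hz : Blocks y l z) :
      Blocks y l (prefixOf y j ++ c :: z)

variable {y : ℕ → ℕ} {l : ℕ}

theorem HasBlock.mono {z z' : List ℕ} (h : HasBlock y l z) (hz : z <+: z') : HasBlock y l z' := by
  obtain ⟨j, hj, c, hc, hp⟩ := h
  exact ⟨j, hj, c, hc, hp.trans hz⟩

theorem prefix_getElem_of_block {j c : ℕ} {z : List ℕ} (h : prefixOf y j ++ [c] <+: z) :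
    ∃ hj : j < z.length, z[j] = c ∧ ∀ r (hr : r < j), z[r] = y r := by
  have hl := h.length_le
  simp only [List.length_append, length_prefixOf, List.length_singleton] at hl
  refine ⟨by omega, ?_, fun r hr => ?_⟩
  · rw [← h.getElem (i := j) (by simp)]; simp
  · rw [← h.getElem (i := r) (by simp; omega), List.getElem_append_left (by simpa using hr)]; simp

/-- The last symbol of a block differs from the symbol of `y` at its place. -/
theorem not_hasBlock_prefixOf (y : ℕ → ℕ) (l j : ℕ) : ¬ HasBlock y l (prefixOf y j) := by
  rintro ⟨i, -, c, hc, hp⟩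
  obtain ⟨hi, h1, -⟩ := prefix_getElem_of_block hp
  simp at h1
  omega

/-- If one block were shorter, the longer one would agree with `y` where the shorter one is below
it. -/
theorem block_unique {j c j' c' : ℕ} {z : List ℕ} (hc : c < y j) (hc' : c' < y j')
    (h : prefixOf y j ++ [c] <+: z) (h' : prefixOf y j' ++ [c'] <+: z) : j = j' ∧ c = c' := by
  obtain ⟨h1, h2, h3⟩ := prefix_getElem_of_block h
  obtain ⟨h1', h2', h3'⟩ := prefix_getElem_of_block h'
  rcases lt_trichotomy j j' with hj | rfl | hj
  · have := h3' j hj; omega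
  · exact ⟨rfl, h2.symm.trans h2'⟩
  · have := h3 j' hj; omega

/-- Nonempty suffixes of blocks start with a block. -/
theorem hasBlock_drop_block (hy : IsPre y l) {i j c : ℕ} (hj : j < l) (hc : c < y j) (hi : i ≤ j) :
    HasBlock y l ((prefixOf y j ++ [c]).drop i) := by
  rcases Nat.eq_zero_or_pos i with rfl | hi0
  · exact ⟨j, hj, c, hc, by simp⟩
  rw [List.drop_append_of_le_length (by simpa using hi), drop_prefixOf]
  -- Compare the part of the block from `i` on with `y` itself. At the first disagreement the
  -- prenecklace property makes it smaller, which completes a block. Without disagreement the last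
  -- symbol does, since `c < y j ≤ y (j - i)`.
  by_cases hmis : ∃ q, i + q < j ∧ y (i + q) ≠ y q
  · classical
    have hq := Nat.find_spec hmis
    have hmin := fun r (hr : r < Nat.find hmis) => Nat.find_min hmis hr
    set q := Nat.find hmis
    have heq : ∀ r < q, y (i + r) = y r := fun r hr => by
      by_contra h
      exact hmin r hr ⟨by omega, h⟩
    refine ⟨q, by omega, y (i + q), lt_of_le_of_ne (hy i hi0 q (by omega) heq) hq.2, ?_⟩
    have := prefixOf_succ (fun r => y (i + r)) q
    rw [prefixOf_congr heq] at this
    rw [← this]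
    exact (prefixOf_isPrefix _ (by omega)).trans (List.prefix_append _ _)
  · push Not at hmis
    have h1 : prefixOf (fun r => y (i + r)) (j - i) = prefixOf y (j - i) :=
      prefixOf_congr fun r hr => hmis r (by omega)
    have h2 := hy i hi0 (j - i) (by omega) fun r hr => hmis r (by omega)
    rw [show i + (j - i) = j by omega] at h2
    exact ⟨j - i, by omega, c, by omega, by rw [h1]⟩

theorem suffix_append_cases {α : Type*} {x a b : List α} (h : x <:+ a ++ b) :
    x <:+ b ∨ ∃ s, x = s ++ b ∧ s <:+ a := by
  obtain ⟨w, hw⟩ := h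
  rcases List.append_eq_append_iff.mp hw with ⟨s, h1, h2⟩ | ⟨s, h1, h2⟩
  · exact Or.inr ⟨s, h2, w, h1.symm⟩
  · exact Or.inl ⟨s, h2.symm⟩

/-- A suffix either lies within the later blocks or begins inside the first one, where
`hasBlock_drop_block` applies. -/
theorem Blocks.hasBlock_of_suffix (hy : IsPre y l) {z x : List ℕ} (hz : Blocks y l z)
    (hx : x <:+ z) (hne : x ≠ []) : HasBlock y l x := by
  induction hz with
  | nil => exact absurd (List.suffix_nil.mp hx) hne
  | @cons j c z hj hc hz ih =>
    rw [show prefixOf y j ++ c :: z = (prefixOf y j ++ [c]) ++ z by simp] at hx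
    rcases suffix_append_cases hx with h | ⟨s, rfl, h⟩
    · exact ih h
    · have hs : s = [] ∨ ∃ i ≤ j, s = (prefixOf y j ++ [c]).drop i := by
        rw [List.suffix_iff_eq_drop] at h
        by_cases h0 : s = []
        · exact Or.inl h0
        · refine Or.inr ⟨_, ?_, h⟩
          have := List.length_pos_of_ne_nil h0
          simp
          omega
      rcases hs with rfl | ⟨i, hi, rfl⟩
      · exact ih (by simp)
      · exact (hasBlock_drop_block hy hj hc hi).mono (List.prefix_append _ _)

theorem blocks_of_suffixes {z : List ℕ} (h : ∀ x, x <:+ z → x ≠ [] → HasBlock y l x) :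
    Blocks y l z := by
  induction hn : z.length using Nat.strong_induction_on generalizing z with
  | _ n ih =>
    by_cases h0 : z = []
    · exact h0 ▸ Blocks.nil
    · obtain ⟨j, hj, c, hc, x, rfl⟩ := h z (List.suffix_refl z) h0
      have := ih x.length (by rw [← hn]; simp; omega) (z := x)
        (fun x' hx' => h x' (hx'.trans (List.suffix_append _ _))) rfl
      simpa using Blocks.cons hj hc this

/-- Every rotation of `z` starts with a block. -/
def AllRotationsBelow (y : ℕ → ℕ) (l : ℕ) (z : List ℕ) : Prop := ∀ i, HasBlock y l (z.rotate i)

theorem Blocks.allRotationsBelow (hy : IsPre y l) {z : List ℕ} (hz : Blocks y l z) (h0 : z ≠ []) :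
    AllRotationsBelow y l z := by
  intro i
  rw [← List.rotate_mod]
  have hi := Nat.mod_lt i (List.length_pos_of_ne_nil h0)
  rw [List.rotate_eq_drop_append_take hi.le]
  refine (hz.hasBlock_of_suffix hy (List.drop_suffix _ _) ?_).mono (List.prefix_append _ _)
  simpa using hi

/-- If a block starts inside `x` and `x` is followed by a prefix of `y`, then it ends inside `x`. -/
theorem hasBlock_of_append_prefixOf (hy : IsPre y l) {x : List ℕ} {e : ℕ}
    (h : HasBlock y l (x ++ prefixOf y e)) : HasBlock y l x := by
  obtain ⟨j, hj, c, hc, hp⟩ := h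
  rcases le_or_gt (j + 1) x.length with hle | hlt
  · exact ⟨j, hj, c, hc, List.prefix_of_prefix_length_le hp (List.prefix_append _ _) (by simpa)⟩
  · exfalso
    -- Were the block to end beyond `x`, the part of it beyond `x` would itself start with a block,
    -- inside a prefix of `y`.
    have hb := hasBlock_drop_block hy hj hc (i := x.length) (by omega)
    have hp' := hp.drop x.length
    rw [List.drop_left] at hp'
    exact not_hasBlock_prefixOf y l e (hb.mono hp')

/-- A string with all rotations below is a rotation of a concatenation of blocks, by less than the
length of the first block. -/
theorem AllRotationsBelow.exists_blocks (hy : IsPre y l) {s : List ℕ}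
    (h : AllRotationsBelow y l s) :
    ∃ j c z i, j < l ∧ c < y j ∧ i ≤ j ∧ Blocks y l z ∧ (prefixOf y j ++ c :: z).rotate i = s := by
  classical
  -- The longest suffix of `s` that does not start with a block; it will be moved to the front.
  have hex : ∃ k, ¬ HasBlock y l (s.drop k) := ⟨s.length, by
    simpa [prefixOf] using not_hasBlock_prefixOf y l 0⟩
  have hk := Nat.find_spec hex
  have hmin : ∀ k' < Nat.find hex, HasBlock y l (s.drop k') := fun k' hk' =>
    not_not.mp (Nat.find_min hex hk')
  have hks : Nat.find hex ≤ s.length := Nat.find_min' hex (by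
    simpa [prefixOf] using not_hasBlock_prefixOf y l 0)
  set k := Nat.find hex with hkdef
  have hk0 : k ≠ 0 := by
    intro h0
    have := h 0
    rw [h0] at hk
    simp at this hk
    exact hk this
  have hsl : 0 < s.length := by omega
  -- the suffix without a block is a prefix of `y`
  have hpre : s.drop k = prefixOf y (s.length - k) := by
    have hr := h k
    rw [List.rotate_eq_drop_append_take hks] at hr
    obtain ⟨j, hj, c, hc, hp⟩ := hr
    have hlt : s.length - k < j + 1 := by
      by_contra hle
      refine hk ⟨j, hj, c, hc, List.prefix_of_prefix_length_le hp (List.prefix_append _ _) ?_⟩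
      simp
      omega
    have h1 : prefixOf y (s.length - k) <+: s.drop k ++ s.take k :=
      ((prefixOf_isPrefix y (by omega)).trans (List.prefix_append _ _)).trans hp
    exact ((List.prefix_of_prefix_length_le h1 (List.prefix_append _ _) (by simp)).eq_of_length
      (by simp)).symm
  set e := s.length - k with he
  have hel : e < l := by
    obtain ⟨j, hj, c, hc, hp⟩ := h k
    by_contra hle
    refine hk ⟨j, hj, c, hc, ?_⟩
    rw [List.rotate_eq_drop_append_take hks] at hp
    exact List.prefix_of_prefix_length_le hp (List.prefix_append _ _) (by simp; omega)
  have hs : s = s.take k ++ prefixOf y e := by rw [← hpre, List.take_append_drop]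
  -- Every nonempty suffix starts with a block. One inside `s.take k` is followed in `s` by a prefix
  -- of `y` and starts before `k`. One that reaches into the moved prefix is, up to a following
  -- prefix of `y`, a rotation of `s`. In both cases `hasBlock_of_append_prefixOf` discards what
  -- follows.
  have hz : Blocks y l (prefixOf y e ++ s.take k) := by
    apply blocks_of_suffixes
    have hsuf : ∀ x, x <:+ s.take k → x ≠ [] → HasBlock y l x := by
      intro x hx hne
      apply hasBlock_of_append_prefixOf hy (e := e)
      obtain ⟨w, hw⟩ := hx
      have hxe : x ++ prefixOf y e = s.drop w.length := by
        conv_rhs => rw [hs, ← hw]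
        simp
      rw [hxe]
      apply hmin
      have := congrArg List.length hw
      have := List.length_pos_of_ne_nil hne
      simp at *
      omega
    intro x hx hne
    rcases suffix_append_cases hx with h' | ⟨r, rfl, hr⟩
    · exact hsuf x h' hne
    · rw [List.suffix_iff_eq_drop, length_prefixOf] at hr
      obtain ⟨a, ha, hae⟩ : ∃ a, e - r.length = a ∧ a ≤ e := ⟨_, rfl, by omega⟩
      rw [ha] at hr
      apply hasBlock_of_append_prefixOf hy (e := a)
      have hrot := h (k + a)
      rw [← List.rotate_rotate, List.rotate_eq_drop_append_take hks, hpre,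
        List.rotate_eq_drop_append_take (by simp; omega),
        List.drop_append_of_le_length (by simpa using hae), ← hr,
        List.take_append_of_le_length (by simpa using hae), take_prefixOf _ hae] at hrot
      exact hrot
  have hrot : (prefixOf y e ++ s.take k).rotate e = s := by
    conv_rhs => rw [hs]
    have := List.rotate_append_length_eq (prefixOf y e) (s.take k)
    rwa [length_prefixOf] at this
  obtain ⟨j, c, z, hj, hc, hz', hjz⟩ : ∃ j c z, j < l ∧ c < y j ∧ Blocks y l z ∧
      prefixOf y e ++ s.take k = prefixOf y j ++ c :: z := by
    generalize hw : prefixOf y e ++ s.take k = w at hz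
    cases hz with
    | nil =>
      have := congrArg List.length hw
      simp only [List.length_append, length_prefixOf, List.length_take, List.length_nil] at this
      omega
    | cons hj hc hz' => exact ⟨_, _, _, hj, hc, hz', rfl⟩
  refine ⟨j, c, z, e, hj, hc, ?_, hz', by rw [← hjz, hrot]⟩
  -- A rotation by more than `j` would place the whole first block inside a prefix of `y`.
  by_contra hlt
  apply not_hasBlock_prefixOf y l e
  refine ⟨j, hj, c, hc, List.prefix_of_prefix_length_le (l₃ := prefixOf y j ++ c :: z) ?_ ?_ ?_⟩
  · exact ⟨z, by simp⟩
  · exact hjz ▸ List.prefix_append _ _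
  · simp; omega

/-- The two rotations end with the prefixes of `y` of lengths `i < i'`. If they were equal, removing
the common last `i` symbols would show `y 0, …, y (i' - i - 1)` as a nonempty suffix of a
concatenation of blocks, and it would have to start with a block. -/
theorem rotate_blocks_ne (hy : IsPre y l) {j c i j' c' i' : ℕ} {z z' : List ℕ} (hj : j < l)
    (hc : c < y j) (hi : i ≤ j) (hz : Blocks y l z) (hi' : i' ≤ j')
    (hlt : i < i') :
    (prefixOf y j ++ c :: z).rotate i ≠ (prefixOf y j' ++ c' :: z').rotate i' := by
  intro h
  rw [List.rotate_eq_drop_append_take (by simp; omega),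
    List.rotate_eq_drop_append_take (by simp; omega),
    List.take_append_of_le_length (l₁ := prefixOf y j) (by simpa using hi),
    List.take_append_of_le_length (l₁ := prefixOf y j') (by simpa using hi'),
    take_prefixOf _ hi, take_prefixOf _ hi'] at h
  set D := (prefixOf y j ++ c :: z).drop i with hD
  set D' := (prefixOf y j' ++ c' :: z').drop i'
  have hsplit : prefixOf y i' = prefixOf y (i' - i) ++ prefixOf (fun r => y (i' - i + r)) i := by
    have := List.take_append_drop (i' - i) (prefixOf y i')
    rw [take_prefixOf _ (by omega), drop_prefixOf, show i' - (i' - i) = i by omega] at this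
    exact this.symm
  rw [hsplit, ← List.append_assoc] at h
  have h2 := List.append_inj_left' h (by simp)
  have hsuf : prefixOf y (i' - i) <:+ prefixOf y j ++ c :: z :=
    (h2 ▸ List.suffix_append D' _).trans (List.drop_suffix _ _)
  refine not_hasBlock_prefixOf y l (i' - i)
    ((Blocks.cons hj hc hz).hasBlock_of_suffix hy hsuf fun h0 => ?_)
  have := congrArg List.length h0
  simp at this
  omega

/-! ### Counting -/

theorem finite_strings_of_sum_lt (P : List ℕ → Prop) (m b : ℕ) :
    {z : List ℕ | P z ∧ z.length = m ∧ z.sum < b}.Finite := by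
  have : ∀ m, {z : List ℕ | z.length = m ∧ z.sum < b}.Finite := by
    intro m
    induction m with
    | zero =>
      refine (Set.finite_singleton ([] : List ℕ)).subset ?_
      rintro z ⟨hz, -⟩
      exact List.length_eq_zero_iff.mp hz
    | succ m ih =>
      refine ((Set.finite_Iic b).image2 List.cons ih).subset ?_
      rintro (_ | ⟨a, z⟩) ⟨hz, hs⟩
      · simp at hz
      · simp only [List.length_cons, List.sum_cons] at hz hs
        exact ⟨a, Set.mem_Iic.mpr (by omega), z, ⟨by omega, by omega⟩, rfl⟩
  exact (this m).subset fun z hz => hz.2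

/-- The number of concatenations of blocks that have length `m` and weight less than `b`. -/
noncomputable def blockCount (y : ℕ → ℕ) (l m b : ℕ) : ℕ :=
  {z : List ℕ | Blocks y l z ∧ z.length = m ∧ z.sum < b}.ncard

/-- Cumulative in the weight bound, over the bounds `1, …, b`. These are the numbers the algorithm
tabulates, since a sum over the last symbol of a block is then a difference of two entries. -/
noncomputable def blockCountSum (y : ℕ → ℕ) (l m b : ℕ) : ℕ :=
  ∑ b' ∈ Finset.range b, blockCount y l m (b' + 1)

/-- The sum of the first `j` symbols. -/
def weight (y : ℕ → ℕ) (j : ℕ) : ℕ := ∑ i ∈ Finset.range j, y i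

theorem weight_succ (y : ℕ → ℕ) (j : ℕ) : weight y (j + 1) = weight y j + y j :=
  Finset.sum_range_succ _ _

theorem blockCount_weight_zero (y : ℕ → ℕ) (l m : ℕ) : blockCount y l m 0 = 0 := by
  simp [blockCount]

theorem blockCount_length_zero (y : ℕ → ℕ) (l b : ℕ) : blockCount y l 0 (b + 1) = 1 := by
  rw [blockCount, Set.ncard_eq_one]
  refine ⟨[], Set.ext fun z => ⟨fun h => List.length_eq_zero_iff.mp h.2.1, ?_⟩⟩
  rintro rfl
  exact ⟨.nil, rfl, by simp⟩

/-- The terms are `f B, f (B - 1), …`, a segment of the cumulative sum. If `Y` exceeds `B`,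
truncated subtraction adds further copies of `f 0`, which vanish. -/
theorem sum_sub_eq_sub {f : ℕ → ℕ} (hf : f 0 = 0) (B Y : ℕ) :
    ∑ c ∈ Finset.range Y, f (B - c) =
      ∑ b ∈ Finset.range B, f (b + 1) - ∑ b ∈ Finset.range (B - Y), f (b + 1) := by
  induction Y with
  | zero => simp
  | succ Y ih =>
    rw [Finset.sum_range_succ, ih]
    rcases Nat.lt_or_ge Y B with h | h
    · have h1 : ∑ b ∈ Finset.range (B - Y), f (b + 1) =
          ∑ b ∈ Finset.range (B - (Y + 1)), f (b + 1) + f (B - Y) := by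
        rw [show B - Y = B - (Y + 1) + 1 by omega, Finset.sum_range_succ]
      have h2 : ∑ b ∈ Finset.range (B - Y), f (b + 1) ≤ ∑ b ∈ Finset.range B, f (b + 1) :=
        Finset.sum_le_sum_of_subset (Finset.range_mono (by omega))
      omega
    · rw [show B - Y = 0 by omega, show B - (Y + 1) = 0 by omega, hf, add_zero]

theorem sum_blockCount (y : ℕ → ℕ) (l m j b : ℕ) :
    ∑ c ∈ Finset.range (y j), blockCount y l m (b - weight y j - c) =
      blockCountSum y l m (b - weight y j) - blockCountSum y l m (b - weight y (j + 1)) := by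
  rw [sum_sub_eq_sub (blockCount_weight_zero y l m), weight_succ, ← Nat.sub_sub]
  rfl

theorem card_blocks_tail (y : ℕ → ℕ) (l m j c b : ℕ) :
    (finite_strings_of_sum_lt (Blocks y l) m (b - weight y j - c)).toFinset.card =
      blockCount y l m (b - weight y j - c) :=
  (Set.ncard_eq_toFinset_card _ _).symm

/-- A nonempty concatenation splits uniquely into a first block, given by `j` and `c`, and the rest.
The block has length `j + 1`, whence the bound by `m` on `j`. -/
theorem blockCount_succ (y : ℕ → ℕ) (l m b : ℕ) (hm : m ≠ 0) :
    blockCount y l m b = ∑ j ∈ Finset.range (min m l),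
      (blockCountSum y l (m - 1 - j) (b - weight y j) -
        blockCountSum y l (m - 1 - j) (b - weight y (j + 1))) := by
  simp_rw [← sum_blockCount, ← card_blocks_tail]
  rw [blockCount, Set.ncard_eq_toFinset_card _ (finite_strings_of_sum_lt _ _ _)]
  simp_rw [← Finset.card_sigma]
  symm
  refine Finset.card_bij (fun a _ => prefixOf y a.1 ++ a.2.1 :: a.2.2) ?_ ?_ ?_
  · rintro ⟨j, c, z⟩ h
    simp only [Finset.mem_sigma, Finset.mem_range, Set.Finite.mem_toFinset, Set.mem_ofPred_eq] at h ⊢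
    obtain ⟨h1, h2, h3, h4, h5⟩ := h
    refine ⟨.cons (by omega) h2 h3, ?_, ?_⟩
    · simp; omega
    · simp [sum_prefixOf]; unfold weight at h5; omega
  · rintro ⟨j, c, z⟩ h ⟨j', c', z'⟩ h' heq
    simp only [Finset.mem_sigma, Finset.mem_range] at h h' heq
    obtain ⟨rfl, rfl⟩ := block_unique h.2.1 h'.2.1
      (z := prefixOf y j ++ c :: z) ⟨z, by simp⟩ (heq ▸ ⟨z', by simp⟩)
    simpa using heq
  · intro s hs
    simp only [Set.Finite.mem_toFinset, Set.mem_ofPred_eq] at hs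
    obtain ⟨hb, hl, hw⟩ := hs
    cases hb with
    | nil => exact absurd hl.symm hm
    | @cons j c z hj hc hz =>
      simp only [List.length_append, length_prefixOf, List.length_cons, List.sum_append,
        sum_prefixOf, List.sum_cons] at hl hw
      refine ⟨⟨j, c, z⟩, ?_, rfl⟩
      simp only [Finset.mem_sigma, Finset.mem_range, Set.Finite.mem_toFinset, Set.mem_ofPred_eq]
      unfold weight
      exact ⟨by omega, hc, hz, by omega, by omega⟩

/-- The number of strings of length `t` and weight less than `n` all of whose rotations are smaller
than the prenecklace `y 0, …, y (l - 1)`. -/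
noncomputable def countBelow (n t : ℕ) (y : ℕ → ℕ) (l : ℕ) : ℕ :=
  {s : List ℕ | AllRotationsBelow y l s ∧ s.length = t ∧ s.sum < n}.ncard

/-- A string with all rotations below `y` is a unique rotation of a concatenation of blocks by one
of the `j + 1` amounts less than the length of its first block. These amounts are the factor `j +
1`. -/
theorem countBelow_eq (n t : ℕ) (hy : IsPre y l) (hl : l ≤ t) :
    countBelow n t y l = ∑ j ∈ Finset.range l, (j + 1) *
      (blockCountSum y l (t - 1 - j) (n - weight y j) -
        blockCountSum y l (t - 1 - j) (n - weight y (j + 1))) := by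
  simp_rw [← sum_blockCount, ← card_blocks_tail, Finset.mul_sum]
  rw [countBelow, Set.ncard_eq_toFinset_card _ (finite_strings_of_sum_lt _ _ _)]
  have hcard : ∀ j (s : Finset (List ℕ)), (j + 1) * s.card = (Finset.range (j + 1) ×ˢ s).card := by
    intro j s
    rw [Finset.card_product, Finset.card_range]
  simp_rw [hcard, ← Finset.card_sigma]
  symm
  refine Finset.card_bij (fun a _ => (prefixOf y a.1 ++ a.2.1 :: a.2.2.2).rotate a.2.2.1) ?_ ?_ ?_
  · rintro ⟨j, c, i, z⟩ h
    simp only [Finset.mem_sigma, Finset.mem_product, Finset.mem_range, Set.Finite.mem_toFinset,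
      Set.mem_ofPred_eq] at h ⊢
    obtain ⟨h1, h2, h3, h4, h5, h6⟩ := h
    refine ⟨fun k => ?_, ?_, ?_⟩
    · rw [List.rotate_rotate]
      exact (Blocks.cons h1 h2 h4).allRotationsBelow hy (by simp) _
    · simp; omega
    · rw [(List.rotate_perm _ _).sum_eq]
      simp [sum_prefixOf]; unfold weight at h6; omega
  · rintro ⟨j, c, i, z⟩ h ⟨j', c', i', z'⟩ h' heq
    simp only [Finset.mem_sigma, Finset.mem_product, Finset.mem_range, Set.Finite.mem_toFinset,
      Set.mem_ofPred_eq] at h h' heq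
    have hii : i = i' := by
      rcases lt_trichotomy i i' with hlt | h0 | hlt
      · exact absurd heq (rotate_blocks_ne hy h.1 h.2.1 (by omega) h.2.2.2.1 (by omega) hlt)
      · exact h0
      · exact absurd heq.symm
          (rotate_blocks_ne hy h'.1 h'.2.1 (by omega) h'.2.2.2.1 (by omega) hlt)
    subst hii
    have heq := List.rotate_injective i heq
    obtain ⟨rfl, rfl⟩ := block_unique h.2.1 h'.2.1
      (z := prefixOf y j ++ c :: z) ⟨z, by simp⟩ (heq ▸ ⟨z', by simp⟩)
    simpa using heq
  · intro s hs
    simp only [Set.Finite.mem_toFinset, Set.mem_ofPred_eq] at hs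
    obtain ⟨hb, hlen, hw⟩ := hs
    obtain ⟨j, c, z, i, hj, hc, hi, hz, rfl⟩ := hb.exists_blocks hy
    rw [(List.rotate_perm _ _).sum_eq] at hw
    simp only [List.length_rotate, List.length_append, length_prefixOf, List.length_cons,
      List.sum_append, sum_prefixOf, List.sum_cons] at hlen hw
    refine ⟨⟨j, c, i, z⟩, ?_, rfl⟩
    simp only [Finset.mem_sigma, Finset.mem_product, Finset.mem_range, Set.Finite.mem_toFinset,
      Set.mem_ofPred_eq]
    unfold weight
    exact ⟨hj, hc, by omega, hz, by omega, by omega⟩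

end UCycle

namespace UCycle

/-! ### Lexicographic order, rotations and periods -/

theorem cons_le_cons_iff {x y : ℕ} {a b : List ℕ} : x :: a ≤ y :: b ↔ x < y ∨ x = y ∧ a ≤ b := by
  rw [le_iff_lt_or_eq, le_iff_lt_or_eq, List.cons_lt_cons_iff, List.cons.injEq]
  tauto

theorem nil_le (a : List ℕ) : [] ≤ a := le_of_not_gt (List.not_lt_nil a)

theorem take_le_take {a b : List ℕ} (h : a ≤ b) (i : ℕ) : a.take i ≤ b.take i := by
  induction i generalizing a b with
  | zero => simp
  | succ i ih =>
    cases a with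
    | nil => simpa using nil_le _
    | cons x a =>
      cases b with
      | nil => exact absurd h (not_le.mpr (List.nil_lt_cons _ _))
      | cons y b =>
        rw [cons_le_cons_iff] at h
        simp only [List.take_succ_cons, cons_le_cons_iff]
        exact h.imp_right fun h => ⟨h.1, ih h.2⟩

theorem lt_of_take_lt {a b : List ℕ} {i : ℕ} (h : a.take i < b.take i) : a < b :=
  lt_of_not_ge fun h' => absurd (take_le_take h' i) (not_le.mpr h)

/-- This squeezing argument is how neighbouring necklaces are seen to share a prefix. -/
theorem take_eq_of_le_of_le {a x b : List ℕ} {i : ℕ} (h1 : a ≤ x) (h2 : x ≤ b)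
    (h : a.take i = b.take i) : x.take i = b.take i :=
  le_antisymm (take_le_take h2 i) (h ▸ take_le_take h1 i)

theorem le_of_forall₂ {a b : List ℕ} (h : List.Forall₂ (· ≤ ·) a b) : a ≤ b := by
  induction h with
  | nil => exact le_rfl
  | cons hxy _ ih =>
    rw [cons_le_cons_iff]
    rcases hxy.lt_or_eq with h | h
    · exact Or.inl h
    · exact Or.inr ⟨h, ih⟩

theorem forall₂_rotate {a b : List ℕ} (h : List.Forall₂ (· ≤ ·) a b) (i : ℕ) :
    List.Forall₂ (· ≤ ·) (a.rotate i) (b.rotate i) := by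
  rw [List.forall₂_iff_get] at h ⊢
  refine ⟨by simp [h.1], fun k h1 h2 => ?_⟩
  simp only [List.get_eq_getElem, List.getElem_rotate] at h ⊢
  simp only [h.1]
  have h3 : 0 < b.length := by
    simp at h2
    omega
  exact h.2 _ (by rw [h.1]; exact Nat.mod_lt _ h3) (Nat.mod_lt _ h3)

theorem forall₂_take_append_zeros (N : List ℕ) (i : ℕ) :
    List.Forall₂ (· ≤ ·) (N.take i ++ List.replicate (N.length - i) 0) N := by
  induction N generalizing i with
  | nil => simp
  | cons a N ih =>
    cases i with
    | zero => simpa [List.replicate_succ] using ih 0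
    | succ i => simpa using ih i

theorem take_append_zeros_le (N : List ℕ) (i : ℕ) :
    N.take i ++ List.replicate (N.length - i) 0 ≤ N :=
  le_of_forall₂ (forall₂_take_append_zeros N i)

theorem zeros_le (s : List ℕ) : List.replicate s.length 0 ≤ s := by
  simpa using take_append_zeros_le s 0

theorem eq_zeros_of_sum {s : List ℕ} (h : s.sum = 0) : s = List.replicate s.length 0 :=
  List.eq_replicate_iff.mpr ⟨rfl, fun _ hx => List.sum_eq_zero_iff.mp h _ hx⟩

/-! ### Largest rotations. -/

/-- A string that is lexicographically largest among its rotations. -/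
def IsMaxNecklace (s : List ℕ) : Prop := ∀ i, s.rotate i ≤ s

/-- If a rotation of the truncated string `z` exceeded `z`, it would lie between `z` and `N`, since
`z` is symbolwise at most `N`. It would thus share the first `i` symbols, which already carry the
whole weight of `z`. The rest would be zero and the rotation would equal `z`. -/
theorem IsMaxNecklace.take_append_zeros {N : List ℕ} (hN : IsMaxNecklace N) {i : ℕ}
    (hi : i ≤ N.length) : IsMaxNecklace (N.take i ++ List.replicate (N.length - i) 0) := by
  intro a
  by_contra hlt
  rw [not_le] at hlt
  set z := N.take i ++ List.replicate (N.length - i) 0 with hz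
  have hzi : z.take i = N.take i := by
    rw [hz, List.take_append_of_le_length (by simpa using hi), List.take_take, min_self]
  have h1 : z.rotate a ≤ N :=
    (le_of_forall₂ (forall₂_rotate (forall₂_take_append_zeros N i) a)).trans (hN a)
  have h2 : (z.rotate a).take i = z.take i :=
    (take_eq_of_le_of_le hlt.le h1 hzi).trans hzi.symm
  have hlen : z.length = N.length := by simp [hz]; omega
  have hsum : ((z.rotate a).drop i).sum = 0 := by
    have h3 := List.sum_take_add_sum_drop (z.rotate a) i
    rw [(List.rotate_perm z a).sum_eq, h2, hzi] at h3
    have h4 : z.sum = (N.take i).sum := by simp [hz]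
    omega
  have h4 := eq_zeros_of_sum hsum
  have h5 : z.rotate a = z := by
    rw [← List.take_append_drop i (z.rotate a), h2, hzi, h4]
    simp only [List.length_drop, List.length_rotate, hlen]
    rfl
  exact hlt.ne' h5

theorem IsMaxNecklace.getElem_le {N : List ℕ} (hN : IsMaxNecklace N) {i : ℕ} (hi : i < N.length) :
    N[i] ≤ N[0] := by
  have h := take_le_take (hN i) 1
  rw [List.rotate_eq_drop_append_take hi.le, List.drop_eq_getElem_cons hi] at h
  cases N with
  | nil => simp at hi
  | cons b N =>
    simp only [List.cons_append, List.take_succ_cons, List.take_zero, cons_le_cons_iff] at h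
    simp only [List.getElem_cons_zero]
    omega

theorem IsMaxNecklace.eq_zeros {N : List ℕ} (hN : IsMaxNecklace N) (h0 : 0 < N.length)
    (h : N[0] = 0) : N = List.replicate N.length 0 :=
  List.eq_replicate_iff.mpr ⟨rfl, fun x hx => by
    obtain ⟨i, hi, rfl⟩ := List.getElem_of_mem hx
    have := hN.getElem_le hi
    omega⟩

theorem isMaxNecklace_zeros (t : ℕ) : IsMaxNecklace (List.replicate t 0) := by
  intro i
  rw [List.rotate_replicate]

theorem exists_isMaxNecklace_rotate (s : List ℕ) : ∃ i, IsMaxNecklace (s.rotate i) := by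
  rcases Nat.eq_zero_or_pos s.length with h | h
  · rw [List.length_eq_zero_iff] at h
    exact ⟨0, fun i => by simp [h]⟩
  obtain ⟨i, -, hi⟩ := Finset.exists_max_image (Finset.range s.length) s.rotate ⟨0, by simpa⟩
  refine ⟨i, fun j => ?_⟩
  rw [List.rotate_rotate, ← List.rotate_mod]
  exact hi _ (Finset.mem_range.mpr (Nat.mod_lt _ h))

/-- The largest rotation. -/
noncomputable def maxRotation (s : List ℕ) : List ℕ :=
  s.rotate (exists_isMaxNecklace_rotate s).choose

theorem isMaxNecklace_maxRotation (s : List ℕ) : IsMaxNecklace (maxRotation s) :=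
  (exists_isMaxNecklace_rotate s).choose_spec

theorem maxRotation_eq (s : List ℕ) : ∃ i, maxRotation s = s.rotate i := ⟨_, rfl⟩

theorem exists_eq_rotate_rotate (s : List ℕ) (i : ℕ) : ∃ j, s = (s.rotate i).rotate j := by
  rcases Nat.eq_zero_or_pos s.length with h | h
  · rw [List.length_eq_zero_iff] at h
    simp [h]
  · refine ⟨s.length - i % s.length, ?_⟩
    have := Nat.mod_lt i h
    rw [← List.rotate_mod s i, List.rotate_rotate, show i % s.length + (s.length - i % s.length) =
      s.length by omega, List.rotate_length]

theorem rotate_le_maxRotation (s : List ℕ) (i : ℕ) : s.rotate i ≤ maxRotation s := by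
  obtain ⟨k, hk⟩ := maxRotation_eq s
  obtain ⟨j, hj⟩ := exists_eq_rotate_rotate s k
  have := isMaxNecklace_maxRotation s (j + i)
  rwa [← List.rotate_rotate, hk, ← hj, ← hk] at this

theorem IsMaxNecklace.eq_maxRotation {s : List ℕ} {i : ℕ} (h : IsMaxNecklace (s.rotate i)) :
    maxRotation s = s.rotate i := by
  refine le_antisymm ?_ (rotate_le_maxRotation s i)
  obtain ⟨k, hk⟩ := maxRotation_eq s
  obtain ⟨j, hj⟩ := exists_eq_rotate_rotate s i
  rw [hk]
  conv_lhs => rw [hj, List.rotate_rotate]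
  exact h _

@[simp] theorem length_maxRotation (s : List ℕ) : (maxRotation s).length = s.length := by
  obtain ⟨k, hk⟩ := maxRotation_eq s
  simp [hk]

theorem sum_maxRotation (s : List ℕ) : (maxRotation s).sum = s.sum := by
  obtain ⟨k, hk⟩ := maxRotation_eq s
  rw [hk, (List.rotate_perm _ _).sum_eq]

/-! ### Periods and roots. -/

/-- The smallest positive number of rotations that fixes `s`. -/
noncomputable def period (s : List ℕ) : ℕ := Function.minimalPeriod (fun l => l.rotate 1) s

theorem iterate_rotate (s : List ℕ) (i : ℕ) : (fun l => l.rotate 1)^[i] s = s.rotate i := by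
  induction i with
  | zero => simp
  | succ i ih => rw [Function.iterate_succ_apply', ih, List.rotate_rotate]

theorem rotate_eq_self_iff (s : List ℕ) (i : ℕ) : s.rotate i = s ↔ period s ∣ i := by
  rw [period, ← Function.isPeriodicPt_iff_minimalPeriod_dvd, Function.IsPeriodicPt,
    Function.IsFixedPt, iterate_rotate]

theorem rotate_period (s : List ℕ) : s.rotate (period s) = s := (rotate_eq_self_iff s _).mpr dvd_rfl

theorem period_dvd (s : List ℕ) : period s ∣ s.length :=
  (rotate_eq_self_iff s _).mp (List.rotate_length s)

theorem period_pos {s : List ℕ} (h : 0 < s.length) : 0 < period s :=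
  Nat.pos_of_dvd_of_pos (period_dvd s) h

theorem period_le {s : List ℕ} (h : 0 < s.length) : period s ≤ s.length :=
  Nat.le_of_dvd h (period_dvd s)

/-- The shortest prefix of which `s` is a power. -/
noncomputable def root (s : List ℕ) : List ℕ := s.take (period s)

theorem drop_eq_take_of_rotate {s : List ℕ} {d : ℕ} (hd : d ≤ s.length) (h : s.rotate d = s) :
    s.drop d = s.take (s.length - d) := by
  rw [List.rotate_eq_drop_append_take hd] at h
  have h' := congrArg (List.take (s.length - d)) h
  rwa [List.take_left' (by simp)] at h'

theorem rotate_sub_period (s : List ℕ) : s.rotate (s.length - period s) = s :=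
  (rotate_eq_self_iff s _).mpr (Nat.dvd_sub (period_dvd s) dvd_rfl)

theorem drop_sub_period {s : List ℕ} (h : 0 < s.length) : s.drop (s.length - period s) = root s := by
  rw [drop_eq_take_of_rotate (by omega) (rotate_sub_period s), root]
  congr 1
  have := period_le h
  omega

theorem length_root {s : List ℕ} (h : 0 < s.length) : (root s).length = period s := by
  simp [root, period_le h]

/-- Translates the description of the aperiodic prefix by powers into one by rotations, where
divisibility by `period` is available. -/
theorem flatten_replicate_take {s : List ℕ} {d : ℕ} (hd : 0 < d) (hs : 0 < s.length) :
    (List.replicate (s.length / d) (s.take d)).flatten = s ↔ d ∣ s.length ∧ s.rotate d = s := by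
  constructor
  · intro h
    have hdl : d ≤ s.length := by
      by_contra hlt
      rw [Nat.div_eq_of_lt (by omega)] at h
      rw [← h] at hs
      simp at hs
    have hl := congrArg List.length h
    simp [hdl] at hl
    refine ⟨Dvd.intro_left _ hl, ?_⟩
    have hq : s.length / d = (s.length / d - 1) + 1 := by
      have := Nat.div_pos hdl hd
      omega
    rw [List.rotate_eq_drop_append_take hdl]
    rw [hq] at h
    have h1 := h
    rw [List.replicate_succ, List.flatten_cons] at h
    rw [List.replicate_succ', List.flatten_append] at h1
    have h2 : s.drop d = (List.replicate (s.length / d - 1) (s.take d)).flatten := by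
      conv_lhs => rw [← h]
      exact List.drop_left' (by simp [hdl])
    rw [h2]
    simpa using h1
  · rintro ⟨⟨k, hk⟩, hr⟩
    rw [hk, Nat.mul_div_cancel_left _ hd]
    clear hs
    induction k generalizing s with
    | zero =>
      simp at hk
      simp [hk]
    | succ k ih =>
      rw [List.replicate_succ, List.flatten_cons]
      have hdl : d ≤ s.length := by rw [hk]; exact Nat.le_mul_of_pos_right _ (by omega)
      conv_rhs => rw [← List.take_append_drop d s]
      congr 1
      have hdrop := drop_eq_take_of_rotate hdl hr
      rcases Nat.eq_zero_or_pos k with rfl | hk0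
      · simp at hk
        simp [hk]
      have hsl : s.length = d + d * k := by rw [hk]; ring
      have htake : (s.drop d).take d = s.take d := by
        rw [hdrop, List.take_take, min_eq_left]
        have : d ≤ d * k := Nat.le_mul_of_pos_right _ hk0
        omega
      rw [← htake]
      refine ih ?_ (by simp [hsl])
      rw [List.rotate_eq_drop_append_take (by
        have : d ≤ d * k := Nat.le_mul_of_pos_right _ hk0
        simp; omega), htake]
      have h3 := hr
      rw [List.rotate_eq_drop_append_take hdl] at h3
      have h4 := congrArg (List.drop d) h3
      rwa [List.drop_append_of_le_length (by
        have : d ≤ d * k := Nat.le_mul_of_pos_right _ hk0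
        simp; omega)] at h4

theorem pairwise_inits (s : List ℕ) : s.inits.Pairwise fun a b => a.length < b.length := by
  induction s with
  | nil => simp
  | cons a s ih => simpa [List.pairwise_map] using ih

/-- The search meets the prefixes by increasing length. A success before the root would give a
positive rotation fixing `s` that is shorter than the period. -/
theorem aperiodicPrefix_eq_root {s : List ℕ} (hs : 0 < s.length) : aperiodicPrefix s = root s := by
  have hroot : (List.replicate (s.length / (root s).length) (root s)).flatten = s := by
    rw [length_root hs]
    exact (flatten_replicate_take (period_pos hs) hs).mpr ⟨period_dvd s, rotate_period s⟩
  have hmem : root s ∈ s.inits := List.mem_inits _ _ |>.mpr (List.take_prefix _ _)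
  rw [aperiodicPrefix]
  cases hf : s.inits.find? fun p => (List.replicate (s.length / p.length) p).flatten = s with
  | none =>
    rw [List.find?_eq_none] at hf
    exact absurd (by simpa using hroot) (hf _ hmem)
  | some r =>
    rw [List.find?_eq_some_iff_append] at hf
    obtain ⟨hr, as, bs, hab, has⟩ := hf
    simp only [decide_eq_true_eq] at hr
    rw [Option.getD_some]
    rw [hab, List.mem_append, List.mem_cons] at hmem
    rcases hmem with h | h | h
    · exact absurd hroot (by simpa using has _ h)
    · exact h.symm
    · have hlt := pairwise_inits s
      rw [hab, List.pairwise_append, List.pairwise_cons] at hlt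
      have hlt := hlt.2.1.1 _ h
      rw [length_root hs] at hlt
      have hpre : r <+: s := (List.mem_inits _ _).mp (by rw [hab]; simp)
      have hr0 : 0 < r.length := by
        rcases Nat.eq_zero_or_pos r.length with h0 | h0
        · rw [List.length_eq_zero_iff.mp h0] at hr
          rw [← hr] at hs
          simp at hs
        · exact h0
      rw [List.prefix_iff_eq_take.mp hpre, List.length_take, min_eq_left hpre.length_le] at hr
      have := (flatten_replicate_take hr0 hs).mp hr
      have := Nat.le_of_dvd hr0 ((rotate_eq_self_iff s _).mp this.2)
      omega

end UCycle

namespace UCycle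

/-! ### The complemented cycle -/

/-- The strings of differences `n - x` of the necklaces that make up the cycle, in decreasing
lexicographic order. -/
def maxNecklaces (n t : ℕ) : List (List ℕ) :=
  (necklacesGE n t (n * t + t - (n + t - 1))).map fun s => s.map fun x => n - x

theorem map_sub_map_sub {n : ℕ} {s : List ℕ} (h : ∀ x ∈ s, x ≤ n) :
    (s.map fun x => n - x).map (fun x => n - x) = s := by
  rw [List.map_map]
  conv_rhs => rw [← List.map_id s]
  refine List.map_congr_left fun x hx => ?_
  have := h x hx
  simp
  omega

theorem sum_map_sub {n : ℕ} {s : List ℕ} (h : ∀ x ∈ s, x ≤ n) :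
    (s.map fun x => n - x).sum + s.sum = n * s.length := by
  induction s with
  | nil => simp
  | cons a s ih =>
    have h1 := ih fun x hx => h x (List.mem_cons_of_mem _ hx)
    have h2 := h a List.mem_cons_self
    simp only [List.map_cons, List.sum_cons, List.length_cons]
    rw [Nat.mul_succ]
    omega

theorem map_sub_lt {n : ℕ} {s s' : List ℕ} (hl : s.length = s'.length) (h' : ∀ x ∈ s', x ≤ n)
    (h : s < s') : (s'.map fun x => n - x) < s.map fun x => n - x := by
  induction s generalizing s' with
  | nil =>
    rw [List.length_eq_zero_iff.mp hl.symm] at h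
    exact absurd h (lt_irrefl _)
  | cons a s ih =>
    cases s' with
    | nil => simp at hl
    | cons a' s' =>
      have ha := h' a' List.mem_cons_self
      simp only [List.map_cons, List.cons_lt_cons_iff] at h ⊢
      rcases h with h | ⟨rfl, h⟩
      · left; omega
      · exact Or.inr ⟨rfl, ih (by simpa using hl) (fun x hx => h' x (List.mem_cons_of_mem _ hx)) h⟩

theorem map_sub_le {n : ℕ} {s s' : List ℕ} (hl : s.length = s'.length) (h' : ∀ x ∈ s', x ≤ n)
    (h : s ≤ s') : (s'.map fun x => n - x) ≤ s.map fun x => n - x := by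
  rcases h.lt_or_eq with h | rfl
  · exact (map_sub_lt hl h' h).le
  · exact le_rfl

theorem isMaxNecklace_map_sub {n : ℕ} {s : List ℕ} (h : ∀ x ∈ s, x ≤ n) (hs : IsNecklace s) :
    IsMaxNecklace (s.map fun x => n - x) := by
  intro i
  rw [← List.map_rotate]
  rcases Nat.eq_zero_or_pos s.length with h0 | h0
  · rw [List.length_eq_zero_iff] at h0
    simp [h0]
  · rw [← List.rotate_mod]
    exact map_sub_le (by simp) (fun x hx => h x (List.mem_rotate.mp hx)) (hs _ (Nat.mod_lt _ h0))

theorem isNecklace_map_sub {n : ℕ} {s : List ℕ} (h : ∀ x ∈ s, x ≤ n) (hs : IsMaxNecklace s) :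
    IsNecklace (s.map fun x => n - x) := by
  intro i _
  rw [← List.map_rotate]
  exact map_sub_le (by simp) h (hs i)

/-- The weight bound is `n * t + t - (n + t - 1) = n * t - (n - 1)`, so the differences `n - x` sum
to at most `n - 1`. Conversely, a sum below `n` forces every symbol below `n`, so the alphabet
imposes no further condition. -/
theorem mem_maxNecklaces {n t : ℕ} (hn : 1 ≤ n) (ht : 1 ≤ t) {s : List ℕ} :
    s ∈ maxNecklaces n t ↔ (s.length = t ∧ s.sum < n) ∧ IsMaxNecklace s := by
  have hnt : n ≤ n * t := Nat.le_mul_of_pos_right _ ht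
  simp only [maxNecklaces, necklacesGE, List.mem_map, List.mem_filter, mem_strings,
    decide_eq_true_eq, Bool.decide_and, Bool.and_eq_true]
  constructor
  · rintro ⟨x, ⟨⟨hl, hx⟩, hneck, hw⟩, rfl⟩
    have h1 := sum_map_sub fun a ha => (hx a ha).2
    rw [hl] at h1
    exact ⟨⟨by simpa using hl, by omega⟩, isMaxNecklace_map_sub (fun a ha => (hx a ha).2) hneck⟩
  · rintro ⟨⟨hl, hs⟩, hneck⟩
    have hle : ∀ x ∈ s, x < n := fun x hx => (List.le_sum_of_mem hx).trans_lt hs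
    have hle' : ∀ x ∈ s, x ≤ n := fun x hx => (hle x hx).le
    have h1 := sum_map_sub hle'
    rw [hl] at h1
    refine ⟨s.map fun x => n - x, ⟨⟨by simpa using hl, fun x hx => ?_⟩,
      isNecklace_map_sub hle' hneck, by omega⟩, map_sub_map_sub hle'⟩
    obtain ⟨a, ha, rfl⟩ := List.mem_map.mp hx
    have := hle a ha
    omega

theorem pairwise_maxNecklaces (n t : ℕ) : (maxNecklaces n t).Pairwise (· > ·) := by
  rw [maxNecklaces, List.pairwise_map, necklacesGE]
  refine List.Pairwise.imp_of_mem ?_ ((pairwise_strings n t).filter _)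
  intro a b ha hb hab
  have ha := mem_strings.mp (List.mem_filter.mp ha).1
  have hb := mem_strings.mp (List.mem_filter.mp hb).1
  exact map_sub_lt (ha.1.trans hb.1.symm) (fun x hx => (hb.2 x hx).2) hab

theorem period_map_sub {n : ℕ} {s : List ℕ} (h : ∀ x ∈ s, x ≤ n) :
    period (s.map fun x => n - x) = period s := by
  refine Nat.dvd_antisymm ?_ ?_
  · rw [← rotate_eq_self_iff, ← List.map_rotate, rotate_period]
  · rw [← rotate_eq_self_iff]
    have h1 := rotate_period (s.map fun x => n - x)
    rw [← List.map_rotate] at h1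
    have h2 := congrArg (List.map fun x => n - x) h1
    rwa [map_sub_map_sub h, map_sub_map_sub fun x hx => h x (List.mem_rotate.mp hx)] at h2

/-- The cycle with every symbol decreased by one. -/
noncomputable def diffCycle (n t : ℕ) : List ℕ := (maxNecklaces n t).flatMap root

/-- The complement is `n + 1 - x = (n - x) + 1`, and the injective map `x ↦ n - x` preserves
periods, hence the places where roots are cut. -/
theorem cycleLE_eq {n t : ℕ} (ht : 1 ≤ t) :
    cycleLE n t (n + t - 1) = (diffCycle n t).map (· + 1) := by
  simp only [cycleLE, complement, cycleGE, diffCycle, maxNecklaces, List.map_flatMap,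
    List.flatMap_map]
  refine List.flatMap_congr fun s hs => ?_
  have hs := mem_strings.mp (List.mem_filter.mp hs).1
  have hle : ∀ x ∈ s, x ≤ n := fun x hx => (hs.2 x hx).2
  rw [aperiodicPrefix_eq_root (by omega), root, root, period_map_sub hle, ← List.map_take,
    List.map_map]
  refine List.map_congr_left fun x hx => ?_
  have := hle x (List.mem_of_mem_take hx)
  simp
  omega

/-! ### Counting rotation classes -/

/-- The strings of length `t` and weight less than `n` whose largest rotation satisfies `P`. -/
def classes (n t : ℕ) (P : List ℕ → Prop) : Set (List ℕ) :=
  {z | P (maxRotation z) ∧ z.length = t ∧ z.sum < n}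

theorem finite_classes (n t : ℕ) (P : List ℕ → Prop) : (classes n t P).Finite :=
  finite_strings_of_sum_lt (fun z => P (maxRotation z)) t n

theorem maxRotation_eq_of_isMaxNecklace {N : List ℕ} (h : IsMaxNecklace N) : maxRotation N = N := by
  have : IsMaxNecklace (N.rotate 0) := by simpa using h
  simpa using this.eq_maxRotation

theorem maxRotation_rotate (s : List ℕ) (i : ℕ) : maxRotation (s.rotate i) = maxRotation s := by
  obtain ⟨j, hj⟩ := maxRotation_eq (s.rotate i)
  have h := isMaxNecklace_maxRotation (s.rotate i)
  rw [hj, List.rotate_rotate] at h ⊢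
  exact h.eq_maxRotation.symm

theorem exists_eq_rotate_of_maxRotation_eq {N z : List ℕ} (hN : 0 < N.length)
    (h : maxRotation z = N) : ∃ i < period N, z = N.rotate i := by
  obtain ⟨k, hk⟩ := maxRotation_eq z
  obtain ⟨j, hj⟩ := exists_eq_rotate_rotate z k
  rw [← hk, h] at hj
  refine ⟨j % period N, Nat.mod_lt _ (period_pos hN), ?_⟩
  have h1 : N.rotate (period N * (j / period N)) = N :=
    (rotate_eq_self_iff _ _).mpr (Dvd.intro _ rfl)
  calc z = N.rotate (period N * (j / period N) + j % period N) := by rw [Nat.div_add_mod, hj]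
    _ = N.rotate (j % period N) := by rw [← List.rotate_rotate, h1]

/-- The class of `N` consists of the rotations by `i < period N`, and a coincidence among them would
give a smaller period. -/
theorem ncard_class {N : List ℕ} (hN : IsMaxNecklace N) (h0 : 0 < N.length) (n : ℕ)
    (hw : N.sum < n) : (classes n N.length (· = N)).ncard = period N := by
  have : classes n N.length (· = N) = N.rotate '' (Finset.range (period N)) := by
    ext z
    constructor
    · rintro ⟨h1, -, -⟩
      obtain ⟨i, hi, rfl⟩ := exists_eq_rotate_of_maxRotation_eq h0 h1
      exact ⟨i, by simpa using hi, rfl⟩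
    · rintro ⟨i, -, rfl⟩
      refine ⟨?_, by simp, by rwa [(List.rotate_perm _ _).sum_eq]⟩
      rw [maxRotation_rotate, maxRotation_eq_of_isMaxNecklace hN]
  rw [this, Set.InjOn.ncard_image, Set.ncard_coe_finset, Finset.card_range]
  have key : ∀ i j, i ≤ j → j < period N → N.rotate i = N.rotate j → i = j := by
    intro i j hij hj h
    have h1 : (N.rotate i).rotate (j - i) = N.rotate i := by
      rw [List.rotate_rotate, Nat.add_sub_cancel' hij, h]
    obtain ⟨k, hk⟩ := exists_eq_rotate_rotate N i
    have h2 : N.rotate (j - i) = N := by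
      conv_rhs => rw [hk, ← h1]
      conv_lhs => rw [hk]
      rw [List.rotate_rotate, List.rotate_rotate, List.rotate_rotate, List.rotate_rotate]
      congr 1
      ring
    have h3 := Nat.eq_zero_of_dvd_of_lt ((rotate_eq_self_iff _ _).mp h2) (by omega)
    omega
  intro i hi j hj h
  simp only [Finset.coe_range, Set.mem_Iio] at hi hj
  rcases le_total i j with hij | hij
  · exact key i j hij hj h
  · exact (key j i hij hi h.symm).symm

/-- Each necklace contributes its root, whose length is the size of its rotation class; the classes
are disjoint. -/
theorem length_flatMap_root {n t : ℕ} (ht : 1 ≤ t) {l : List (List ℕ)} (hnd : l.Nodup)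
    (hl : ∀ N ∈ l, (N.length = t ∧ N.sum < n) ∧ IsMaxNecklace N) :
    (l.flatMap root).length = (classes n t (· ∈ l)).ncard := by
  induction l with
  | nil => simp [classes]
  | cons N l ih =>
    rw [List.nodup_cons] at hnd
    obtain ⟨⟨h1, h2⟩, h3⟩ := hl N List.mem_cons_self
    have hunion : classes n t (· ∈ N :: l) = classes n t (· = N) ∪ classes n t (· ∈ l) := by
      ext z
      simp only [classes, List.mem_cons, Set.mem_union, Set.mem_ofPred_eq]
      tauto
    have hdisj : Disjoint (classes n t (· = N)) (classes n t (· ∈ l)) := by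
      rw [Set.disjoint_left]
      rintro z ⟨h, -⟩ ⟨h', -⟩
      exact hnd.1 (h ▸ h')
    rw [hunion, Set.ncard_union_eq hdisj (finite_classes _ _ _) (finite_classes _ _ _),
      ← ih hnd.2 fun N hN => hl N (List.mem_cons_of_mem _ hN), List.flatMap_cons,
      List.length_append, length_root (by omega), ← ncard_class h3 (by omega) n h2, h1]

/-- As the list decreases and `P` is upward closed, the initial segment contains all necklaces with
`P`. Lengths of initial parts of the cycle thus become numbers of strings. -/
theorem length_flatMap_takeWhile {n t : ℕ} (hn : 1 ≤ n) (ht : 1 ≤ t) (P : List ℕ → Bool)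
    (hP : ∀ a b : List ℕ, a ≤ b → P a = true → P b = true) :
    (((maxNecklaces n t).takeWhile P).flatMap root).length =
      (classes n t fun N => P N = true).ncard := by
  have hsub := (List.takeWhile_prefix P (l := maxNecklaces n t)).sublist
  have hpw := pairwise_maxNecklaces n t
  rw [length_flatMap_root ht (n := n)]
  · congr 1
    ext z
    simp only [classes, Set.mem_ofPred_eq]
    constructor
    · rintro ⟨h1, h2⟩
      exact ⟨List.mem_takeWhile_imp h1, h2⟩
    · rintro ⟨h1, h2⟩
      refine ⟨?_, h2⟩
      have hmem : maxRotation z ∈ maxNecklaces n t := (mem_maxNecklaces hn ht).mpr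
        ⟨⟨by simp [h2.1], by rw [sum_maxRotation]; exact h2.2⟩, isMaxNecklace_maxRotation z⟩
      by_contra hnot
      have hmem' := hmem
      rw [← List.takeWhile_append_dropWhile (p := P) (l := maxNecklaces n t),
        List.mem_append] at hmem'
      have hd := hmem'.resolve_left hnot
      cases hc : (maxNecklaces n t).dropWhile P with
      | nil => simp [hc] at hd
      | cons M l2 =>
        have hM : ¬ P M = true := by
          have := List.head_dropWhile_not P (l := maxNecklaces n t) (by simp [hc])
          simp only [hc, List.head_cons] at this
          simp [this]
        rw [hc, List.mem_cons] at hd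
        rcases hd with hd | hd
        · exact hM (hd ▸ h1)
        · have h3 := hpw.sublist (List.dropWhile_sublist P)
          rw [hc, List.pairwise_cons] at h3
          exact hM (hP _ _ (h3.1 _ hd).le h1)
  · exact (hpw.sublist hsub).imp fun h => ne_of_gt h
  · exact fun N hN => (mem_maxNecklaces hn ht).mp (hsub.subset hN)

theorem length_diffCycle {n t : ℕ} (hn : 1 ≤ n) (ht : 1 ≤ t) :
    (diffCycle n t).length = (classes n t fun _ => True).ncard := by
  have := length_flatMap_takeWhile hn ht (fun _ => true) fun _ _ _ _ => rfl
  rwa [List.takeWhile_eq_self_iff.mpr (by simp), ← diffCycle, show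
    (classes n t fun _ => true = true) = classes n t fun _ => True by simp] at this

end UCycle

namespace UCycle

/-! ### Occurrences in the cycle -/

section

variable {n t : ℕ}

theorem take_append_zeros_mem (hn : 1 ≤ n) (ht : 1 ≤ t) {N : List ℕ} (hN : N ∈ maxNecklaces n t)
    {i : ℕ} (hi : i ≤ t) : N.take i ++ List.replicate (t - i) 0 ∈ maxNecklaces n t := by
  obtain ⟨⟨h1, h2⟩, h3⟩ := (mem_maxNecklaces hn ht).mp hN
  refine (mem_maxNecklaces hn ht).mpr ⟨⟨?_, ?_⟩, ?_⟩
  · simp; omega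
  · have := List.sum_take_add_sum_drop N i
    simp
    omega
  · rw [← h1] at hi ⊢
    exact h3.take_append_zeros hi

/-- Combined with `take_append_zeros_mem` and `take_eq_of_le_of_le`, this shows that the successor
of a necklace shares a prefix with it. -/
theorem exists_next {N Z : List ℕ} {l : List (List ℕ)} (hN : N :: l <:+ maxNecklaces n t)
    (hZ : Z ∈ maxNecklaces n t) (h : Z < N) :
    ∃ N' l', l = N' :: l' ∧ Z ≤ N' ∧ N' < N := by
  have hpw := pairwise_maxNecklaces n t
  obtain ⟨l1, hl1⟩ := hN
  rw [← hl1, List.pairwise_append, List.pairwise_cons] at hpw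
  rw [← hl1, List.mem_append, List.mem_cons] at hZ
  obtain ⟨-, ⟨hpw1, hpw2⟩, hpw3⟩ := hpw
  rcases hZ with hZ | rfl | hZ
  · exact absurd (hpw3 Z hZ N List.mem_cons_self) (not_lt.mpr h.le)
  · exact absurd h (lt_irrefl _)
  · cases l with
    | nil => simp at hZ
    | cons N' l' =>
      refine ⟨N', l', rfl, ?_, hpw1 N' List.mem_cons_self⟩
      rw [List.pairwise_cons] at hpw2
      rcases List.mem_cons.mp hZ with rfl | hZ
      · exact le_rfl
      · exact (hpw2.1 Z hZ).le

theorem eq_zeros_of_take {N : List ℕ} (hN : IsMaxNecklace N) {i : ℕ} (hi : 0 < i)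
    (h : N.take i = List.replicate i 0) : N = List.replicate N.length 0 := by
  have hl : 0 < N.length := by
    have := congrArg List.length h
    simp at this
    omega
  refine hN.eq_zeros hl ?_
  have h1 := List.getElem_of_eq h (i := 0) (by simp; omega)
  simpa using h1

/-- The last `period N` symbols are the root again, so if they vanish the first, largest symbol of
`N` does too. -/
theorem eq_zeros_of_root {N : List ℕ} (hN : IsMaxNecklace N) (hl : 0 < N.length)
    (h : N.drop (N.length - period N) = List.replicate (period N) 0) :
    N = List.replicate N.length 0 := by
  rw [drop_sub_period hl] at h
  exact eq_zeros_of_take hN (period_pos hl) h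

theorem drop_eq_of_eq_append_zeros {N : List ℕ} {i : ℕ} (hi : i ≤ N.length)
    (h : N.take i ++ List.replicate (N.length - i) 0 = N) :
    N.drop i = List.replicate (N.length - i) 0 := by
  have := congrArg (List.drop i) h
  rw [List.drop_left' (by simpa using hi)] at this
  exact this.symm

/-- A necklace occurs where its aperiodic prefix starts. -/
theorem prefix_flatMap_root (hn : 1 ≤ n) (ht : 1 ≤ t) {l : List (List ℕ)} : ∀ {N : List ℕ},
    N :: l <:+ maxNecklaces n t → N ≠ List.replicate t 0 → N <+: (N :: l).flatMap root := by
  induction l with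
  | nil =>
    intro N hN h0
    exfalso
    have hmem := hN.subset List.mem_cons_self
    obtain ⟨⟨h1, -⟩, -⟩ := (mem_maxNecklaces hn ht).mp hmem
    obtain ⟨N', l', h, -⟩ := exists_next hN (take_append_zeros_mem hn ht hmem (Nat.zero_le _))
      (lt_of_le_of_ne (by simpa [h1] using take_append_zeros_le N 0) (by simpa using h0.symm))
    simp at h
  | cons N' l ih =>
    intro N hN h0
    have hmem := hN.subset List.mem_cons_self
    obtain ⟨⟨h1, -⟩, h3⟩ := (mem_maxNecklaces hn ht).mp hmem
    have hd := period_le (s := N) (by omega)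
    have hd0 := period_pos (s := N) (by omega)
    rw [List.flatMap_cons]
    rcases hd.eq_or_lt with hd' | hd'
    · rw [root, hd', List.take_length]
      exact List.prefix_append _ _
    have hdd : period N ≤ N.length - period N := by
      obtain ⟨k, hk⟩ := period_dvd N
      have : 2 ≤ k := by
        by_contra hlt
        have : k = 0 ∨ k = 1 := by omega
        rcases this with rfl | rfl <;> omega
      have := Nat.mul_le_mul_left (period N) this
      omega
    set a := t - period N with ha
    have hZmem := take_append_zeros_mem hn ht hmem (i := a) (by omega)
    have hZle := take_append_zeros_le N a
    rw [h1] at hZle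
    have hZne : N.take a ++ List.replicate (t - a) 0 ≠ N := by
      intro h
      rw [← h1] at h
      have := drop_eq_of_eq_append_zeros (by omega) h
      refine h0 (h1 ▸ eq_zeros_of_root h3 (by omega) ?_)
      rw [h1, ← ha, this]
      congr 1
      omega
    -- Zeroing the last copy of the root gives a smaller necklace, so the successor keeps everything
    -- before that copy. By induction the successor is read off after the root of `N`.
    obtain ⟨N'', l', heq, hle, hlt⟩ := exists_next hN hZmem (lt_of_le_of_ne hZle hZne)
    obtain ⟨rfl, rfl⟩ := List.cons.inj heq
    have htake : N'.take a = N.take a := take_eq_of_le_of_le hle hlt.le (by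
      rw [List.take_append_of_le_length (by simp; omega), List.take_take, min_self])
    have hN' : N' :: l <:+ maxNecklaces n t := (List.suffix_cons _ _).trans hN
    have h0' : N' ≠ List.replicate t 0 := by
      rintro rfl
      refine h0 (h1 ▸ eq_zeros_of_take h3 (i := a) (by omega) ?_)
      rw [← htake, List.take_replicate, min_eq_left (by omega)]
    have hpre : N.drop (period N) <+: (N' :: l).flatMap root := by
      rw [drop_eq_take_of_rotate hd (rotate_period N), h1, ← ha, ← htake]
      exact (List.take_prefix _ _).trans (ih hN' h0')
    conv_lhs => rw [← List.take_append_drop (period N) N]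
    exact (List.prefix_append_right_inj _).mpr hpre

/-- A rotation of a necklace that does not cut off zeros only occurs inside or after its aperiodic
prefix. -/
theorem rotate_prefix_flatMap_root (hn : 1 ≤ n) (ht : 1 ≤ t) {l : List (List ℕ)} {N : List ℕ}
    (hN : N :: l <:+ maxNecklaces n t) {i : ℕ} (hi : i < period N)
    (h0 : (root N).drop i ≠ List.replicate (period N - i) 0) :
    N.rotate i <+: ((N :: l).flatMap root).drop i := by
  have hmem := hN.subset List.mem_cons_self
  obtain ⟨⟨h1, -⟩, h3⟩ := (mem_maxNecklaces hn ht).mp hmem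
  have hd := period_le (s := N) (by omega)
  have hne : N ≠ List.replicate t 0 := by
    intro h
    apply h0
    rw [root, h, List.take_replicate, List.drop_replicate, ← h]
    congr 1
    omega
  rcases Nat.eq_zero_or_pos i with rfl | hi0
  · simpa using prefix_flatMap_root hn ht hN hne
  set a := t - period N + i with ha
  -- The root is also the last period of `N`, so index `i` of the root is index `a` of `N`. If the
  -- rest is not all zeros, zeroing it makes the string strictly smaller.
  have hdrop : N.drop a = (root N).drop i := by
    rw [← drop_sub_period (by omega), List.drop_drop, ha, h1]
  have hZmem := take_append_zeros_mem hn ht hmem (i := a) (by omega)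
  have hZle := take_append_zeros_le N a
  rw [h1] at hZle
  have hZne : N.take a ++ List.replicate (t - a) 0 ≠ N := by
    intro h
    rw [← h1] at h
    have := drop_eq_of_eq_append_zeros (by omega) h
    refine h0 ?_
    rw [← hdrop, this]
    congr 1
    omega
  obtain ⟨N', l', rfl, hle, hlt⟩ := exists_next hN hZmem (lt_of_le_of_ne hZle hZne)
  have htake : N'.take a = N.take a := take_eq_of_le_of_le hle hlt.le (by
    rw [List.take_append_of_le_length (by simp; omega), List.take_take, min_self])
  have hN' : N' :: l' <:+ maxNecklaces n t := (List.suffix_cons _ _).trans hN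
  have h0' : N' ≠ List.replicate t 0 := by
    rintro rfl
    refine hne (h1 ▸ eq_zeros_of_take h3 (i := a) (by omega) ?_)
    rw [← htake, List.take_replicate, min_eq_left (by omega)]
  have hrot : N.rotate i = (root N).drop i ++ N.take a := by
    have h4 : N.take a = N.take (t - period N) ++ (root N).take i := by
      rw [ha, List.take_add, ← h1, drop_sub_period (by omega)]
    rw [h4, ← List.append_assoc, List.rotate_eq_drop_append_take (by omega)]
    congr 1
    · rw [← h1, ← drop_eq_take_of_rotate hd (rotate_period N)]
      conv_lhs => rw [← List.take_append_drop (period N) N]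
      rw [List.drop_append_of_le_length (by simp; omega)]
      rfl
    · rw [root, List.take_take, min_eq_left hi.le]
  rw [hrot, List.flatMap_cons, List.drop_append_of_le_length (by rw [length_root] <;> omega),
    List.prefix_append_right_inj, ← htake]
  exact (List.take_prefix _ _).trans (prefix_flatMap_root hn ht hN' h0')

theorem zeros_mem (hn : 1 ≤ n) (ht : 1 ≤ t) : List.replicate t 0 ∈ maxNecklaces n t :=
  (mem_maxNecklaces hn ht).mpr ⟨⟨by simp, by simpa using Nat.pos_of_ne_zero (by omega)⟩, isMaxNecklace_zeros t⟩

theorem eq_append_of_min {l : List (List ℕ)} {Z : List ℕ} (hpw : l.Pairwise (· > ·)) (hZ : Z ∈ l)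
    (hmin : ∀ N ∈ l, Z ≤ N) : ∃ l', l = l' ++ [Z] := by
  obtain ⟨l1, l2, rfl⟩ := List.append_of_mem hZ
  cases l2 with
  | nil => exact ⟨l1, rfl⟩
  | cons N l2 =>
    rw [List.pairwise_append, List.pairwise_cons] at hpw
    exact absurd (hmin N (by simp)) (not_le.mpr (hpw.2.1.1 N List.mem_cons_self))

theorem one_zeros_le {N : List ℕ} (h : N ≠ List.replicate N.length 0)
    (hN : IsMaxNecklace N) : 1 :: List.replicate (N.length - 1) 0 ≤ N := by
  cases N with
  | nil => simp at h
  | cons a N =>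
    have ha : a ≠ 0 := fun ha => h (hN.eq_zeros (by simp) (by simpa using ha))
    rw [cons_le_cons_iff]
    rcases (Nat.one_le_iff_ne_zero.mpr ha).lt_or_eq with h1 | h1
    · exact Or.inl h1
    · exact Or.inr ⟨h1, by simpa using zeros_le N⟩

theorem isMaxNecklace_one_zeros (m : ℕ) : IsMaxNecklace (1 :: List.replicate m 0) := by
  intro i
  obtain ⟨z, hz⟩ : ∃ z, z = (1 :: List.replicate m 0).rotate i := ⟨_, rfl⟩
  have hlen : z.length = m + 1 := by simp [hz]
  have hsum : z.sum = 1 := by rw [hz, (List.rotate_perm _ _).sum_eq]; simp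
  rw [← hz]
  cases z with
  | nil => simp at hlen
  | cons a z =>
    simp only [List.sum_cons, List.length_cons] at hsum hlen
    rw [cons_le_cons_iff]
    rcases Nat.lt_or_ge a 1 with h | h
    · exact Or.inl h
    · have h1 := eq_zeros_of_sum (s := z) (by omega)
      refine Or.inr ⟨by omega, ?_⟩
      rw [h1, show z.length = m by omega]

/-- If there is a nonzero string, the cycle ends with a string of zeros. -/
theorem zeros_suffix_diffCycle (hn : 2 ≤ n) (ht : 1 ≤ t) :
    List.replicate t 0 <:+ diffCycle n t := by
  have hn1 : 1 ≤ n := by omega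
  have hpw := pairwise_maxNecklaces n t
  obtain ⟨l, hl⟩ := eq_append_of_min hpw (zeros_mem hn1 ht) fun N hN => by
    have h1 := ((mem_maxNecklaces hn1 ht).mp hN).1.1
    exact h1 ▸ zeros_le N
  -- The two smallest necklaces are `1 0⋯0`, which is its own root, and `0⋯0`, whose root is a
  -- single zero. Together they end the cycle with `t` zeros.
  set Z := 1 :: List.replicate (t - 1) 0 with hZ
  have hZlen : Z.length = t := by simp [hZ]; omega
  have hZneck : IsMaxNecklace Z := isMaxNecklace_one_zeros _
  have hZmem : Z ∈ maxNecklaces n t :=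
    (mem_maxNecklaces hn1 ht).mpr ⟨⟨hZlen, by simp [hZ]; omega⟩, hZneck⟩
  have hZ0 : Z ≠ List.replicate Z.length 0 := fun h => by
    have := congrArg List.sum h
    simp [hZ] at this
  rw [hl, List.mem_append, List.mem_singleton] at hZmem
  have hZl := hZmem.resolve_right fun h => hZ0 (by rw [hZlen]; exact h)
  rw [hl, List.pairwise_append] at hpw
  obtain ⟨l', rfl⟩ := eq_append_of_min hpw.1 hZl fun N hN => by
    have hN' : N ∈ maxNecklaces n t := by rw [hl]; simp [hN]
    obtain ⟨⟨h1, -⟩, h3⟩ := (mem_maxNecklaces hn1 ht).mp hN'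
    have := one_zeros_le (N := N) (fun h => by
      have := hpw.2.2 N hN _ (List.mem_singleton_self _)
      rw [h, h1] at this
      exact lt_irrefl _ this) h3
    rwa [h1] at this
  have hp0 : period (List.replicate t 0) = 1 := by
    have : period (List.replicate t 0) ∣ 1 := by
      rw [← rotate_eq_self_iff, List.rotate_replicate]
    exact Nat.dvd_one.mp this
  have hpZ : period Z = t := by
    by_contra hne
    have h1 := period_le (s := Z) (by omega)
    have h2 := period_pos (s := Z) (by omega)
    refine hZ0 (eq_zeros_of_root hZneck (by omega) ?_)
    obtain ⟨k, hk⟩ : ∃ k, Z.length - period Z = k + 1 := ⟨Z.length - period Z - 1, by omega⟩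
    have h5 : Z.drop (k + 1) = List.replicate (t - 1 - k) 0 := by simp [hZ]
    rw [hk, h5]
    congr 1
    omega
  have hrZ : root Z = Z := by rw [root, hpZ, ← hZlen, List.take_length]
  have hr0 : root (List.replicate t 0) = [0] := by
    rw [root, hp0, List.take_replicate, min_eq_left ht]
    rfl
  rw [diffCycle, hl, List.flatMap_append, List.flatMap_append, List.flatMap_singleton,
    List.flatMap_singleton, hrZ, hr0, hZ]
  refine ⟨l'.flatMap root ++ [1], ?_⟩
  obtain ⟨m, rfl⟩ : ∃ m, t = m + 1 := ⟨t - 1, by omega⟩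
  simp [List.replicate_succ']

/-- The necklaces whose prefix exceeds `w` are followed by one with prefix `w`, and preceded by
zeros. -/
theorem zeros_append_occurs (hn : 1 ≤ n) (ht : 1 ≤ t) {w : List ℕ} {m : ℕ}
    (hmem : w ++ List.replicate m 0 ∈ maxNecklaces n t)
    (hne : w ++ List.replicate m 0 ≠ List.replicate t 0) (hw : w ≠ []) :
    w <+: ((maxNecklaces n t).dropWhile fun N => w < N.take w.length).flatMap root ∧
      (((maxNecklaces n t).takeWhile fun N => w < N.take w.length) = [] ∨
        List.replicate m 0 <:+
          ((maxNecklaces n t).takeWhile fun N => w < N.take w.length).flatMap root) := by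
  set P : List ℕ → Bool := fun N => w < N.take w.length with hP
  obtain ⟨⟨h1, -⟩, h3⟩ := (mem_maxNecklaces hn ht).mp hmem
  have hlen : w.length + m = t := by simpa using h1
  have hw0 : 0 < w.length := List.length_pos_of_ne_nil hw
  have hpw := pairwise_maxNecklaces n t
  have hsplit := List.takeWhile_append_dropWhile (p := P) (l := maxNecklaces n t)
  have hPN : ¬ P (w ++ List.replicate m 0) = true := by simp [hP]
  have hmemd : w ++ List.replicate m 0 ∈ (maxNecklaces n t).dropWhile P := by
    have h := hmem
    rw [← hsplit, List.mem_append] at h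
    exact h.resolve_left fun h => hPN (List.mem_takeWhile_imp h)
  have hwz : w ≠ List.replicate w.length 0 := fun h => hne (by
    rw [h, ← List.replicate_add, hlen])
  cases hc : (maxNecklaces n t).dropWhile P with
  | nil => simp [hc] at hmemd
  | cons M l =>
    have hPM : ¬ P M = true := by
      have := List.head_dropWhile_not P (l := maxNecklaces n t) (by simp [hc])
      simp only [hc, List.head_cons] at this
      simp [this]
    have hsuf : M :: l <:+ maxNecklaces n t := hc ▸ List.dropWhile_suffix P
    have hMmem := hsuf.subset List.mem_cons_self
    -- The first necklace whose prefix does not exceed `w` has prefix exactly `w`, because the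
    -- necklace `w 0⋯0` comes no earlier in the list.
    have hMtake : M.take w.length = w := by
      refine le_antisymm (by simpa [hP] using hPM) ?_
      have hle : w ++ List.replicate m 0 ≤ M := by
        rw [hc, List.mem_cons] at hmemd
        rcases hmemd with h | h
        · exact h.le
        · have := hpw.sublist hsuf.sublist
          rw [List.pairwise_cons] at this
          exact (this.1 _ h).le
      have := take_le_take hle w.length
      rwa [List.take_left] at this
    obtain ⟨⟨hM1, -⟩, hM3⟩ := (mem_maxNecklaces hn ht).mp hMmem
    have hM0 : M ≠ List.replicate t 0 := by
      rintro rfl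
      rw [List.take_replicate, min_eq_left (by omega)] at hMtake
      exact hwz hMtake.symm
    refine ⟨?_, ?_⟩
    · conv_lhs => rw [← hMtake]
      exact (List.take_prefix _ _).trans (prefix_flatMap_root hn ht hsuf hM0)
    rcases List.eq_nil_or_concat ((maxNecklaces n t).takeWhile P) with h | ⟨l1, K, hK⟩
    · exact Or.inl h
    right
    rw [List.concat_eq_append] at hK
    have hPK : P K = true := List.mem_takeWhile_imp (l := maxNecklaces n t) (by rw [hK]; simp)
    have hPK' : w < K.take w.length := by simpa [hP] using hPK
    have hKsuf : K :: M :: l <:+ maxNecklaces n t := ⟨l1, by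
      rw [← hsplit, hK, hc]; simp⟩
    have hKmem := hKsuf.subset List.mem_cons_self
    obtain ⟨⟨hK1, -⟩, hK3⟩ := (mem_maxNecklaces hn ht).mp hKmem
    have hZmem := take_append_zeros_mem hn ht hKmem (i := w.length) (by omega)
    have hZle := take_append_zeros_le K w.length
    rw [hK1] at hZle
    -- Otherwise `K` with its tail zeroed would be a smaller necklace, and the successor `M` would
    -- have a prefix at least `K.take w.length`, which exceeds `w`.
    have hZeq : K.take w.length ++ List.replicate (t - w.length) 0 = K := by
      by_contra hZne
      obtain ⟨M', l', heq, hle, -⟩ := exists_next hKsuf hZmem (lt_of_le_of_ne hZle hZne)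
      obtain ⟨rfl, rfl⟩ := List.cons.inj heq
      have := take_le_take hle w.length
      rw [List.take_append_of_le_length (by simp; omega), List.take_take, min_self, hMtake] at this
      exact absurd hPK' (not_lt.mpr this)
    rw [← hK1] at hZeq
    have hdropK := drop_eq_of_eq_append_zeros (by omega) hZeq
    have hdK := period_le (s := K) (by omega)
    -- The zeros at the end of `K` lie within its last period: a period shorter than `m` would make
    -- the root, and hence `K`, zero.
    have hroot : List.replicate m 0 <:+ root K := by
      rw [← drop_sub_period (by omega)]
      have hm : K.length - w.length = m := by omega
      rcases Nat.lt_or_ge (period K) m with hlt | hge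
      · exfalso
        have : K = List.replicate K.length 0 := eq_zeros_of_root hK3 (by omega) (by
          rw [show K.length - period K = w.length + (m - period K) by omega, ← List.drop_drop,
            hdropK, List.drop_replicate]
          congr 1
          omega)
        rw [this, List.take_replicate, min_eq_left (by omega)] at hPK'
        exact absurd (zeros_le w) (not_le.mpr hPK')
      · rw [← hm, ← hdropK]
        exact List.suffix_of_suffix_length_le (List.drop_suffix _ _) (List.drop_suffix _ _)
          (by simp; omega)
    rw [hK, List.flatMap_append, List.flatMap_singleton]
    exact hroot.trans (List.suffix_append _ _)

end

end UCycle

namespace UCycle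

/-! ### Windows and positions -/

theorem window_eq_of_getElem? {U s : List ℕ} {i : ℕ}
    (h : ∀ j < s.length, U[(i + j) % U.length]? = s[j]?) : window U s.length i = s := by
  apply List.ext_getElem
  · simp [window]
  · intro j h1 h2
    simp only [window, List.getElem_map, List.getElem_range, List.getD_eq_getElem?_getD, h j h2]
    simp [h2]

theorem window_of_prefix {U s : List ℕ} {i : ℕ} (h : s <+: U.drop i) (hs : s ≠ []) :
    i < U.length ∧ window U s.length i = s := by
  have hlen := h.length_le
  have hpos := List.length_pos_of_ne_nil hs
  rw [List.length_drop] at hlen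
  refine ⟨by omega, window_eq_of_getElem? fun j hj => ?_⟩
  rw [Nat.mod_eq_of_lt (by omega), ← List.getElem?_drop]
  exact (List.prefix_iff_getElem?.mp h j hj).trans (by simp [hj])

theorem window_wrap {U h w : List ℕ} (hh : h <:+ U) (hw : w <+: U) :
    window U (h ++ w).length (U.length - h.length) = h ++ w := by
  have h1 := hh.length_le
  have h2 := hw.length_le
  refine window_eq_of_getElem? fun j hj => ?_
  rw [List.length_append] at hj
  rcases Nat.lt_or_ge j h.length with hlt | hge
  · rw [Nat.mod_eq_of_lt (by omega), List.getElem?_append_left hlt]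
    conv_rhs => rw [List.suffix_iff_eq_drop.mp hh, List.getElem?_drop]
  · rw [show U.length - h.length + j = j - h.length + U.length by omega, Nat.add_mod_right,
      Nat.mod_eq_of_lt (by omega), List.getElem?_append_right hge]
    exact (List.prefix_iff_getElem?.mp hw _ (by omega)).trans (by simp)

theorem window_map_succ {U : List ℕ} (hU : 0 < U.length) (len i : ℕ) :
    window (U.map (· + 1)) len i = (window U len i).map (· + 1) := by
  simp only [window, List.map_map, List.length_map]
  refine List.map_congr_left fun j _ => ?_
  have := Nat.mod_lt (i + j) hU
  simp [List.getD_eq_getElem?_getD, this]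

section

variable {n t : ℕ}

/-- The number of strings whose largest rotation has a prefix that exceeds `w`. -/
noncomputable def startOf (n t : ℕ) (w : List ℕ) : ℕ :=
  (classes n t fun N => w < N.take w.length).ncard

/-- The number of strings of length `t` and weight less than `n`. -/
noncomputable def numStrings (n t : ℕ) : ℕ := (classes n t fun _ => True).ncard

theorem length_flatMap_takeWhile_lt (hn : 1 ≤ n) (ht : 1 ≤ t) (w : List ℕ) :
    (((maxNecklaces n t).takeWhile fun N => w < N.take w.length).flatMap root).length =
      startOf n t w := by
  rw [length_flatMap_takeWhile hn ht]
  · simp [startOf]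
  · intro a b hab h
    simp only [decide_eq_true_eq] at h ⊢
    exact h.trans_le (take_le_take hab _)

theorem takeWhile_lt_eq {l1 l2 : List (List ℕ)} {N : List ℕ} (hN : N.length = t)
    (hl : ∀ M ∈ l1 ++ N :: l2, M.length = t) (hpw : (l1 ++ N :: l2).Pairwise (· > ·)) :
    (l1 ++ N :: l2).takeWhile (fun M => N < M.take N.length) = l1 := by
  rw [List.pairwise_append] at hpw
  rw [List.takeWhile_append_of_pos, List.takeWhile_cons_of_neg, List.append_nil]
  · simp
  · intro M hM
    rw [List.take_of_length_le (by rw [hl M (by simp [hM]), hN])]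
    simpa using hpw.2.2 M hM N List.mem_cons_self

theorem maxNecklaces_split (hn : 1 ≤ n) (ht : 1 ≤ t) {N : List ℕ} (hN : N ∈ maxNecklaces n t) :
    ∃ l1 l2, maxNecklaces n t = l1 ++ N :: l2 ∧ (l1.flatMap root).length = startOf n t N := by
  obtain ⟨l1, l2, h⟩ := List.append_of_mem hN
  have hpw := pairwise_maxNecklaces n t
  have hlen : ∀ M ∈ maxNecklaces n t, M.length = t := fun M hM =>
    ((mem_maxNecklaces hn ht).mp hM).1.1
  have h1 := length_flatMap_takeWhile_lt hn ht N
  rw [h] at hpw hlen h1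
  rw [takeWhile_lt_eq (hlen N (by simp)) hlen hpw] at h1
  exact ⟨l1, l2, h, h1⟩

theorem window_rotate (hn : 1 ≤ n) (ht : 1 ≤ t) {N : List ℕ} (hN : N ∈ maxNecklaces n t) {i : ℕ}
    (hi : i < period N) (h0 : (root N).drop i ≠ List.replicate (period N - i) 0) :
    startOf n t N + i < (diffCycle n t).length ∧
      window (diffCycle n t) t (startOf n t N + i) = N.rotate i := by
  obtain ⟨l1, l2, h, hlen⟩ := maxNecklaces_split hn ht hN
  have hl : (N.rotate i).length = t := by simpa using ((mem_maxNecklaces hn ht).mp hN).1.1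
  have h1 := rotate_prefix_flatMap_root hn ht ⟨l1, h.symm⟩ hi h0
  have h2 : (diffCycle n t).drop (startOf n t N + i) = ((N :: l2).flatMap root).drop i := by
    rw [diffCycle, h, List.flatMap_append, ← List.drop_drop, ← hlen, List.drop_left]
  have h3 := window_of_prefix (h2 ▸ h1) (List.ne_nil_of_length_pos (by omega))
  rwa [hl] at h3

theorem window_zeros_append (hn : 1 ≤ n) (ht : 1 ≤ t) {w : List ℕ} {m : ℕ}
    (hmem : w ++ List.replicate m 0 ∈ maxNecklaces n t)
    (hne : w ++ List.replicate m 0 ≠ List.replicate t 0) (hw : w ≠ []) :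
    m ≤ (diffCycle n t).length ∧
    window (diffCycle n t) t ((startOf n t w + ((diffCycle n t).length - m)) %
      (diffCycle n t).length) = List.replicate m 0 ++ w := by
  obtain ⟨⟨h1, hsum⟩, h3⟩ := (mem_maxNecklaces hn ht).mp hmem
  have hlen : (List.replicate m 0 ++ w).length = t := by simp at h1 ⊢; omega
  have hn2 : 2 ≤ n := by
    by_contra hlt
    have := eq_zeros_of_sum (s := w ++ List.replicate m 0) (by omega)
    rw [h1] at this
    exact hne this
  have hsuf : List.replicate m 0 <:+ diffCycle n t := by
    refine List.IsSuffix.trans ⟨List.replicate (t - m) 0, ?_⟩ (zeros_suffix_diffCycle hn2 ht)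
    rw [← List.replicate_add]
    congr 1
    simp at hlen
    omega
  have hm : m ≤ (diffCycle n t).length := by simpa using hsuf.length_le
  refine ⟨hm, ?_⟩
  obtain ⟨h4, h5⟩ := zeros_append_occurs hn ht hmem hne hw
  have hstart := length_flatMap_takeWhile_lt hn ht w
  have hsplit : diffCycle n t =
      ((maxNecklaces n t).takeWhile fun N => w < N.take w.length).flatMap root ++
        ((maxNecklaces n t).dropWhile fun N => w < N.take w.length).flatMap root := by
    rw [← List.flatMap_append, List.takeWhile_append_dropWhile, diffCycle]
  have hs0 : List.replicate m 0 ++ w ≠ [] := by simp [hw]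
  -- With fewer than `m` symbols before the necklaces with prefix `w`, no necklace can precede them
  -- at all, and the window begins in the zeros at the end of the cycle. Otherwise it begins `m`
  -- places earlier without wrapping.
  by_cases hm' : startOf n t w < m
  · have hnil := h5.resolve_right fun h => by
      have := h.length_le
      rw [hstart] at this
      simp at this
      omega
    rw [hnil] at hstart hsplit
    rw [List.flatMap_nil, List.nil_append] at hsplit
    simp only [List.flatMap_nil, List.length_nil] at hstart
    rw [← hsplit] at h4
    have := window_wrap hsuf h4
    rw [hlen, List.length_replicate] at this
    rwa [← hstart, zero_add, Nat.mod_eq_of_lt (by omega)]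
  · have hpre : List.replicate m 0 ++ w <+: (diffCycle n t).drop (startOf n t w - m) := by
      rcases Nat.eq_zero_or_pos m with rfl | hm0
      · rw [hsplit, ← hstart, Nat.sub_zero, List.drop_left]
        simpa using h4
      · obtain ⟨A, hA⟩ := h5.resolve_left fun h => by
          rw [h] at hstart
          simp at hstart
          omega
        obtain ⟨B, hB⟩ := h4
        rw [hsplit, ← hA, ← hB, List.append_assoc, List.drop_left' (by
          have := congrArg List.length hA
          rw [hstart] at this
          simp at this
          omega)]
        exact ⟨B, by simp⟩
    obtain ⟨h6, h7⟩ := window_of_prefix hpre hs0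
    rw [hlen] at h7
    rwa [show startOf n t w + ((diffCycle n t).length - m) =
      startOf n t w - m + (diffCycle n t).length by omega, Nat.add_mod_right, Nat.mod_eq_of_lt h6]

theorem length_diffCycle_pos (hn : 1 ≤ n) (ht : 1 ≤ t) : 0 < (diffCycle n t).length := by
  rw [length_diffCycle hn ht, Set.ncard_pos (finite_classes _ _ _)]
  exact ⟨List.replicate t 0, trivial, by simp, by simpa using Nat.pos_of_ne_zero (by omega)⟩

theorem window_zeros (hn : 1 ≤ n) (ht : 1 ≤ t) :
    window (diffCycle n t) t ((diffCycle n t).length - t) = List.replicate t 0 := by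
  rcases hn.lt_or_eq with hn2 | rfl
  · have := window_wrap (zeros_suffix_diffCycle hn2 ht) List.nil_prefix
    simpa using this
  -- For `n = 1` every symbol of the cycle is zero, so the window is zero however often it wraps
  -- around.
  · have h0 : ∀ x ∈ diffCycle 1 t, x = 0 := by
      intro x hx
      obtain ⟨N, hN, hx⟩ := List.mem_flatMap.mp hx
      have h1 := ((mem_maxNecklaces le_rfl ht).mp hN).1.2
      exact List.sum_eq_zero_iff.mp (show N.sum = 0 by omega) x (List.mem_of_mem_take hx)
    rw [List.eq_replicate_iff]
    refine ⟨by simp [window], fun x hx => ?_⟩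
    obtain ⟨j, -, rfl⟩ := List.mem_map.mp hx
    rw [List.getD_eq_getElem?_getD]
    cases h : (diffCycle 1 t)[((diffCycle 1 t).length - t + j) % (diffCycle 1 t).length]? with
    | none => rfl
    | some a => exact h0 a (List.mem_of_getElem? h)

/-- A nonzero string is a rotation of its largest rotation as in `window_rotate` or arises from it
by moving zeros as in `window_zeros_append`. -/
theorem rotate_cases {z N : List ℕ} (h0 : 0 < z.length) (hz : z ≠ List.replicate z.length 0)
    {i : ℕ} (hi : i < period N) (hzi : z = N.rotate i)
    (hzero : (root N).drop i = List.replicate (period N - i) 0) :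
    ∃ w m, z = List.replicate m 0 ++ w ∧ w ++ List.replicate m 0 = N ∧ w ≠ [] := by
  have hlen : z.length = N.length := by rw [hzi, List.length_rotate]
  have hd := period_le (s := N) (by omega)
  have htake : z.take (period N - i) = List.replicate (period N - i) 0 := by
    rw [hzi, List.rotate_eq_drop_append_take (by omega),
      List.take_append_of_le_length (by simp; omega), ← List.drop_take, ← root, hzero]
  refine ⟨z.drop (period N - i), period N - i, ?_, ?_, fun h => hz ?_⟩
  · rw [← htake, List.take_append_drop]
  · rw [← htake, ← List.rotate_eq_drop_append_take (by omega), hzi, List.rotate_rotate,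
      Nat.add_sub_cancel' hi.le, rotate_period]
  · have := List.take_append_drop (period N - i) z
    rw [h, htake, List.append_nil] at this
    conv_rhs => rw [← this, List.length_replicate]
    exact this.symm

theorem exists_window (hn : 1 ≤ n) (ht : 1 ≤ t) {z : List ℕ} (hl : z.length = t) (hs : z.sum < n) :
    ∃ i < (diffCycle n t).length, window (diffCycle n t) t i = z := by
  have hpos := length_diffCycle_pos hn ht
  by_cases hz : z = List.replicate t 0
  · exact ⟨_, by omega, hz ▸ window_zeros hn ht⟩
  have hN : maxRotation z ∈ maxNecklaces n t := (mem_maxNecklaces hn ht).mpr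
    ⟨⟨by simp [hl], by rwa [sum_maxRotation]⟩, isMaxNecklace_maxRotation z⟩
  obtain ⟨i, hi, hzi⟩ := exists_eq_rotate_of_maxRotation_eq (N := maxRotation z) (by simp; omega) rfl
  by_cases h0 : (root (maxRotation z)).drop i = List.replicate (period (maxRotation z) - i) 0
  · obtain ⟨w, m, h1, h2, h3⟩ := rotate_cases (by omega) (by rwa [hl]) hi hzi h0
    rw [← h2] at hN
    refine ⟨_, Nat.mod_lt _ hpos, (window_zeros_append hn ht hN (fun h => hz ?_) h3).2.trans h1.symm⟩
    rw [hzi, ← h2, h, List.rotate_replicate]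
  · obtain ⟨h1, h2⟩ := window_rotate hn ht hN hi h0
    exact ⟨_, h1, h2.trans hzi.symm⟩

theorem classes_true : classes n t (fun _ => True) = {z | z.length = t ∧ z.sum < n} := by
  simp [classes]

/-- Positions in the cycle correspond to strings. -/
theorem window_bijective (hn : 1 ≤ n) (ht : 1 ≤ t) :
    (∀ i < (diffCycle n t).length, (window (diffCycle n t) t i).sum < n) ∧
      ∀ i < (diffCycle n t).length, ∀ j < (diffCycle n t).length,
        window (diffCycle n t) t i = window (diffCycle n t) t j → i = j := by
  classical
  set Y := (finite_classes n t fun _ => True).toFinset with hY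
  have hcard : Y.card = (diffCycle n t).length := by
    rw [length_diffCycle hn ht, Set.ncard_eq_toFinset_card _ (finite_classes _ _ _)]
  have hmem : ∀ z, z ∈ Y ↔ z.length = t ∧ z.sum < n := by
    intro z
    rw [hY, Set.Finite.mem_toFinset, classes_true]
    rfl
  have hsub : Y ⊆ (Finset.range (diffCycle n t).length).image (window (diffCycle n t) t) := by
    intro z hz
    obtain ⟨h1, h2⟩ := (hmem z).mp hz
    obtain ⟨i, hi, h⟩ := exists_window hn ht h1 h2
    exact Finset.mem_image.mpr ⟨i, Finset.mem_range.mpr hi, h⟩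
  have hle : ((Finset.range (diffCycle n t).length).image (window (diffCycle n t) t)).card ≤
      Y.card := by
    rw [hcard]
    exact Finset.card_image_le.trans (by simp)
  -- Pigeonhole: the windows cover a set of strings that has as many elements as there are
  -- positions.
  have heq := Finset.eq_of_subset_of_card_le hsub hle
  constructor
  · intro i hi
    refine ((hmem _).mp ?_).2
    rw [heq]
    exact Finset.mem_image_of_mem _ (Finset.mem_range.mpr hi)
  · rw [heq] at hcard
    have hinj := Finset.card_image_iff.mp (hcard.trans (by simp))
    intro i hi j hj h
    exact hinj (by simpa using hi) (by simpa using hj) h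

/-- The symbols of the cycle, in terms of numbers of strings with large rotations. -/
theorem getD_diffCycle (hn : 1 ≤ n) (ht : 1 ≤ t) {y : ℕ → ℕ} {r : ℕ}
    (h1 : startOf n t (prefixOf y t) ≤ r)
    (h2 : r < (classes n t fun N => prefixOf y t ≤ N.take t).ncard) :
    r - startOf n t (prefixOf y t) < t ∧
      (diffCycle n t).getD r 0 = y (r - startOf n t (prefixOf y t)) := by
  have hunion : (classes n t fun N => prefixOf y t ≤ N.take t) =
      (classes n t fun N => prefixOf y t < N.take (prefixOf y t).length) ∪
        classes n t (· = prefixOf y t) := by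
    ext z
    simp only [classes, Set.mem_union, Set.mem_ofPred_eq, length_prefixOf, le_iff_lt_or_eq]
    constructor
    · rintro ⟨h | h, hl, hs⟩
      · exact Or.inl ⟨h, hl, hs⟩
      · exact Or.inr ⟨by rw [h, List.take_of_length_le (by simp [hl])], hl, hs⟩
    · rintro (⟨h, hl, hs⟩ | ⟨h, hl, hs⟩)
      · exact ⟨Or.inl h, hl, hs⟩
      · exact ⟨Or.inr (by rw [h, List.take_of_length_le (by simp)]), hl, hs⟩
  have hle := Set.ncard_union_le
    (classes n t fun N => prefixOf y t < N.take (prefixOf y t).length)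
    (classes n t (· = prefixOf y t))
  rw [← hunion] at hle
  -- The interval from start to end belongs to the class of `y` alone. Containing `r`, it is
  -- nonempty, so `y` is a necklace of admissible weight and the offset lies in its root.
  have hr : r - startOf n t (prefixOf y t) < (classes n t (· = prefixOf y t)).ncard := by
    unfold startOf at h1 ⊢
    omega
  obtain ⟨z, hz1, hz2, hz3⟩ := (Set.ncard_pos (finite_classes _ _ _)).mp (Nat.zero_lt_of_lt hr)
  have hneck : IsMaxNecklace (prefixOf y t) := hz1 ▸ isMaxNecklace_maxRotation z
  have hsum : (prefixOf y t).sum < n := by rw [← hz1, sum_maxRotation]; exact hz3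
  have hcl := ncard_class hneck (by simp; omega) n hsum
  rw [length_prefixOf] at hcl
  rw [hcl] at hr
  obtain ⟨l1, l2, h, hlen⟩ := maxNecklaces_split hn ht
    ((mem_maxNecklaces hn ht).mpr ⟨⟨length_prefixOf y t, hsum⟩, hneck⟩)
  have hp := period_le (s := prefixOf y t) (by simp; omega)
  rw [length_prefixOf] at hp
  refine ⟨by omega, ?_⟩
  rw [diffCycle, h, List.flatMap_append, List.flatMap_cons, List.getD_eq_getElem?_getD,
    List.getElem?_append_right (by omega), hlen,
    List.getElem?_append_left (by rw [length_root (by simp; omega)]; exact hr), root,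
    List.getElem?_take_of_lt hr, List.getElem?_eq_getElem (by simp; omega)]
  simp

end

end UCycle

namespace UCycle

/-! ### Multisets -/

/-- The partial sums `p + a₁, p + a₁ + a₂, …`. -/
def partialSums : ℕ → List ℕ → List ℕ
  | _, [] => []
  | p, a :: l => (p + a) :: partialSums (p + a) l

theorem length_diffs (p : ℕ) (l : List ℕ) : (diffs p l).length = l.length := by
  induction l generalizing p with
  | nil => rfl
  | cons a l ih => simp [diffs, ih]

theorem length_partialSums (p : ℕ) (l : List ℕ) : (partialSums p l).length = l.length := by
  induction l generalizing p with
  | nil => rfl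
  | cons a l ih => simp [partialSums, ih]

theorem diffs_partialSums (p : ℕ) (l : List ℕ) : diffs p (partialSums p l) = l := by
  induction l generalizing p with
  | nil => rfl
  | cons a l ih => simp [partialSums, diffs, ih]

theorem partialSums_diffs {p : ℕ} {l : List ℕ} (h : (p :: l).Pairwise (· ≤ ·)) :
    partialSums p (diffs p l) = l := by
  induction l generalizing p with
  | nil => rfl
  | cons a l ih =>
    rw [List.pairwise_cons] at h
    have h1 := h.1 a List.mem_cons_self
    simp only [diffs, partialSums]
    rw [show p + (a - p) = a by omega, ih h.2]

theorem pairwise_partialSums (p : ℕ) (l : List ℕ) : (p :: partialSums p l).Pairwise (· ≤ ·) := by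
  induction l generalizing p with
  | nil => simp [partialSums]
  | cons a l ih =>
    have h := ih (p + a)
    rw [partialSums, List.pairwise_cons]
    refine ⟨fun b hb => ?_, h⟩
    rw [List.pairwise_cons] at h
    rcases List.mem_cons.mp hb with rfl | hb
    · omega
    · exact (Nat.le_add_right p a).trans (h.1 b hb)

theorem le_sum_of_mem_partialSums {p x : ℕ} {l : List ℕ} (h : x ∈ partialSums p l) :
    x ≤ p + l.sum := by
  induction l generalizing p with
  | nil => simp [partialSums] at h
  | cons a l ih =>
    rw [partialSums, List.mem_cons] at h
    rw [List.sum_cons]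
    rcases h with rfl | h
    · omega
    · have := ih h; omega

theorem sum_diffs_lt {p n : ℕ} {l : List ℕ} (hp : p < n) (hl : ∀ x ∈ l, x < n)
    (h : (p :: l).Pairwise (· ≤ ·)) : p + (diffs p l).sum < n := by
  induction l generalizing p with
  | nil => simpa [diffs]
  | cons a l ih =>
    rw [List.pairwise_cons] at h
    have h1 := h.1 a List.mem_cons_self
    have h2 := ih (hl a List.mem_cons_self) (fun x hx => hl x (List.mem_cons_of_mem _ hx)) h.2
    simp only [diffs, List.sum_cons]
    omega

section

variable {n t : ℕ}

theorem partialSums_diffRep (m : Multiset ℕ) : partialSums 0 (diffRep m) = listing m := by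
  refine partialSums_diffs (List.pairwise_cons.mpr ⟨fun _ _ => Nat.zero_le _, ?_⟩)
  exact Multiset.pairwise_sort m (· ≤ ·)

theorem length_listing {m : Multiset ℕ} (hm : m ∈ multisets n t) : (listing m).length = t := by
  rw [listing, Multiset.length_sort]
  exact hm.1

theorem length_diffRep {m : Multiset ℕ} (hm : m ∈ multisets n t) : (diffRep m).length = t := by
  rw [diffRep, length_diffs, length_listing hm]

theorem sum_diffRep (hn : 1 ≤ n) {m : Multiset ℕ} (hm : m ∈ multisets n t) :
    (diffRep m).sum < n := by
  have := sum_diffs_lt (p := 0) (n := n) (l := listing m) (by omega)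
    (fun x hx => hm.2 x ((Multiset.mem_sort _).mp hx))
    (List.pairwise_cons.mpr ⟨fun _ _ => Nat.zero_le _, Multiset.pairwise_sort m (· ≤ ·)⟩)
  rwa [zero_add] at this

theorem exists_multiset {z : List ℕ} (hl : z.length = t) (hs : z.sum < n) :
    ∃ m ∈ multisets n t, diffRep m = z ∧ listing m = partialSums 0 z := by
  have hlist : listing (partialSums 0 z : Multiset ℕ) = partialSums 0 z := by
    refine List.Perm.eq_of_pairwise' (r := (· ≤ ·)) (Multiset.pairwise_sort _ _)
      (List.pairwise_cons.mp (pairwise_partialSums 0 z)).2 ?_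
    rw [← Multiset.coe_eq_coe, listing, Multiset.sort_eq]
  refine ⟨(partialSums 0 z : Multiset ℕ), ⟨?_, fun x hx => ?_⟩, ?_, hlist⟩
  · rw [Multiset.coe_card, length_partialSums, hl]
  · have := le_sum_of_mem_partialSums (Multiset.mem_coe.mp hx)
    omega
  · rw [diffRep, hlist, diffs_partialSums]

theorem diffRep_injective : Function.Injective diffRep := by
  intro m m' h
  have h1 : listing m = listing m' := by rw [← partialSums_diffRep, h, partialSums_diffRep]
  have h2 := congrArg (fun l : List ℕ => (l : Multiset ℕ)) h1
  simpa [listing] using h2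

theorem encard_multisets (hn : 1 ≤ n) (ht : 1 ≤ t) :
    (multisets n t).encard = (diffCycle n t).length := by
  have : diffRep '' multisets n t = classes n t fun _ => True := by
    rw [classes_true]
    ext z
    constructor
    · rintro ⟨m, hm, rfl⟩
      exact ⟨length_diffRep hm, sum_diffRep hn hm⟩
    · rintro ⟨h1, h2⟩
      obtain ⟨m, hm, h, -⟩ := exists_multiset h1 h2
      exact ⟨m, hm, h⟩
  rw [length_diffCycle hn ht, (finite_classes _ _ _).cast_ncard_eq, ← this,
    diffRep_injective.encard_image]

theorem length_cycleLE (ht : 1 ≤ t) : (cycleLE n t (n + t - 1)).length = (diffCycle n t).length := by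
  rw [cycleLE_eq ht, List.length_map]

theorem window_cycleLE (hn : 1 ≤ n) (ht : 1 ≤ t) (len i : ℕ) :
    window (cycleLE n t (n + t - 1)) len i = (window (diffCycle n t) len i).map (· + 1) := by
  rw [cycleLE_eq ht, window_map_succ (length_diffCycle_pos hn ht)]

theorem window_cycleLE_eq_iff (hn : 1 ≤ n) (ht : 1 ≤ t) {m : Multiset ℕ} (hm : m ∈ multisets n t)
    (i : ℕ) : window (cycleLE n t (n + t - 1)) (shiftedDiffRep m).length i = shiftedDiffRep m ↔
      window (diffCycle n t) t i = diffRep m := by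
  rw [window_cycleLE hn ht, shiftedDiffRep, List.length_map, length_diffRep hm]
  exact (List.map_injective_iff.mpr (add_left_injective 1)).eq_iff

theorem isUniversalCycle_cycleLE (hn : 1 ≤ n) (ht : 1 ≤ t) :
    IsUniversalCycle (cycleLE n t (n + t - 1)) (multisets n t) shiftedDiffRep := by
  refine ⟨by rw [encard_multisets hn ht, length_cycleLE ht], fun m hm => ?_⟩
  obtain ⟨i, hi, h⟩ := exists_window hn ht (length_diffRep hm) (sum_diffRep hn hm)
  refine ⟨i, ⟨by rwa [length_cycleLE ht], (window_cycleLE_eq_iff hn ht hm i).mpr h⟩, ?_⟩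
  rintro j ⟨hj, h'⟩
  rw [length_cycleLE ht] at hj
  rw [window_cycleLE_eq_iff hn ht hm] at h'
  exact (window_bijective hn ht).2 j hj i hi (h'.trans h.symm)

theorem rank_eq (hn : 1 ≤ n) (ht : 1 ≤ t) {m : Multiset ℕ} (hm : m ∈ multisets n t) {i : ℕ}
    (hi : i < (diffCycle n t).length) (h : window (diffCycle n t) t i = diffRep m) :
    rank (cycleLE n t (n + t - 1)) (shiftedDiffRep m) = i + 1 := by
  rw [rank, length_cycleLE ht, Nat.add_right_cancel_iff, List.findIdx_eq (by simpa using hi)]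
  simp only [List.getElem_range, decide_eq_true_eq, decide_eq_false_iff_not,
    window_cycleLE_eq_iff hn ht hm]
  refine ⟨h, fun j hj h' => ?_⟩
  have := (window_bijective hn ht).2 j (by omega) i hi (h'.trans h.symm)
  omega

theorem ncard_multisets (hn : 1 ≤ n) (ht : 1 ≤ t) :
    (multisets n t).ncard = (diffCycle n t).length := by
  rw [Set.ncard, encard_multisets hn ht, ENat.toNat_natCast]

theorem unrank_eq (hn : 1 ≤ n) (ht : 1 ≤ t) (r : ℕ) :
    unrank (cycleLE n t (n + t - 1)) t r = (window (diffCycle n t) t (r - 1)).map (· + 1) :=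
  window_cycleLE hn ht t (r - 1)

theorem exists_multiset_unrank (hn : 1 ≤ n) (ht : 1 ≤ t) {r : ℕ} (h1 : 1 ≤ r)
    (h2 : r ≤ (multisets n t).ncard) : ∃ m ∈ multisets n t,
      shiftedDiffRep m = unrank (cycleLE n t (n + t - 1)) t r ∧
        listing m = partialSums 0 (window (diffCycle n t) t (r - 1)) := by
  rw [ncard_multisets hn ht] at h2
  obtain ⟨m, hm, h, h'⟩ := exists_multiset (t := t) (by simp [window])
    ((window_bijective hn ht).1 (r - 1) (by omega))
  exact ⟨m, hm, by rw [unrank_eq hn ht, shiftedDiffRep, h], h'⟩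

end

/-! ### Prenecklaces -/

/-- `y 0, …, y (q - 1)` has period `p`, and its first `p` symbols form a string that is larger than
each of its proper suffixes and no prefix of which is a suffix. -/
structure IsPeriodic (y : ℕ → ℕ) (q p : ℕ) : Prop where
  pos : 0 < p
  lyndon : ∀ i, 1 ≤ i → i < p → ∃ r, i + r < p ∧ (∀ r' < r, y (i + r') = y r') ∧ y (i + r) < y r
  eq : ∀ i, p ≤ i → i < q → y i = y (i - p)

variable {y : ℕ → ℕ} {q p : ℕ}

theorem IsPeriodic.eq_mod (h : IsPeriodic y q p) {i : ℕ} (hi : i < q) : y i = y (i % p) := by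
  induction i using Nat.strong_induction_on with
  | _ i ih =>
    rcases Nat.lt_or_ge i p with hlt | hge
    · rw [Nat.mod_eq_of_lt hlt]
    · have := h.pos
      rw [h.eq i hge hi, ih (i - p) (by omega) (by omega), Nat.mod_eq_sub_mod hge]

theorem isPeriodic_one (y : ℕ → ℕ) : IsPeriodic y 1 1 :=
  ⟨one_pos, fun i h1 h2 => by omega, fun i h1 h2 => by omega⟩

theorem IsPeriodic.succ_of_eq (h : IsPeriodic y q p) (heq : y q = y (q - p)) :
    IsPeriodic y (q + 1) p :=
  ⟨h.pos, h.lyndon, fun i h1 h2 => by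
    rcases Nat.lt_succ_iff_lt_or_eq.mp h2 with h3 | rfl
    · exact h.eq i h1 h3
    · exact heq⟩

/-- A string that is followed by a smaller symbol than its period requires. -/
theorem IsPeriodic.succ_of_lt (h : IsPeriodic y q p) (hpq : p ≤ q) (hlt : y q < y (q - p)) :
    IsPeriodic y (q + 1) (q + 1) := by
  refine ⟨Nat.succ_pos _, fun i h1 h2 => ?_, fun i h1 h2 => by omega⟩
  have hp := h.pos
  -- the last symbol, as compared with the one that the period predicts
  have hlast : y q < y ((q - p) % p) := by rwa [h.eq_mod (i := q - p) (by omega)] at hlt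
  have hqp : (q - p) % p = q % p := by
    conv_rhs => rw [← Nat.sub_add_cancel hpq, Nat.add_mod_right]
  rw [hqp] at hlast
  have hdiv := Nat.div_add_mod i p
  -- A suffix starting at a multiple of `p` agrees with the prefix until the new, smaller symbol.
  -- Any other suffix is decided by the mismatch of the repeated part, or by the new symbol if that
  -- comes no later.
  rcases Nat.eq_zero_or_pos (i % p) with h0 | h0
  · refine ⟨q - i, by omega, fun r hr => ?_, ?_⟩
    · rw [h.eq_mod (by omega), h.eq_mod (i := r) (by omega), Nat.add_mod, h0, zero_add,
        Nat.mod_mod]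
    · rw [show i + (q - i) = q by omega, h.eq_mod (i := q - i) (by omega)]
      have : q % p = (q - i) % p := by
        conv_lhs => rw [show q = i + (q - i) by omega, Nat.add_mod, h0, zero_add, Nat.mod_mod]
      rwa [← this]
  · obtain ⟨r, hr1, hr2, hr3⟩ := h.lyndon (i % p) h0 (Nat.mod_lt _ hp)
    have hmod : ∀ r', i % p + r' < p → (i + r') % p = i % p + r' := by
      intro r' hr'
      conv_lhs => rw [← hdiv, Nat.add_assoc, Nat.mul_add_mod]
      exact Nat.mod_eq_of_lt hr'
    rcases Nat.lt_or_ge (i + r) q with hiq | hiq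
    · refine ⟨r, by omega, fun r' hr' => ?_, ?_⟩
      · rw [h.eq_mod (by omega), hmod r' (by omega), hr2 r' hr']
      · rwa [h.eq_mod (by omega), hmod r hr1]
    · refine ⟨q - i, by omega, fun r' hr' => ?_, ?_⟩
      · rw [h.eq_mod (by omega), hmod r' (by omega), hr2 r' (by omega)]
      · rw [show i + (q - i) = q by omega]
        have h1 := hmod (q - i) (by omega)
        rw [show i + (q - i) = q by omega] at h1
        rw [h1] at hlast
        rcases Nat.lt_or_ge (q - i) r with h2 | h2
        · rwa [← hr2 _ h2]
        · rw [show q - i = r by omega] at hlast ⊢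
          omega

/-- Modulo `p`, a suffix either starts with the repeated part and matches, or becomes smaller at the
mismatch that `lyndon` provides. -/
theorem IsPeriodic.isPre (h : IsPeriodic y q p) : IsPre y q := by
  intro i h1 r hr hmatch
  have hp := h.pos
  rcases Nat.eq_zero_or_pos (i % p) with h0 | h0
  · rw [h.eq_mod hr, h.eq_mod (i := r) (by omega), Nat.add_mod, h0, zero_add, Nat.mod_mod]
  · obtain ⟨s, hs1, hs2, hs3⟩ := h.lyndon (i % p) h0 (Nat.mod_lt _ hp)
    have hmod : ∀ r', i % p + r' < p → (i + r') % p = i % p + r' := by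
      intro r' hr'
      conv_lhs => rw [← Nat.div_add_mod i p, Nat.add_assoc, Nat.mul_add_mod]
      exact Nat.mod_eq_of_lt hr'
    rcases lt_trichotomy r s with hlt | rfl | hgt
    · rw [h.eq_mod hr, hmod r (by omega), hs2 r hlt]
    · rw [h.eq_mod hr, hmod r hs1]
      exact hs3.le
    · exfalso
      have := hmatch s hgt
      rw [h.eq_mod (by omega), hmod s hs1] at this
      omega

/-- Increasing the last symbol of the repeated part. -/
theorem IsPeriodic.isPre_update (h : IsPeriodic y q p) :
    IsPre (fun i => if i = p - 1 then y i + 1 else y i) p := by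
  intro i h1 r hr hmatch
  obtain ⟨s, hs1, hs2, hs3⟩ := h.lyndon i h1 (by omega)
  -- The mismatch at `s` lies within the first `p` symbols, so a comparison that reaches the
  -- increased symbol at `p - 1` either has passed the mismatch or is at it; there the inequality is
  -- strict and absorbs the increase.
  have key : y (i + r) ≤ y r ∧ (i + r = p - 1 → y (i + r) < y r) := by
    rcases lt_trichotomy r s with hlt | rfl | hgt
    · have := hs2 r hlt
      exact ⟨this.le, fun h => by omega⟩
    · exact ⟨hs3.le, fun _ => hs3⟩
    · exfalso
      have h2 := hmatch s hgt
      simp only at h2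
      rw [if_neg (by omega), if_neg (by omega)] at h2
      omega
  simp only
  split_ifs with h2 h3
  · omega
  · exact key.2 h2
  · omega
  · exact key.1

/-- Of a prenecklace, no symbol exceeds the one a period earlier. -/
theorem IsMaxNecklace.getElem_le_sub {N : List ℕ} (hN : IsMaxNecklace N)
    (h : IsPeriodic y q p) (hpq : p ≤ q) (hq : q < N.length)
    (hpre : N.take q = prefixOf y q) : N[q] ≤ N[q - p] := by
  -- Compare `N` with its rotation by `p`: the first `q - p` symbols agree by periodicity, and the
  -- next ones are `N[q - p]` and `N[q]`.
  have h1 := take_le_take (hN p) (q - p + 1)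
  rw [List.rotate_eq_drop_append_take (by omega), List.take_append_of_le_length (by simp; omega),
    List.take_add_one, List.take_add_one (l := N)] at h1
  have hp := h.pos
  have h2 : (N.drop p).take (q - p) = N.take (q - p) := by
    have h3 : N.take (q - p) = prefixOf y (q - p) := by
      rw [← take_prefixOf y (Nat.sub_le q p), ← hpre, List.take_take, min_eq_left (Nat.sub_le _ _)]
    rw [h3, ← List.drop_take, hpre, drop_prefixOf]
    refine prefixOf_congr fun r hr => ?_
    rw [h.eq (p + r) (by omega) (by omega), Nat.add_sub_cancel_left]
  have h4 : (N.drop p)[q - p]? = some N[q] := by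
    rw [List.getElem?_drop, show p + (q - p) = q by omega, List.getElem?_eq_getElem hq]
  rw [h2, h4, List.getElem?_eq_getElem (by omega)] at h1
  by_contra hlt
  rw [not_le] at hlt
  have h5 : [N[q - p]] < [N[q]] := List.cons_lt_cons_iff.mpr (Or.inl hlt)
  exact absurd (List.append_left_lt (l₁ := N.take (q - p)) h5) (not_lt.mpr h1)

end UCycle

namespace UCycle

/-! ### Numbers of strings with large rotations -/

theorem append_singleton_lt {u v : List ℕ} (h : u.length = v.length) (a b : ℕ) :
    u ++ [a] < v ++ [b] ↔ u < v ∨ u = v ∧ a < b := by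
  induction u generalizing v with
  | nil =>
    rw [List.length_eq_zero_iff.mp h.symm]
    simp [List.cons_lt_cons_iff]
  | cons x u ih =>
    cases v with
    | nil => simp at h
    | cons y v =>
      simp only [List.cons_append, List.cons_lt_cons_iff, ih (Nat.succ.inj h), List.cons.injEq]
      tauto

theorem append_singleton_le {u v : List ℕ} (h : u.length = v.length) (a b : ℕ) :
    u ++ [a] ≤ v ++ [b] ↔ u < v ∨ u = v ∧ a ≤ b := by
  rw [le_iff_lt_or_eq, append_singleton_lt h, le_iff_lt_or_eq,
    List.append_singleton_inj]
  tauto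

theorem take_succ_eq {N : List ℕ} {q : ℕ} (h : q < N.length) :
    N.take (q + 1) = N.take q ++ [N[q]] := by
  rw [List.take_add_one, List.getElem?_eq_getElem h, Option.toList_some]

theorem hasBlock_iff {y : ℕ → ℕ} {l : ℕ} {z : List ℕ} (hl : l ≤ z.length) :
    HasBlock y l z ↔ z.take l < prefixOf y l := by
  constructor
  · rintro ⟨j, hj, c, hc, z', rfl⟩
    refine lt_of_take_lt (i := j + 1) ?_
    rw [List.take_take, min_eq_left (by omega), take_prefixOf _ (by omega), prefixOf_succ,
      List.take_left' (by simp), append_singleton_lt rfl]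
    exact Or.inr ⟨rfl, hc⟩
  · intro h
    rw [List.lt_iff_exists] at h
    rcases h with ⟨-, h⟩ | ⟨i, h1, h2, h3, h4⟩
    · simp at h
      omega
    · simp only [List.getElem_take, getElem_prefixOf] at h3 h4
      rw [length_prefixOf] at h2
      refine ⟨i, h2, _, h4, ?_⟩
      rw [show prefixOf y i = z.take i from List.ext_getElem (by simp; omega) fun k hk hk' => by
        simp only [getElem_prefixOf, List.getElem_take]
        exact (h3 k (by simpa using hk)).symm, ← take_succ_eq]
      exact List.take_prefix _ _

/-- Connects blocks with rotation classes: all rotations lie below `y` as soon as the largest does.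
-/
theorem allRotationsBelow_iff {y : ℕ → ℕ} {l : ℕ} {z : List ℕ} (hl : l ≤ z.length) :
    AllRotationsBelow y l z ↔ (maxRotation z).take l < prefixOf y l := by
  constructor
  · intro h
    obtain ⟨i, hi⟩ := maxRotation_eq z
    rw [← hasBlock_iff (by simpa using hl), hi]
    exact h i
  · intro h i
    rw [hasBlock_iff (by simpa using hl)]
    exact (take_le_take (rotate_le_maxRotation z i) l).trans_lt h

section

variable {n t : ℕ} {y : ℕ → ℕ} {q p : ℕ}

/-- The number of strings whose largest rotation has a prefix that is at least `w`. -/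
noncomputable def endOf (n t : ℕ) (w : List ℕ) : ℕ :=
  (classes n t fun N => w ≤ N.take w.length).ncard

theorem endOf_add_countBelow {l : ℕ} (hl : l ≤ t) :
    endOf n t (prefixOf y l) + countBelow n t y l = numStrings n t := by
  rw [endOf, countBelow, numStrings, ← Set.ncard_union_eq ?_ (finite_classes _ _ _)
    (finite_strings_of_sum_lt _ _ _)]
  · congr 1
    ext z
    simp only [classes, Set.mem_union, Set.mem_ofPred_eq, length_prefixOf, true_and]
    constructor
    · rintro (h | h) <;> exact h.2
    · intro h
      rw [allRotationsBelow_iff (by omega)]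
      rcases le_or_gt (prefixOf y l) ((maxRotation z).take l) with h' | h'
      · exact Or.inl ⟨h', h⟩
      · exact Or.inr ⟨h', h⟩
  · rw [Set.disjoint_left]
    rintro z ⟨h1, h2, -⟩ ⟨h3, -⟩
    rw [allRotationsBelow_iff (by omega)] at h3
    rw [length_prefixOf] at h1
    exact absurd h3 (not_lt.mpr h1)

theorem classes_congr {P Q : List ℕ → Prop}
    (h : ∀ N : List ℕ, IsMaxNecklace N → N.length = t → N.sum < n → (P N ↔ Q N)) :
    classes n t P = classes n t Q := by
  ext z
  simp only [classes, Set.mem_ofPred_eq]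
  refine and_congr_left fun hz => h _ (isMaxNecklace_maxRotation z) (by simp [hz.1]) ?_
  rw [sum_maxRotation]
  exact hz.2

theorem startOf_one (ht : 1 ≤ t) (hy : n ≤ y 0 + 1) : startOf n t (prefixOf y 1) = 0 := by
  rw [startOf, classes_congr (Q := fun _ => False)]
  · simp [classes]
  · intro N _ hl hs
    have h0 : N[0] ≤ N.sum := List.le_sum_of_mem (List.getElem_mem _)
    rw [length_prefixOf, show (1 : ℕ) = 0 + 1 from rfl, prefixOf_succ, take_succ_eq (by omega),
      append_singleton_lt (by simp)]
    simp [prefixOf]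
    omega

/-- A necklace with the given first `q` symbols cannot have a larger next symbol than the period
predicts, so to exceed the longer prefix it must already exceed the shorter one. -/
theorem startOf_succ (h : IsPeriodic y q p) (hpq : p ≤ q) (hq : q < t) (heq : y q = y (q - p)) :
    startOf n t (prefixOf y (q + 1)) = startOf n t (prefixOf y q) := by
  rw [startOf, startOf, classes_congr]
  intro N hN hl _
  have hlen : (prefixOf y q).length = (N.take q).length := by simp; omega
  rw [length_prefixOf, length_prefixOf, prefixOf_succ, take_succ_eq (by omega),
    append_singleton_lt hlen, or_iff_left]
  rintro ⟨h1, h2⟩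
  have h3 := hN.getElem_le_sub h hpq (by omega) h1.symm
  have h4 : N[q - p] = y (q - p) := by
    have hp := h.pos
    have := List.getElem_of_eq h1 (i := q - p) (by simp; omega)
    simpa using this.symm
  omega

theorem startOf_eq_startOf (h : IsPeriodic y q p) (hpq : p ≤ q) (hq : q ≤ t) :
    startOf n t (prefixOf y q) = startOf n t (prefixOf y p) := by
  induction q, hpq using Nat.le_induction with
  | base => rfl
  | succ q hpq ih =>
    have h' : IsPeriodic y q p := ⟨h.pos, h.lyndon, fun i h1 h2 => h.eq i h1 (by omega)⟩
    rw [startOf_succ h' hpq (by omega) (h.eq q hpq (by omega)), ih h' (by omega)]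

/-- Symbols are integers: exceeding a symbol means being at least the next one. -/
theorem startOf_eq_endOf {y' : ℕ → ℕ} (hq : q < t) (h : ∀ i < q, y' i = y i)
    (hy : y' q = y q + 1) :
    startOf n t (prefixOf y (q + 1)) = endOf n t (prefixOf y' (q + 1)) := by
  rw [startOf, endOf, classes_congr]
  intro N _ hl _
  have hlen : (prefixOf y q).length = (N.take q).length := by simp; omega
  rw [length_prefixOf, length_prefixOf, prefixOf_succ, prefixOf_succ, take_succ_eq (by omega),
    prefixOf_congr h, append_singleton_lt hlen, append_singleton_le hlen, hy]
  rfl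

theorem endOf_succ (hq : q < t) (h : y q = 0) :
    endOf n t (prefixOf y (q + 1)) = endOf n t (prefixOf y q) := by
  rw [endOf, endOf, classes_congr]
  intro N _ hl _
  have hlen : (prefixOf y q).length = (N.take q).length := by simp; omega
  rw [length_prefixOf, length_prefixOf, prefixOf_succ, take_succ_eq (by omega),
    append_singleton_le hlen, h, le_iff_lt_or_eq (a := prefixOf y q)]
  simp

theorem endOf_zero : endOf n t (prefixOf y 0) = numStrings n t := by
  simp [endOf, numStrings, prefixOf]

/-- The number of strings with a rotation above `y` is obtained by increasing the last symbol of the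
repeated part of `y`. -/
theorem startOf_add_countBelow (h : IsPeriodic y q p) (hpq : p ≤ q) (hq : q ≤ t) :
    startOf n t (prefixOf y q) +
      countBelow n t (fun i => if i = p - 1 then y i + 1 else y i) p = numStrings n t := by
  have hp := h.pos
  obtain ⟨k, rfl⟩ : ∃ k, p = k + 1 := ⟨p - 1, by omega⟩
  rw [startOf_eq_startOf h hpq hq, startOf_eq_endOf (q := k) (y' := fun i => if i = k + 1 - 1 then y i + 1
    else y i) (by omega) (fun i hi => if_neg (by omega)) (if_pos rfl)]
  exact endOf_add_countBelow (by omega)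

theorem isPre_one (y : ℕ → ℕ) : IsPre y 1 := (isPeriodic_one y).isPre

/-- Lets the counting procedure compute the length of the cycle: the single symbol `n` exceeds every
admissible string. -/
theorem countBelow_one (ht : 1 ≤ t) (hy : y 0 = n) : countBelow n t y 1 = numStrings n t := by
  have h : endOf n t (prefixOf y 1) = 0 := by
    rw [endOf, classes_congr (Q := fun _ => False)]
    · simp [classes]
    · intro N _ hl hs
      have h0 : N[0] ≤ N.sum := List.le_sum_of_mem (List.getElem_mem _)
      rw [length_prefixOf, show (1 : ℕ) = 0 + 1 from rfl, prefixOf_succ, take_succ_eq (by omega),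
        append_singleton_le (by simp)]
      simp [prefixOf]
      omega
  rw [← endOf_add_countBelow (y := y) ht, h, zero_add]

theorem numStrings_eq (hn : 1 ≤ n) (ht : 1 ≤ t) : numStrings n t = (diffCycle n t).length :=
  (length_diffCycle hn ht).symm

/-! ### The position of a string -/

/-- A string `z` at whose last maximal rotation `z.rotate o` is neither a rotation by its leading
zeros. -/
theorem window_of_last_maximal (hn : 1 ≤ n) (ht : 1 ≤ t) {z : List ℕ} (hl : z.length = t)
    (hs : z.sum < n) (hz : z ≠ List.replicate t 0) {o m : ℕ} (ho : o ≤ t)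
    (hmax : IsMaxNecklace (z.rotate o)) (hlast : ∀ j, o < j → j ≤ t → z.rotate j ≠ z.rotate o)
    (hm : m < t) (hm0 : z.take m = List.replicate m 0) (hm1 : z[m] ≠ 0) :
    if z.rotate m = z.rotate o then
      m ≤ numStrings n t ∧ window (diffCycle n t) t
        ((startOf n t ((z.rotate o).take (t - m)) + (numStrings n t - m)) % numStrings n t) = z
    else startOf n t (z.rotate o) + (t - o) < numStrings n t ∧
      window (diffCycle n t) t (startOf n t (z.rotate o) + (t - o)) = z := by
  rw [numStrings_eq hn ht]
  have hN : z.rotate o ∈ maxNecklaces n t := (mem_maxNecklaces hn ht).mpr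
    ⟨⟨by simp [hl], by rwa [(List.rotate_perm _ _).sum_eq]⟩, hmax⟩
  have hzi : z = (z.rotate o).rotate (t - o) := by
    rw [List.rotate_rotate, Nat.add_sub_cancel' ho, ← hl, List.rotate_length]
  have hne : z.rotate o ≠ List.replicate t 0 := fun h => hz (by
    rw [hzi, h, List.rotate_replicate])
  split_ifs with hif
  · have hw : z = List.replicate m 0 ++ z.drop m := by rw [← hm0, List.take_append_drop]
    have h2 : z.rotate o = z.drop m ++ List.replicate m 0 := by
      rw [← hif, List.rotate_eq_drop_append_take (by omega), hm0]
    have hw0 : z.drop m ≠ [] := List.ne_nil_of_length_pos (by simp; omega)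
    have htake : (z.rotate o).take (t - m) = z.drop m := by
      rw [h2, List.take_left' (by simp [hl])]
    rw [htake]
    rw [h2] at hN hne
    obtain ⟨h3, h4⟩ := window_zeros_append hn ht hN hne hw0
    exact ⟨h3, h4.trans hw.symm⟩
  -- If the offset reached the period, rotating one period further would give another largest
  -- rotation after `o`.
  · have hlt : t - o < period (z.rotate o) := by
      by_contra hge
      have hp := period_pos (s := z.rotate o) (by simp; omega)
      refine hlast (o + period (z.rotate o)) (by omega) (by omega) ?_
      rw [← List.rotate_rotate, rotate_period]
    by_cases h0 : (root (z.rotate o)).drop (t - o) =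
        List.replicate (period (z.rotate o) - (t - o)) 0
    · exfalso
      obtain ⟨w, m', h1, h2, h3⟩ := rotate_cases (by omega) (by rwa [hl]) hlt hzi h0
      have hwpos := List.length_pos_of_ne_nil h3
      have hw0 : w[0] ≠ 0 := by
        intro h4
        have h5 := hmax.eq_zeros (by simp; omega) (by simp only [← h2]; simpa [hwpos] using h4)
        rw [List.length_rotate, hl] at h5
        exact hne h5
      -- A largest rotation of a nonzero string starts with a nonzero symbol, so the zeros to be
      -- moved are exactly the leading zeros of `z`.
      have hmm : m = m' := by
        have hlen := congrArg List.length h1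
        simp at hlen
        rcases lt_trichotomy m m' with h | h | h
        · refine absurd ?_ hm1
          simp [h1, h]
        · exact h
        · have h6 := List.getElem_of_eq hm0 (i := m') (by simp; omega)
          simp only [List.getElem_take, List.getElem_replicate] at h6
          have h7 := List.getElem_of_eq h1 (i := m') (by omega)
          rw [h6, List.getElem_append_right (by simp)] at h7
          simp at h7
          exact absurd h7.symm hw0
      apply hif
      rw [hmm, ← h2]
      conv_lhs => rw [h1]
      have := List.rotate_append_length_eq (List.replicate m' 0) w
      rwa [List.length_replicate] at this
    · obtain ⟨h1, h2⟩ := window_rotate hn ht hN hlt h0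
      exact ⟨h1, h2.trans hzi.symm⟩

end

end UCycle

/-! ### Rules for stores and straight-line code. -/

namespace Ram

namespace Store

variable (v : Store) (x a k i : ℕ)

@[simp] theorem setVar_var (y : ℕ) : (v.setVar x a).var y = if y = x then a else v.var y := rfl
@[simp] theorem setVar_arr : (v.setVar x a).arr = v.arr := rfl
@[simp] theorem setVar_inp : (v.setVar x a).inp = v.inp := rfl
@[simp] theorem setVar_out : (v.setVar x a).out = v.out := rfl
@[simp] theorem setArr_var : (v.setArr k i a).var = v.var := rfl
@[simp] theorem setArr_arr (k' i' : ℕ) :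
    (v.setArr k i a).arr k' i' = if k' = k ∧ i' = i then a else v.arr k' i' := rfl
@[simp] theorem setArr_inp : (v.setArr k i a).inp = v.inp := rfl
@[simp] theorem setArr_out : (v.setArr k i a).out = v.out := rfl

theorem setArr_arr_of_ne {k k' : ℕ} (h : k' ≠ k) : (v.setArr k i a).arr k' = v.arr k' := by
  funext j
  simp [h]

end Store

namespace Triple

variable {B : ℕ} {v : Store} {p q : Program} {T T' : ℕ} {Q R : Store → Prop}

theorem weaken (h : Triple B p v T Q) (hT : T ≤ T') : Triple B p v T' Q := h.mono hT fun _ => id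

theorem assign_seq {x : ℕ} {e : Expr} (hx : x < 32) (he : e.ok = true) (hs : e.Safe B v)
    (hq : Triple B q (v.setVar x (e.eval v)) T Q) :
    Triple B (.seq (Ram.assign x e) q) v (100 + T) Q :=
  (assign (Q := (· = _)) hx he hs rfl).seq fun _ h => by subst h; exact hq

theorem put_seq {k : ℕ} {e f : Expr} (hk : k < 3) (he : e.ok = true) (hf : f.ok = true)
    (hse : e.Safe B v) (hsf : f.Safe B v) (hi : e.eval v < B)
    (hq : Triple B q (v.setArr k (e.eval v) (f.eval v)) T Q) :
    Triple B (.seq (Ram.put k e f) q) v (200 + T) Q :=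
  (put (Q := (· = _)) hk he hf hse hsf hi rfl).seq fun _ h => by subst h; exact hq

theorem read_seq {x a : ℕ} {l : List ℕ} (hx : x < 32) (hl : v.inp = a :: l)
    (hq : Triple B q { v.setVar x a with inp := l } T Q) :
    Triple B (.seq (.read x) q) v (1 + T) Q :=
  (read (Q := (· = _)) hx hl rfl).seq fun _ h => by subst h; exact hq

end Triple

/-! ### Counting the strings all of whose rotations are smaller than a prenecklace

Variables: `0` holds `n`, `1` holds `t`, `2` holds the length `l` of the prenecklace. Array `1` holds
the prenecklace, starting at index `1`. Variables from `20` on and array `2` are used for the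
computation. The result is in variable `23`. -/

open Ram.Expr

/-- Variable 20 holds the row `m`, 21 the last finished column, 24 the block index `j`, and 25 the
weight of the first `j` symbols. Variables 22 and 23 accumulate the sums for `blockCount` and, with
factors `j + 1`, for `countBelow`. The table is stored in rows of length `n + 1`. -/
def countTerm : Program :=
  .seq (assign 26 (get 2 ((var 20 - 1 - var 24) * (var 0 + 1) + (var 21 + 1 - var 25)) -
    get 2 ((var 20 - 1 - var 24) * (var 0 + 1) + (var 21 + 1 - var 25 - get 1 (var 24 + 1)))))
  (.seq (assign 22 (var 22 + var 26))
  (.seq (assign 23 (var 23 + (var 24 + 1) * var 26))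
  (.seq (assign 25 (var 25 + get 1 (var 24 + 1)))
  (assign 24 (var 24 + 1)))))

/-- The loop test is a product of truncated differences, so `j` runs below the minimum of `m` and
`l`. The new entry is its left neighbour plus the accumulated count. -/
def countCell : Program :=
  .seq (assign 22 0) (.seq (assign 23 0) (.seq (assign 24 0) (.seq (assign 25 0)
  (.seq (whileDo ((var 20 - var 24) * (var 2 - var 24)) countTerm)
  (.seq (put 2 (var 20 * (var 0 + 1) + (var 21 + 1))
    (get 2 (var 20 * (var 0 + 1) + var 21) + var 22))
  (assign 21 (var 21 + 1)))))))

def countRow : Program :=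
  .seq (put 2 (var 20 * (var 0 + 1)) 0) (.seq (assign 21 0)
  (.seq (whileDo (var 0 - var 21) countCell) (assign 20 (var 20 + 1))))

/-- Row `0` has entry `b` in column `b`, because the empty string is below each of the `b` positive
weight bounds. -/
def count : Program :=
  .seq (assign 21 0)
  (.seq (whileDo (var 0 + 1 - var 21) (.seq (put 2 (var 21) (var 21)) (assign 21 (var 21 + 1))))
  (.seq (assign 20 1) (whileDo (var 1 + 1 - var 20) countRow)))

/-- The stores agree on everything except the memory used for counting. -/
structure SameMain (v v' : Store) : Prop where
  var : ∀ x < 20, v'.var x = v.var x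
  arr0 : v'.arr 0 = v.arr 0
  arr1 : v'.arr 1 = v.arr 1
  inp : v'.inp = v.inp
  out : v'.out = v.out

namespace SameMain

theorem refl (v : Store) : SameMain v v := ⟨fun _ _ => rfl, rfl, rfl, rfl, rfl⟩

theorem setVar {v v' : Store} (h : SameMain v v') {x a : ℕ} (hx : 20 ≤ x) :
    SameMain v (v'.setVar x a) :=
  ⟨fun y hy => (if_neg (by omega)).trans (h.var y hy), h.arr0, h.arr1, h.inp, h.out⟩

theorem setArr {v v' : Store} (h : SameMain v v') {i a : ℕ} : SameMain v (v'.setArr 2 i a) :=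
  ⟨h.var, (Store.setArr_arr_of_ne _ _ _ (by decide)).trans h.arr0,
    (Store.setArr_arr_of_ne _ _ _ (by decide)).trans h.arr1, h.inp, h.out⟩

end SameMain

section

open UCycle

variable {n t l : ℕ} {y : ℕ → ℕ} {v₀ : Store}

theorem index_lt {m b : ℕ} (hm : m ≤ t) (hb : b ≤ n) : m * (n + 1) + b < (t + 1) * (n + 1) := by
  have := Nat.mul_le_mul_right (n + 1) hm
  rw [Nat.succ_mul]
  omega

/-- The contents of the variables and of the array with the prenecklace. -/
structure CountInput (n t l : ℕ) (y : ℕ → ℕ) (v : Store) : Prop where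
  var0 : v.var 0 = n
  var1 : v.var 1 = t
  var2 : v.var 2 = l
  letter : ∀ j < l, v.arr 1 (j + 1) = y j
  le : l ≤ t

theorem CountInput.of_sameMain {v : Store} (h : CountInput n t l y v₀) (hv : SameMain v₀ v) :
    CountInput n t l y v :=
  ⟨by rw [hv.var 0 (by omega), h.var0], by rw [hv.var 1 (by omega), h.var1],
    by rw [hv.var 2 (by omega), h.var2], fun j hj => by rw [hv.arr1, h.letter j hj], h.le⟩

/-- The table is filled up to row `m`, column `b`. -/
def TableFilled (n l : ℕ) (y : ℕ → ℕ) (m b : ℕ) (v : Store) : Prop :=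
  (∀ m' < m, ∀ b' ≤ n, v.arr 2 (m' * (n + 1) + b') = blockCountSum y l m' b') ∧
    ∀ b' ≤ b, v.arr 2 (m * (n + 1) + b') = blockCountSum y l m b'

noncomputable def countSummand (y : ℕ → ℕ) (l m b j : ℕ) : ℕ :=
  blockCountSum y l (m - 1 - j) (b - weight y j) - blockCountSum y l (m - 1 - j) (b - weight y (j + 1))

structure TermInv (n t l : ℕ) (y : ℕ → ℕ) (v₀ : Store) (m b j : ℕ) (v : Store) : Prop where
  same : SameMain v₀ v
  table : TableFilled n l y m b v
  var20 : v.var 20 = m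
  var21 : v.var 21 = b
  var24 : v.var 24 = j
  var25 : v.var 25 = weight y j
  acc : v.var 22 = ∑ i ∈ Finset.range j, countSummand y l m (b + 1) i
  acc' : v.var 23 = ∑ i ∈ Finset.range j, (i + 1) * countSummand y l m (b + 1) i

theorem triple_countTerm {m b j : ℕ} (h₀ : CountInput n t l y v₀) (hm : m ≤ t) (hb : b < n)
    (hj : j < min m l) {v : Store} (h : TermInv n t l y v₀ m b j v) :
    Triple ((t + 1) * (n + 1)) countTerm v 500 (TermInv n t l y v₀ m b (j + 1)) := by
  obtain ⟨hs, ht, h20, h21, h24, h25, h22, h23⟩ := h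
  obtain ⟨hn, ht1, hl, hy, hlt⟩ := h₀.of_sameMain hs
  have hyj := hy j (by omega)
  have hi1 := index_lt (t := t) (n := n) (m := m - 1 - j) (b := b + 1 - weight y j) (by omega)
    (by omega)
  have hi2 := index_lt (t := t) (n := n) (m := m - 1 - j) (b := b + 1 - weight y j - y j) (by omega)
    (by omega)
  have hi3 := index_lt (t := t) (n := n) (m := t) (b := 0) le_rfl (by omega)
  have hi4 : t ≤ t * (n + 1) := Nat.le_mul_of_pos_right t (Nat.succ_pos n)
  have hT1 := ht.1 (m - 1 - j) (by omega) (b + 1 - weight y j) (by omega)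
  have hT2 := ht.1 (m - 1 - j) (by omega) (b + 1 - weight y (j + 1)) (by omega)
  rw [weight_succ, ← Nat.sub_sub] at hT2
  have hD : countSummand y l m (b + 1) j = blockCountSum y l (m - 1 - j) (b + 1 - weight y j) -
      blockCountSum y l (m - 1 - j) (b + 1 - weight y j - y j) := by
    rw [countSummand, weight_succ, Nat.sub_sub (b + 1)]
  refine Triple.weaken (Triple.assign_seq (by omega) rfl ?_ (Triple.assign_seq (by omega) rfl ?_
    (Triple.assign_seq (by omega) rfl ?_ (Triple.assign_seq (by omega) rfl ?_
    (Triple.assign (by omega) rfl ?_ ?_))))) (by omega)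
  · simp [h20, h21, h24, h25, hn, hyj]
    omega
  · simp
  · simp
  · simp [h24]
    omega
  · simp
  · refine ⟨((((hs.setVar (by omega)).setVar (by omega)).setVar (by omega)).setVar
      (by omega)).setVar (by omega), ht, ?_, ?_, ?_, ?_, ?_, ?_⟩
    · simp [h20]
    · simp [h21]
    · simp [h24]
    · simp [h24, h25, hyj, weight_succ]
    · rw [Finset.sum_range_succ, hD]
      simp [h20, h21, h22, h24, h25, hn, hyj, hT1, hT2]
    · rw [Finset.sum_range_succ, hD]
      simp [h20, h21, h23, h24, h25, hn, hyj, hT1, hT2]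

/-- Variable 23 keeps the weighted sum of the cell computed last, so the claim about it starts once
a cell of the row is finished. -/
structure CellInv (n t l : ℕ) (y : ℕ → ℕ) (v₀ : Store) (m b : ℕ) (v : Store) : Prop where
  same : SameMain v₀ v
  table : TableFilled n l y m b v
  var20 : v.var 20 = m
  var21 : v.var 21 = b
  acc : 0 < b → v.var 23 = ∑ i ∈ Finset.range (min m l), (i + 1) * countSummand y l m b i

theorem triple_countCell {m b : ℕ} (h₀ : CountInput n t l y v₀) (hm : m ≤ t) (hm0 : m ≠ 0)
    (hb : b < n) {v : Store} (h : CellInv n t l y v₀ m b v) :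
    Triple ((t + 1) * (n + 1)) countCell v (800 + (t * 600 + 100))
      (CellInv n t l y v₀ m (b + 1)) := by
  obtain ⟨hs, ht, h20, h21, -⟩ := h
  refine Triple.weaken (Triple.assign_seq (by omega) rfl (by simp) (Triple.assign_seq (by omega) rfl
    (by simp) (Triple.assign_seq (by omega) rfl (by simp) (Triple.assign_seq (by omega) rfl (by simp)
    (Triple.seq (Triple.whileDo (TermInv n t l y v₀ m b) (min m l) (T := 500) rfl ?_ ?_ ?_ ?_
      (fun _ h => h)) (T' := 300) ?_))))) ?_
  · intro j _ v _
    simp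
  · intro j hj v h
    refine ⟨?_, triple_countTerm h₀ hm hb hj h⟩
    simp [h.var20, h.var24, (h₀.of_sameMain h.same).var2]
    omega
  · intro v h
    simp [h.var20, h.var24, (h₀.of_sameMain h.same).var2]
    omega
  · refine ⟨(((hs.setVar (by omega)).setVar (by omega)).setVar (by omega)).setVar (by omega), ht,
      ?_, ?_, ?_, ?_, ?_, ?_⟩ <;> simp [h20, h21, weight]
  · intro v h
    obtain ⟨hs, ht, h20, h21, h24, h25, h22, h23⟩ := h
    have hn := (h₀.of_sameMain hs).var0
    have hT := ht.2 b le_rfl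
    have hi := index_lt (t := t) (n := n) (m := m) (b := b + 1) (by omega) (by omega)
    refine Triple.weaken (Triple.put_seq (by omega) rfl rfl ?_ ?_ ?_ (Triple.assign (by omega) rfl
      (by simp) ?_)) le_rfl
    · simp
    · simp [h20, h21, hn]
      omega
    · simpa [h20, h21, hn] using hi
    · refine ⟨hs.setArr.setVar (by omega), ⟨?_, ?_⟩, by simpa using h20, by simp [h21], ?_⟩
      · intro m' hm' b' hb'
        have := Nat.mul_le_mul_right (n + 1) (Nat.succ_le_of_lt hm')
        rw [Nat.succ_mul] at this
        simp [h20, h21, hn]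
        rw [if_neg (by omega), ht.1 m' hm' b' hb']
      · intro b' hb'
        simp [h20, h21, hn]
        rcases Nat.lt_succ_iff_lt_or_eq.mp (Nat.lt_succ_of_le hb') with hlt | rfl
        · rw [if_neg (by omega), ht.2 b' (by omega)]
        · rw [if_pos rfl, hT, h22]
          rw [blockCountSum, blockCountSum, Finset.sum_range_succ, blockCount_succ y l m _ hm0]
          rfl
      · intro _
        simp [h23]
  · have : min m l * 600 ≤ t * 600 := Nat.mul_le_mul_right _ (by omega)
    omega

structure RowInv (n t l : ℕ) (y : ℕ → ℕ) (v₀ : Store) (m : ℕ) (v : Store) : Prop where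
  same : SameMain v₀ v
  table : ∀ m' ≤ m, ∀ b' ≤ n, v.arr 2 (m' * (n + 1) + b') = blockCountSum y l m' b'
  var20 : v.var 20 = m + 1
  acc : 0 < m → v.var 23 = ∑ i ∈ Finset.range (min m l), (i + 1) * countSummand y l m n i

theorem triple_countRow {m : ℕ} (h₀ : CountInput n t l y v₀) (hn : 1 ≤ n) (hm : m < t) {v : Store}
    (h : RowInv n t l y v₀ m v) :
    Triple ((t + 1) * (n + 1)) countRow v (500 + n * (1000 + t * 600))
      (RowInv n t l y v₀ (m + 1)) := by
  obtain ⟨hs, ht, h20, -⟩ := h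
  have hvn := (h₀.of_sameMain hs).var0
  have hi := index_lt (t := t) (n := n) (m := m + 1) (b := 0) (by omega) (by omega)
  refine Triple.weaken (Triple.put_seq (by omega) rfl rfl (by simp) (by simp) ?_
    (Triple.assign_seq (by omega) rfl (by simp) (Triple.seq (Triple.whileDo
      (CellInv n t l y v₀ (m + 1)) n (T := 800 + (t * 600 + 100)) rfl ?_ ?_ ?_ ?_ (fun _ h => h))
      (T' := 100) ?_))) ?_
  · simpa [h20, hvn] using hi
  · intro b _ v _
    simp
  · intro b hb v h
    refine ⟨?_, triple_countCell h₀ (by omega) (by omega) hb h⟩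
    simp [h.var21, (h₀.of_sameMain h.same).var0]
    omega
  · intro v h
    simp [h.var21, (h₀.of_sameMain h.same).var0]
  · refine ⟨hs.setArr.setVar (by omega), ⟨?_, ?_⟩, by simpa using h20, by simp, by simp⟩
    · intro m' hm' b' hb'
      have := Nat.mul_le_mul_right (n + 1) (Nat.succ_le_of_lt hm')
      rw [Nat.succ_mul] at this
      simp [h20, hvn]
      rw [if_neg (by omega), ht m' (by omega) b' hb']
    · intro b' hb'
      obtain rfl : b' = 0 := by omega
      simp [h20, hvn, blockCountSum]
  · intro v h
    refine Triple.assign (by omega) rfl (by simp) ⟨h.same.setVar (by omega), ?_, by simp [h.var20], ?_⟩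
    · intro m' hm' b' hb'
      rcases Nat.lt_succ_iff_lt_or_eq.mp (Nat.lt_succ_of_le hm') with hlt | rfl
      · exact h.table.1 m' hlt b' hb'
      · exact h.table.2 b' hb'
    · intro _
      simpa using h.acc hn
  · have : n * (1000 + t * 600) = n * (800 + (t * 600 + 100) + 100) := by ring
    omega

/-- The time for counting. -/
def countTime (n t : ℕ) : ℕ := 1000 + (n + 1) * 400 + t * (600 + n * (1000 + t * 600))

/-- The last cell computed has row `t` and column `n`, where the weighted sum in variable 23 is the
formula of `countBelow_eq`. -/
theorem triple_count (h₀ : CountInput n t l y v₀) (hn : 1 ≤ n) (ht : 1 ≤ t) (hy : IsPre y l) :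
    Triple ((t + 1) * (n + 1)) count v₀ (countTime n t) fun v =>
      SameMain v₀ v ∧ v.var 23 = countBelow n t y l := by
  have hi := index_lt (t := t) (n := n) (m := 0) (b := n) (by omega) le_rfl
  refine Triple.weaken (Triple.assign_seq (by omega) rfl (by simp) (Triple.seq (Triple.whileDo
      (fun b v => SameMain v₀ v ∧ v.var 21 = b ∧ ∀ b' < b, v.arr 2 b' = b') (n + 1) (T := 300) rfl
      ?_ ?_ ?_ ?_ (fun _ h => h)) (T' := 100 + (t * (500 + n * (1000 + t * 600) + 100) + 100))
      ?_)) ?_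
  · intro b _ v _
    simp
  · rintro b hb v ⟨hs, h21, hv⟩
    refine ⟨?_, Triple.put_seq (by omega) rfl rfl (by simp) (by simp) ?_ (Triple.assign (by omega)
      rfl (by simp) ⟨hs.setArr.setVar (by omega), by simp [h21], ?_⟩)⟩
    · simp [h21, (h₀.of_sameMain hs).var0]
      omega
    · simp [h21]
      omega
    · intro b' hb'
      simp [h21]
      rcases Nat.lt_succ_iff_lt_or_eq.mp hb' with hlt | rfl
      · rw [if_neg (by omega), hv b' hlt]
      · simp
  · rintro v ⟨hs, h21, -⟩
    simp [h21, (h₀.of_sameMain hs).var0]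
  · exact ⟨(SameMain.refl v₀).setVar (by omega), by simp, by simp⟩
  · rintro v ⟨hs, -, hv⟩
    refine Triple.assign_seq (by omega) rfl (by simp) (Triple.whileDo (RowInv n t l y v₀) t rfl
      ?_ ?_ ?_ ?_ ?_)
    · intro m _ v _
      simp
    · intro m hm v h
      refine ⟨?_, triple_countRow h₀ hn hm h⟩
      simp [h.var20, (h₀.of_sameMain h.same).var1]
      omega
    · intro v h
      simp [h.var20, (h₀.of_sameMain h.same).var1]
    · refine ⟨hs.setVar (by omega), ?_, by simp, by simp⟩
      intro m' hm' b' hb'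
      obtain rfl : m' = 0 := by omega
      simp [hv b' (by omega), blockCountSum, blockCount_length_zero]
    · intro v h
      refine ⟨h.same, ?_⟩
      rw [h.acc ht, countBelow_eq n t hy h₀.le, min_eq_right h₀.le]
      rfl
  · rw [countTime, show t * (600 + n * (1000 + t * 600)) =
      t * (500 + n * (1000 + t * 600) + 100) by ring]
    omega

end

end Ram

/-! ### Comparing rotations -/

namespace UCycle

section

variable {t : ℕ} {z : List ℕ}

theorem getElem_rotate_eq (hl : z.length = t) (a i : ℕ) (hi : i < (z.rotate a).length) :
    (z.rotate a)[i] = z.getD ((a + i) % t) 0 := by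
  have : (a + i) % t < z.length := hl ▸ Nat.mod_lt _ (by simp at hi; omega)
  rw [List.getElem_rotate, List.getD_eq_getElem _ _ this]
  simp only [hl, add_comm]

theorem rotate_lt_rotate (hl : z.length = t) {a b r : ℕ} (hr : r < t)
    (h : ∀ i < r, z.getD ((a + i) % t) 0 = z.getD ((b + i) % t) 0)
    (hlt : z.getD ((a + r) % t) 0 < z.getD ((b + r) % t) 0) : z.rotate a < z.rotate b := by
  refine lt_of_take_lt (i := r + 1) ?_
  rw [take_succ_eq (by simp; omega), take_succ_eq (by simp; omega),
    append_singleton_lt (by simp), getElem_rotate_eq hl, getElem_rotate_eq hl]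
  refine Or.inr ⟨?_, hlt⟩
  refine List.ext_getElem (by simp) fun i h1 h2 => ?_
  rw [List.getElem_take, List.getElem_take, getElem_rotate_eq hl, getElem_rotate_eq hl]
  exact h i (by simp at h1; omega)

theorem rotate_eq_rotate (hl : z.length = t) {a b : ℕ}
    (h : ∀ i < t, z.getD ((a + i) % t) 0 = z.getD ((b + i) % t) 0) : z.rotate a = z.rotate b := by
  refine List.ext_getElem (by simp) fun i h1 h2 => ?_
  rw [getElem_rotate_eq hl, getElem_rotate_eq hl]
  exact h i (by simp at h1; omega)

/-- The search runs over `1, …, t` rather than `0, …, t - 1`; rotation by `t` stands for rotation by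
`0`. -/
theorem isMaxNecklace_rotate (hl : z.length = t) (ht : 1 ≤ t) {o : ℕ}
    (h : ∀ i, 1 ≤ i → i ≤ t → z.rotate i ≤ z.rotate o) : IsMaxNecklace (z.rotate o) := by
  intro i
  rw [List.rotate_rotate, ← List.rotate_mod, hl]
  rcases Nat.eq_zero_or_pos ((o + i) % t) with h0 | h0
  · have := h t ht le_rfl
    rw [h0, List.rotate_zero]
    rwa [← hl, List.rotate_length] at this
  · exact h _ h0 (Nat.mod_lt _ ht).le

theorem take_rotate (hl : z.length = t) (o : ℕ) {q : ℕ} (hq : q ≤ t) :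
    (z.rotate o).take q = prefixOf (fun i => z.getD ((o + i) % t) 0) q := by
  refine List.ext_getElem (by simp; omega) fun i h1 h2 => ?_
  rw [List.getElem_take, getElem_rotate_eq hl, getElem_prefixOf]

end

end UCycle

/-! ### Ranking

Variables: `0` holds `n`, `1` holds `t`, `6` holds the length of the cycle. Array `0` holds two copies
of the string that is to be ranked. -/

namespace Ram

open UCycle Ram.Expr

/-- Read `n` and `t` and compute the length of the cycle. -/
def setup : Program :=
  .seq (.read 0) (.seq (.read 1) (.seq (put 1 1 (var 0)) (.seq (assign 2 1) (.seq count
  (assign 6 (var 23))))))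

/-- Read a string whose symbols are obtained from the input by means of `e`, where variable `4` holds
the current and variable `5` the previous number in the input. -/
def readString (e : Expr) : Program :=
  .seq (assign 3 0) (.seq (assign 5 0) (whileDo (var 1 - var 3)
  (.seq (.read 4) (.seq (put 0 (var 3) e) (.seq (put 0 (var 3 + var 1) e) (.seq (assign 5 (var 4))
  (assign 3 (var 3 + 1))))))))

/-- Find the first difference of the rotations by the variables `a` and `b`. -/
def mismatch (a b : ℕ) : Program :=
  .seq (assign 9 0) (whileDo ((var 1 - var 9) *
    (1 - ((get 0 (var a + var 9) - get 0 (var b + var 9)) +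
      (get 0 (var b + var 9) - get 0 (var a + var 9))))) (assign 9 (var 9 + 1)))

/-- Find the last largest rotation. -/
def findRotation : Program :=
  .seq (assign 7 1) (.seq (assign 8 2) (whileDo (var 1 + 1 - var 8) (.seq (mismatch 8 7)
  (.seq (ifElse ((var 1 - var 9) * (get 0 (var 7 + var 9) - get 0 (var 8 + var 9))) .skip
    (assign 7 (var 8))) (assign 8 (var 8 + 1))))))

/-- Count the leading zeros. -/
def leadingZeros : Program :=
  .seq (assign 10 0) (whileDo ((var 1 - var 10) * (1 - get 0 (var 10))) (assign 10 (var 10 + 1)))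

/-- Copy a prefix of the rotation to array `1`. -/
def copyPrefix : Program :=
  .seq (assign 3 0) (whileDo (var 11 - var 3)
  (.seq (put 1 (var 3 + 1) (get 0 (var 7 + var 3))) (assign 3 (var 3 + 1))))

/-- Find the period of the prefix and increase the last symbol of its repeated part. -/
def increasePeriod : Program :=
  .seq (assign 13 1) (.seq (assign 3 1) (.seq (whileDo (var 11 - var 3)
  (.seq (ifElse (get 1 (var 3 + 1 - var 13) - get 1 (var 3 + 1)) (assign 13 (var 3 + 1)) .skip)
    (assign 3 (var 3 + 1)))) (.seq (put 1 (var 13) (get 1 (var 13) + 1)) (assign 2 (var 13)))))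

/-- Compute the rank of a nonzero string. -/
def locate : Program :=
  .seq findRotation (.seq (mismatch 10 7)
  (.seq (ifElse (var 1 - var 9)
    (.seq (assign 11 (var 1)) (.seq (assign 12 (var 1 - var 7)) (assign 10 0)))
    (.seq (assign 11 (var 1 - var 10)) (assign 12 0)))
  (.seq copyPrefix (.seq increasePeriod (.seq count
  (.seq (assign 15 (var 6 * 2 - var 23 + var 12 - var 10))
    (assign 14 (var 15 - var 15 / var 6 * var 6 + 1))))))))

def rankProgram (e : Expr) : Program :=
  .seq setup (.seq (readString e) (.seq leadingZeros
  (.seq (ifElse (var 1 - var 10) locate (assign 14 (var 6 - var 1 + 1))) (print (var 14)))))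

/-- The list of the `f p x` for the consecutive numbers `p`, `x`. -/
def decode (f : ℕ → ℕ → ℕ) : ℕ → List ℕ → List ℕ
  | _, [] => []
  | p, x :: l => f p x :: decode f x l

theorem Store.setVar_setVar (v : Store) (x a b : ℕ) :
    (v.setVar x a).setVar x b = v.setVar x b := by
  simp only [Store.setVar, Store.mk.injEq, and_true]
  funext y
  split_ifs <;> rfl

section

variable {n t : ℕ} {z x : List ℕ} {v : Store}

theorem two_mul_lt (hn : 1 ≤ n) : 2 * t < (t + 1) * (n + 1) := by
  have := Nat.mul_le_mul_left (t + 1) (show 2 ≤ n + 1 by omega)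
  omega

/-- The prenecklace used here is the single symbol `n`, below which all strings lie
(`countBelow_one`). -/
theorem triple_setup (hn : 1 ≤ n) (ht : 1 ≤ t) :
    Triple ((t + 1) * (n + 1)) setup ⟨fun _ => 0, fun _ _ => 0, n :: t :: x, []⟩
      (500 + countTime n t) fun v =>
      v.var 0 = n ∧ v.var 1 = t ∧ v.var 6 = numStrings n t ∧ v.inp = x ∧ v.out = [] := by
  have hB := two_mul_lt (t := t) hn
  refine Triple.weaken (Triple.read_seq (by omega) rfl (Triple.read_seq (by omega) rfl
    (Triple.put_seq (by omega) rfl rfl (by simp) (by simp) ?_ (Triple.assign_seq (by omega) rfl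
    (by simp) (Triple.seq (triple_count (l := 1) (y := fun _ => n) ⟨?_, ?_, ?_, ?_, ht⟩ hn ht
      (isPre_one _)) (T' := 100) ?_))))) ?_
  · simp; omega
  · simp
  · simp
  · simp
  · intro j hj
    simp [show j = 0 by omega]
  · rintro v ⟨hs, hv⟩
    refine Triple.assign (by omega) rfl (by simp) ⟨?_, ?_, ?_, ?_, ?_⟩
    · simp [hs.var 0]
    · simp [hs.var 1]
    · simp [hv, countBelow_one ht]
    · simp [hs.inp]
    · simp [hs.out]
  · omega

/-- The contents of the memory after the input has been read. -/
structure RankState (n t : ℕ) (z : List ℕ) (v : Store) : Prop where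
  var0 : v.var 0 = n
  var1 : v.var 1 = t
  var6 : v.var 6 = numStrings n t
  symbol : ∀ i < 2 * t, v.arr 0 i = z.getD (i % t) 0
  out : v.out = []

namespace RankState

theorem setVar (h : RankState n t z v) {x a : ℕ} (h0 : x ≠ 0) (h1 : x ≠ 1) (h6 : x ≠ 6) :
    RankState n t z (v.setVar x a) :=
  ⟨by simp [h0.symm, h.var0], by simp [h1.symm, h.var1], by simp [h6.symm, h.var6], h.symbol, h.out⟩

theorem setArr (h : RankState n t z v) {i a : ℕ} : RankState n t z (v.setArr 1 i a) :=
  ⟨h.var0, h.var1, h.var6, fun j hj => by simp [h.symbol j hj], h.out⟩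

theorem of_sameMain {v' : Store} (h : RankState n t z v) (hv : SameMain v v') :
    RankState n t z v' :=
  ⟨by rw [hv.var 0 (by omega), h.var0], by rw [hv.var 1 (by omega), h.var1],
    by rw [hv.var 6 (by omega), h.var6], fun j hj => by rw [hv.arr0, h.symbol j hj],
    by rw [hv.out, h.out]⟩

end RankState

theorem triple_readString {e : Expr} {f : ℕ → ℕ → ℕ} (he : e.ok = true)
    (hs : ∀ v B, e.Safe B v) (hf : ∀ v, e.eval v = f (v.var 5) (v.var 4)) (hn : 1 ≤ n)
    (hx : x.length = t) (h0 : v.var 0 = n) (h1 : v.var 1 = t) (h6 : v.var 6 = numStrings n t)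
    (hi : v.inp = x) (ho : v.out = []) :
    Triple ((t + 1) * (n + 1)) (readString e) v (300 + t * 1000)
      (RankState n t (decode f 0 x)) := by
  have hB := two_mul_lt (t := t) hn
  refine Triple.weaken (Triple.assign_seq (by omega) rfl (by simp) (Triple.assign_seq (by omega) rfl
    (by simp) (Triple.whileDo (fun k v => v.var 0 = n ∧ v.var 1 = t ∧ v.var 6 = numStrings n t ∧
      v.out = [] ∧ v.var 3 = k ∧ v.inp = x.drop k ∧
      decode f (v.var 5) (x.drop k) = (decode f 0 x).drop k ∧
      ∀ i < k, v.arr 0 i = (decode f 0 x).getD i 0 ∧ v.arr 0 (i + t) = (decode f 0 x).getD i 0) t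
      (T := 601) rfl ?_ ?_ ?_ ?_ ?_))) ?_
  · intro k _ v _
    simp
  · rintro k hk v ⟨h0, h1, h6, ho, h3, hi, hd, ha⟩
    refine ⟨by simp [h1, h3]; omega, ?_⟩
    rw [List.drop_eq_getElem_cons (by omega)] at hi hd
    rw [decode] at hd
    have hdk : (decode f 0 x).getD k 0 = f (v.var 5) x[k] := by
      have := congrArg (fun l => l.getD 0 0) hd
      simpa [List.getD_eq_getElem?_getD] using this.symm
    refine Triple.weaken (Triple.read_seq (by omega) hi (Triple.put_seq (by omega) rfl he (by simp)
      (hs _ _) ?_ (Triple.put_seq (by omega) rfl he (by simp) (hs _ _) ?_ (Triple.assign_seq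
      (by omega) rfl (by simp) (Triple.assign (by omega) rfl (by simp) ?_))))) le_rfl
    · simp [h3]; omega
    · simp [h3, h1]; omega
    · refine ⟨by simpa using h0, by simpa using h1, by simpa using h6, by simpa using ho,
        by simp [h3], by simp, ?_, ?_⟩
      · have := congrArg (List.drop 1) hd
        simpa [List.drop_drop, add_comm] using this
      · intro i hi
        simp only [Store.setVar_arr, Store.setArr_arr, hf, true_and]
        simp [h3, h1]
        rcases Nat.lt_succ_iff_lt_or_eq.mp hi with hlt | rfl
        · obtain ⟨h4, h5⟩ := ha i hlt
          rw [if_neg (by omega), if_neg (by omega), if_neg (by omega), if_neg (by omega), h4, h5]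
          simp [List.getD_eq_getElem?_getD]
        · rw [if_neg (by omega), if_pos rfl, if_pos rfl, ← hdk]
          simp [List.getD_eq_getElem?_getD]
  · rintro v ⟨h0, h1, h6, ho, h3, hi, hd, ha⟩
    simp [h1, h3]
  · refine ⟨by simpa using h0, by simpa using h1, by simpa using h6, by simpa using ho,
      by simp, by simpa using hi, by simp, by simp⟩
  · rintro v ⟨h0, h1, h6, ho, h3, hi, hd, ha⟩
    refine ⟨h0, h1, h6, fun i hi => ?_, ho⟩
    rcases Nat.lt_or_ge i t with hlt | hge
    · rw [(ha i hlt).1, Nat.mod_eq_of_lt hlt]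
    · rw [Nat.mod_eq_sub_mod hge, Nat.mod_eq_of_lt (by omega), ← (ha (i - t) (by omega)).2,
        Nat.sub_add_cancel hge]
  · omega

/-- The sum of both truncated differences is the distance of the two symbols, so the test is nonzero
exactly while the symbols agree and the index is below `t`. Two copies of the string make indices
modulo `t` unnecessary. -/
theorem triple_mismatch (hn : 1 ≤ n) (h : RankState n t z v) {a b : ℕ}
    (hok : ((var 1 - var 9) * (1 - ((get 0 (var a + var 9) - get 0 (var b + var 9)) +
      (get 0 (var b + var 9) - get 0 (var a + var 9)))) : Expr).ok = true)
    (ha9 : a ≠ 9) (hb9 : b ≠ 9) (ha : v.var a ≤ t) (hb : v.var b ≤ t) :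
    Triple ((t + 1) * (n + 1)) (mismatch a b) v (200 + t * 200) fun v' => ∃ r ≤ t,
      v' = v.setVar 9 r ∧
      (∀ i < r, z.getD ((v.var a + i) % t) 0 = z.getD ((v.var b + i) % t) 0) ∧
      (r < t → z.getD ((v.var a + r) % t) 0 ≠ z.getD ((v.var b + r) % t) 0) := by
  have hB := two_mul_lt (t := t) hn
  have hex : ∃ r, r = t ∨ z.getD ((v.var a + r) % t) 0 ≠ z.getD ((v.var b + r) % t) 0 :=
    ⟨t, Or.inl rfl⟩
  classical
  obtain ⟨r, hr, hmin⟩ : ∃ r, (r = t ∨ z.getD ((v.var a + r) % t) 0 ≠ z.getD ((v.var b + r) % t) 0)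
      ∧ ∀ i < r, ¬ (i = t ∨ z.getD ((v.var a + i) % t) 0 ≠ z.getD ((v.var b + i) % t) 0) :=
    ⟨Nat.find hex, Nat.find_spec hex, fun i hi => Nat.find_min hex hi⟩
  have hrt : r ≤ t := by
    by_contra hlt
    exact hmin t (by omega) (Or.inl rfl)
  have hmin' : ∀ i < r, z.getD ((v.var a + i) % t) 0 = z.getD ((v.var b + i) % t) 0 := by
    intro i hi
    have := hmin i hi
    push Not at this
    exact this.2
  refine Triple.weaken (Triple.assign_seq (by omega) rfl (by simp) (Triple.whileDo
    (fun i v' => v' = v.setVar 9 i) r (T := 100) hok ?_ ?_ ?_ ?_ ?_)) ?_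
  · rintro i hi _ rfl
    simp [ha9, hb9]
    omega
  · rintro i hi _ rfl
    refine ⟨?_, Triple.assign (by omega) rfl (by simp) ?_⟩
    · have h1 := h.symbol (v.var a + i) (by omega)
      have h2 := h.symbol (v.var b + i) (by omega)
      have h3 := hmin' i hi
      simp only [eval_mul, eval_sub, eval_add, eval_one, eval_get, eval_var, Store.setVar_var,
        Store.setVar_arr, if_neg ha9, if_neg hb9, if_true, if_neg (show ¬ (1 : ℕ) = 9 by decide),
        h.var1, h1, h2, h3, Nat.sub_self]
      omega
    · rw [Store.setVar_setVar]
      simp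
  · rintro _ rfl
    rcases hr with rfl | hr
    · simp [h.var1]
    · rcases Nat.lt_or_ge r t with hlt | hge
      · have h1 := h.symbol (v.var a + r) (by omega)
        have h2 := h.symbol (v.var b + r) (by omega)
        simp only [eval_mul, eval_sub, eval_add, eval_one, eval_get, eval_var, Store.setVar_var,
          Store.setVar_arr, if_neg ha9, if_neg hb9, h1, h2, if_true]
        refine Nat.mul_eq_zero.mpr (Or.inr ?_)
        omega
      · simp [h.var1, hge]
  · rfl
  · rintro _ rfl
    exact ⟨r, hrt, rfl, hmin', fun hlt => hr.resolve_left (by omega)⟩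
  · have : r * 200 ≤ t * 200 := Nat.mul_le_mul_right _ hrt
    omega

/-- The candidate replaces the current best unless it is strictly smaller. Ties thus move on, which
yields the last largest rotation needed in `window_of_last_maximal`. -/
theorem triple_findRotation (hn : 1 ≤ n) (ht : 1 ≤ t) (hl : z.length = t)
    (h : RankState n t z v) :
    Triple ((t + 1) * (n + 1)) findRotation v (300 + t * (700 + t * 200)) fun v' =>
      RankState n t z v' ∧ v'.var 10 = v.var 10 ∧ 1 ≤ v'.var 7 ∧ v'.var 7 ≤ t ∧
      IsMaxNecklace (z.rotate (v'.var 7)) ∧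
      ∀ j, v'.var 7 < j → j ≤ t → z.rotate j ≠ z.rotate (v'.var 7) := by
  have hB := two_mul_lt (t := t) hn
  refine Triple.weaken (Triple.assign_seq (by omega) rfl (by simp) (Triple.assign_seq (by omega) rfl
    (by simp) (Triple.whileDo (fun k v' => RankState n t z v' ∧ v'.var 10 = v.var 10 ∧
      v'.var 8 = k + 2 ∧ 1 ≤ v'.var 7 ∧ v'.var 7 ≤ k + 1 ∧
      (∀ i, 1 ≤ i → i < k + 2 → z.rotate i ≤ z.rotate (v'.var 7)) ∧
      ∀ j, v'.var 7 < j → j < k + 2 → z.rotate j ≠ z.rotate (v'.var 7)) (t - 1)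
      (T := 500 + t * 200) rfl ?_ ?_ ?_ ?_ ?_))) ?_
  · intro k _ v _
    simp
  · rintro k hk v' ⟨hv, h10, h8, h7, h7', hle, hne⟩
    refine ⟨by simp [hv.var1, h8]; omega, Triple.weaken (Triple.seq (triple_mismatch hn hv rfl
      (by omega) (by omega) (by omega) (by omega)) (T' := 300) ?_) (by omega)⟩
    rintro _ ⟨r, hr, rfl, heq, hdiff⟩
    rw [h8] at heq hdiff
    refine Triple.weaken (Triple.seq (Triple.ifElse (T := 100) (Q := fun v'' =>
      RankState n t z v'' ∧ v''.var 10 = v.var 10 ∧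
      v''.var 8 = k + 2 ∧ 1 ≤ v''.var 7 ∧ v''.var 7 ≤ k + 2 ∧
      (∀ i, 1 ≤ i → i < k + 3 → z.rotate i ≤ z.rotate (v''.var 7)) ∧
      ∀ j, v''.var 7 < j → j < k + 3 → z.rotate j ≠ z.rotate (v''.var 7)) rfl ?_ ?_ ?_)
      (T' := 100) ?_) le_rfl
    · simp [h8]
      omega
    · intro hcond
      have hrt : r < t := by
        by_contra hge
        apply hcond
        simp [hv.var1, show t - r = 0 by omega]
      have h1 := hv.symbol (v'.var 7 + r) (by omega)
      have h2 := hv.symbol (k + 2 + r) (by omega)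
      simp [h8, h1, h2] at hcond
      have hlt := rotate_lt_rotate hl hrt heq (by
        rcases Nat.lt_or_ge (z.getD ((k + 2 + r) % t) 0) (z.getD ((v'.var 7 + r) % t) 0) with h | h
        · exact h
        · simp at h; omega)
      refine Triple.weaken (Triple.skip ?_) (by omega)
      refine ⟨hv.setVar (by omega) (by omega) (by omega), by simpa using h10, by simpa using h8,
        by simpa using h7, by simp; omega, ?_, ?_⟩
      · intro i h3 h4
        rcases Nat.lt_succ_iff_lt_or_eq.mp h4 with h5 | rfl
        · exact hle i h3 h5
        · exact hlt.le
      · intro i h3 h4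
        rcases Nat.lt_succ_iff_lt_or_eq.mp h4 with h5 | rfl
        · exact hne i h3 h5
        · exact hlt.ne
    · intro hcond
      have hge : z.rotate (v'.var 7) ≤ z.rotate (k + 2) := by
        rcases Nat.lt_or_ge r t with hrt | hrt
        · have h1 := hv.symbol (v'.var 7 + r) (by omega)
          have h2 := hv.symbol (k + 2 + r) (by omega)
          have h3 := hdiff hrt
          simp only [eval_mul, eval_sub, eval_add, eval_get, eval_var, Store.setVar_var,
            Store.setVar_arr, if_true, if_neg (show ¬ (1 : ℕ) = 9 by decide),
            if_neg (show ¬ (7 : ℕ) = 9 by decide), if_neg (show ¬ (8 : ℕ) = 9 by decide), hv.var1,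
            h8, h1, h2] at hcond
          rcases Nat.mul_eq_zero.mp hcond with h4 | h4
          · omega
          · exact (rotate_lt_rotate hl hrt (fun i hi => (heq i hi).symm) (by omega)).le
        · exact (rotate_eq_rotate hl fun i hi => (heq i (by omega)).symm).le
      refine Triple.assign (by omega) rfl (by simp) ?_
      refine ⟨(hv.setVar (by omega) (by omega) (by omega)).setVar (by omega) (by omega) (by omega),
        by simpa using h10, by simpa using h8, by simp [h8], by simp [h8], ?_, ?_⟩
      · intro i h3 h4
        simp only [Store.setVar_var, if_true, eval_var,
          if_neg (show ¬ (8 : ℕ) = 9 by decide), h8]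
        rcases Nat.lt_succ_iff_lt_or_eq.mp h4 with h5 | rfl
        · exact (hle i h3 h5).trans hge
        · exact le_rfl
      · intro i h3 h4
        simp [h8] at h3
        omega
    · rintro v'' ⟨hv, h10, h8, h7, h7', hle, hne⟩
      refine Triple.assign (by omega) rfl (by simp) ?_
      exact ⟨hv.setVar (by omega) (by omega) (by omega), by simpa using h10, by simp [h8],
        by simpa using h7, by simpa using h7', by simpa using hle, by simpa using hne⟩
  · rintro v' ⟨hv, h10, h8, h7, h7', hle, hne⟩
    simp [hv.var1, h8]
    omega
  · refine ⟨(h.setVar (by omega) (by omega) (by omega)).setVar (by omega) (by omega) (by omega),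
      by simp, by simp, by simp, by simp, ?_, ?_⟩
    · intro i h1 h2
      simp [show i = 1 by omega]
    · intro j h1 h2
      simp at h1
      omega
  · rintro v' ⟨hv, h10, h8, h7, h7', hle, hne⟩
    exact ⟨hv, h10, h7, by omega, isMaxNecklace_rotate hl ht fun i h1 h2 => hle i h1 (by omega),
      fun j h1 h2 => hne j h1 (by omega)⟩
  · have h1 : (t - 1) * (500 + t * 200 + 100) ≤ t * (700 + t * 200) :=
      Nat.mul_le_mul (by omega) (by omega)
    omega

theorem triple_leadingZeros (hn : 1 ≤ n) (h : RankState n t z v) :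
    Triple ((t + 1) * (n + 1)) leadingZeros v (200 + t * 200) fun v' =>
      RankState n t z v' ∧ v'.var 10 ≤ t ∧ (∀ i < v'.var 10, z.getD i 0 = 0) ∧
      (v'.var 10 < t → z.getD (v'.var 10) 0 ≠ 0) := by
  have hB := two_mul_lt (t := t) hn
  have hex : ∃ m, m = t ∨ z.getD m 0 ≠ 0 := ⟨t, Or.inl rfl⟩
  classical
  obtain ⟨m, hm, hmin⟩ : ∃ m, (m = t ∨ z.getD m 0 ≠ 0) ∧ ∀ i < m, ¬ (i = t ∨ z.getD i 0 ≠ 0) :=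
    ⟨Nat.find hex, Nat.find_spec hex, fun i hi => Nat.find_min hex hi⟩
  have hmt : m ≤ t := by
    by_contra hlt
    exact hmin t (by omega) (Or.inl rfl)
  have hmin' : ∀ i < m, z.getD i 0 = 0 := by
    intro i hi
    have := hmin i hi
    push Not at this
    exact this.2
  have hsym : ∀ i < t, v.arr 0 i = z.getD i 0 := fun i hi => by
    rw [h.symbol i (by omega), Nat.mod_eq_of_lt hi]
  refine Triple.weaken (Triple.assign_seq (by omega) rfl (by simp) (Triple.whileDo
    (fun i v' => v' = v.setVar 10 i) m (T := 100) rfl ?_ ?_ ?_ rfl ?_)) ?_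
  · rintro i hi _ rfl
    simp
    omega
  · rintro i hi _ rfl
    refine ⟨?_, Triple.assign (by omega) rfl (by simp) (by rw [Store.setVar_setVar]; simp)⟩
    simp only [eval_mul, eval_sub, eval_one, eval_get, eval_var, Store.setVar_var,
      Store.setVar_arr, if_true, if_neg (show ¬ (1 : ℕ) = 10 by decide), h.var1,
      hsym i (by omega), hmin' i hi]
    omega
  · rintro _ rfl
    rcases Nat.lt_or_ge m t with hlt | hge
    · have := hm.resolve_left (by omega)
      rw [eval_mul, eval_sub, eval_sub, eval_get]
      refine Nat.mul_eq_zero.mpr (Or.inr ?_)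
      simp only [eval_one, Store.setVar_arr, eval_var, Store.setVar_var, if_true, hsym m hlt]
      omega
    · simp [h.var1, hge]
  · rintro _ rfl
    exact ⟨h.setVar (by omega) (by omega) (by omega), by simpa using hmt, by simpa using hmin',
      fun hlt => by
        simp only [Store.setVar_var, if_true] at hlt ⊢
        exact hm.resolve_left (by omega)⟩
  · have : m * 200 ≤ t * 200 := Nat.mul_le_mul_right _ hmt
    omega

end

end Ram

/-! ### Ranking a nonzero string. -/

namespace Ram

open UCycle Ram.Expr

section

variable {n t : ℕ} {z x : List ℕ} {v : Store}

theorem triple_copyPrefix (hn : 1 ≤ n) (h : RankState n t z v) (h7 : v.var 7 ≤ t)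
    (h11 : v.var 11 ≤ t) :
    Triple ((t + 1) * (n + 1)) copyPrefix v (200 + t * 400) fun v' =>
      RankState n t z v' ∧ (∀ x, 3 < x → v'.var x = v.var x) ∧
      ∀ i < v.var 11, v'.arr 1 (i + 1) = z.getD ((v.var 7 + i) % t) 0 := by
  have hB := two_mul_lt (t := t) hn
  refine Triple.weaken (Triple.assign_seq (by omega) rfl (by simp) (Triple.whileDo
    (fun k v' => RankState n t z v' ∧ v'.var 3 = k ∧ (∀ x, 3 < x → v'.var x = v.var x) ∧
      ∀ i < k, v'.arr 1 (i + 1) = z.getD ((v.var 7 + i) % t) 0) (v.var 11) (T := 300)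
      rfl ?_ ?_ ?_ ?_ ?_)) ?_
  · intro k _ v _
    simp
  · rintro k hk v' ⟨hv, h3, hx, ha⟩
    have hx7 := hx 7 (by omega)
    refine ⟨by simp [h3, hx 11]; omega, Triple.put_seq (by omega) rfl rfl (by simp) ?_ ?_
      (Triple.assign (by omega) rfl (by simp) ?_)⟩
    · simp [h3, hx7]
      omega
    · simp [h3]
      omega
    · refine ⟨hv.setArr.setVar (by omega) (by omega) (by omega), by simp [h3], ?_, ?_⟩
      · intro x hx3
        simp [hx x hx3, show x ≠ 3 by omega]
      · intro i hi
        have hs := hv.symbol (v.var 7 + k) (by omega)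
        simp only [Store.setVar_arr, Store.setArr_arr, eval_add, eval_var, eval_one, eval_get, h3,
          hx7, hs, true_and, Nat.add_right_cancel_iff]
        split_ifs with hik
        · rw [hik]
        · exact ha i (by omega)
  · rintro v' ⟨hv, h3, hx, ha⟩
    simp [h3, hx 11]
  · refine ⟨h.setVar (by omega) (by omega) (by omega), by simp, ?_, by simp⟩
    intro x hx
    simp [show x ≠ 3 by omega]
  · rintro v' ⟨hv, h3, hx, ha⟩
    exact ⟨hv, hx, ha⟩
  · have := Nat.mul_le_mul_right 400 h11
    omega

/-- Duval's method: a symbol equal to the one a period earlier keeps the period, and a smaller one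
makes the whole string the repeated part. By `hmax` a larger one does not occur. -/
theorem triple_increasePeriod (hn : 1 ≤ n) (h : RankState n t z v) {y : ℕ → ℕ} {lw : ℕ}
    (h11 : v.var 11 = lw) (hlw : 1 ≤ lw) (hlt : lw ≤ t) (hy : ∀ i < lw, v.arr 1 (i + 1) = y i)
    (hmax : ∀ q p, IsPeriodic y q p → p ≤ q → q < lw → y q ≤ y (q - p)) :
    Triple ((t + 1) * (n + 1)) increasePeriod v (700 + t * 400) fun v' =>
      ∃ p, IsPeriodic y lw p ∧ p ≤ lw ∧ RankState n t z v' ∧ v'.var 10 = v.var 10 ∧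
      v'.var 12 = v.var 12 ∧ v'.var 2 = p ∧
      ∀ i < lw, v'.arr 1 (i + 1) = if i = p - 1 then y i + 1 else y i := by
  have hB := two_mul_lt (t := t) hn
  refine Triple.weaken (Triple.assign_seq (by omega) rfl (by simp) (Triple.assign_seq (by omega) rfl
    (by simp) (Triple.seq (Triple.whileDo
    (fun k v' => RankState n t z v' ∧ v'.var 3 = k + 1 ∧ IsPeriodic y (k + 1) (v'.var 13) ∧
      v'.var 13 ≤ k + 1 ∧ v'.var 10 = v.var 10 ∧ v'.var 11 = lw ∧ v'.var 12 = v.var 12 ∧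
      v'.arr 1 = v.arr 1) (lw - 1) (T := 300)
      (Q := fun v' => RankState n t z v' ∧ IsPeriodic y lw (v'.var 13) ∧
      v'.var 13 ≤ lw ∧ v'.var 10 = v.var 10 ∧ v'.var 12 = v.var 12 ∧
      v'.arr 1 = v.arr 1) rfl ?_ ?_ ?_ ?_ ?_) (T' := 300) ?_))) ?_
  · intro k _ v _
    simp
  · rintro k hk v' ⟨hv, h3, hper, h13, h10, h11, h12, ha⟩
    have hpos := hper.pos
    have hy1 : v'.arr 1 (k + 1 + 1) = y (k + 1) := by rw [ha, hy _ (by omega)]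
    have hy2 : v'.arr 1 (k + 1 + 1 - v'.var 13) = y (k + 1 - v'.var 13) := by
      rw [ha, show k + 1 + 1 - v'.var 13 = k + 1 - v'.var 13 + 1 by omega, hy _ (by omega)]
    refine ⟨by simp [h3, h11]; omega, Triple.weaken (Triple.seq (Triple.ifElse (T := 100)
      (Q := fun v' => RankState n t z v' ∧ v'.var 3 = k + 1 ∧ IsPeriodic y (k + 2) (v'.var 13) ∧
      v'.var 13 ≤ k + 2 ∧ v'.var 10 = v.var 10 ∧ v'.var 11 = lw ∧ v'.var 12 = v.var 12 ∧
      v'.arr 1 = v.arr 1) rfl ?_ ?_ ?_) (T' := 100) ?_) le_rfl⟩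
    · simp [h3]
      omega
    · intro hcond
      simp [h3, hy1, hy2] at hcond
      refine Triple.assign (by omega) rfl (by simp) ⟨hv.setVar (by omega) (by omega) (by omega),
        by simpa using h3, ?_, by simp [h3], by simpa using h10, by simpa using h11,
        by simpa using h12, ha⟩
      simpa [h3] using hper.succ_of_lt h13 (by omega)
    · intro hcond
      simp [h3, hy1, hy2] at hcond
      have := hmax _ _ hper h13 (by omega)
      exact Triple.weaken (Triple.skip ⟨hv, h3, hper.succ_of_eq (by omega), by omega, h10, h11, h12,
        ha⟩) (by omega)
    · rintro v'' ⟨hv, h3, hper, h13, h10, h11, h12, ha⟩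
      exact Triple.assign (by omega) rfl (by simp) ⟨hv.setVar (by omega) (by omega) (by omega),
        by simp [h3], by simpa using hper, by simpa using h13, by simpa using h10,
        by simpa using h11, by simpa using h12, ha⟩
  · rintro v' ⟨hv, h3, hper, h13, h10, h11, h12, ha⟩
    simp [h3, h11]
    omega
  · exact ⟨(h.setVar (by omega) (by omega) (by omega)).setVar (by omega) (by omega) (by omega),
      by simp, by simpa using isPeriodic_one y, by simp, by simp, by simpa using h11, by simp, rfl⟩
  · rintro v' ⟨hv, h3, hper, h13, h10, h11, h12, ha⟩
    rw [show lw - 1 + 1 = lw by omega] at hper h13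
    exact ⟨hv, hper, h13, h10, h12, ha⟩
  · rintro v' ⟨hv, hper, h13, h10, h12, ha⟩
    have hpos := hper.pos
    refine Triple.put_seq (by omega) rfl rfl (by simp) (by simp; omega) (by simp; omega)
      (Triple.assign (by omega) rfl (by simp) ⟨v'.var 13, hper, h13,
        hv.setArr.setVar (by omega) (by omega) (by omega), by simpa using h10, by simpa using h12,
        by simp, ?_⟩)
    intro i hi
    simp only [Store.setVar_arr, Store.setArr_arr, eval_add, eval_var, eval_one, eval_get, ha,
      true_and]
    by_cases hip : i = v'.var 13 - 1
    · rw [if_pos (by omega), if_pos hip, show v'.var 13 = i + 1 by omega, hy i hi]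
    · rw [if_neg (by omega), if_neg hip, hy i hi]
  · have h1 : (lw - 1) * (300 + 100) ≤ t * 400 := Nat.mul_le_mul (by omega) (by omega)
    omega

/-- The time for ranking. -/
def rankTime (n t : ℕ) : ℕ := 10000 + t * 3000 + t * (700 + t * 200) + 2 * countTime n t

/-- Both cases of `window_of_last_maximal` are brought into one form: the position is the start of a
prefix of the largest rotation, plus variable 12, minus variable 10, modulo the length of the cycle.
-/
theorem triple_locate (hn : 1 ≤ n) (ht : 1 ≤ t) (hl : z.length = t) (hs : z.sum < n)
    (h : RankState n t z v) (hm : v.var 10 < t) (hm0 : ∀ i < v.var 10, z.getD i 0 = 0)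
    (hm1 : z.getD (v.var 10) 0 ≠ 0) :
    Triple ((t + 1) * (n + 1)) locate v
      (3000 + t * 1000 + t * (700 + t * 200) + countTime n t) fun v' =>
      v'.out = [] ∧ ∃ i < (diffCycle n t).length, window (diffCycle n t) t i = z ∧
        v'.var 14 = i + 1 := by
  have hB := two_mul_lt (t := t) hn
  have hlen := length_diffCycle_pos hn ht
  have hz : z ≠ List.replicate t 0 := by
    intro hz
    apply hm1
    simp [hz]
  rw [List.getD_eq_getElem _ _ (by omega)] at hm1
  have htake : z.take (v.var 10) = List.replicate (v.var 10) 0 := by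
    refine List.ext_getElem (by simp; omega) fun i h1 h2 => ?_
    have := hm0 i (by simpa using h2)
    rw [List.getD_eq_getElem _ _ (by simp at h1; omega)] at this
    simpa using this
  refine Triple.weaken (Triple.seq (triple_findRotation hn ht hl h) (T' := 2000 + t * 1000 +
    countTime n t) ?_) (by omega)
  rintro v ⟨hv, h10, h7, h7', hmax, hlast⟩
  have hpos := window_of_last_maximal hn ht hl hs hz h7' hmax hlast hm htake hm1
  rw [← h10] at hm hpos
  refine Triple.weaken (Triple.seq (triple_mismatch hn hv rfl (by omega) (by omega) (by omega) h7')
    (T' := 1800 + t * 800 + countTime n t) ?_) (by omega)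
  rintro _ ⟨r, hr, rfl, heq, hdiff⟩
  generalize hA : v.var 10 = m at *
  generalize hO : v.var 7 = o at *
  -- Running through all `t` symbols without a difference decides which case of
  -- `window_of_last_maximal` applies.
  have hrot : r = t ↔ z.rotate m = z.rotate o := by
    constructor
    · rintro rfl
      exact rotate_eq_rotate hl heq
    · intro hrot
      by_contra hrt
      refine hdiff (by omega) ?_
      rw [← getElem_rotate_eq hl m r (by simp; omega), ← getElem_rotate_eq hl o r (by simp; omega)]
      simp only [hrot]
  refine Triple.weaken (Triple.seq (Triple.ifElse (T := 300) (Q := fun v' => RankState n t z v' ∧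
    v'.var 7 = o ∧ 1 ≤ v'.var 11 ∧ v'.var 11 ≤ t ∧ ∃ i < numStrings n t,
      (startOf n t ((z.rotate o).take (v'.var 11)) + numStrings n t + v'.var 12 - v'.var 10) %
        numStrings n t = i ∧ window (diffCycle n t) t i = z) rfl (by simp) ?_ ?_)
      (T' := 1400 + t * 800 + countTime n t) ?_) (by omega)
  · intro hcond
    have hrt : r ≠ t := by
      rintro rfl
      simp [hv.var1] at hcond
    rw [if_neg fun hh => hrt (hrot.mpr hh)] at hpos
    refine Triple.weaken (Triple.assign_seq (by omega) rfl (by simp) (Triple.assign_seq (by omega) rfl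
      (by simp) (Triple.assign (by omega) rfl (by simp) ⟨(((hv.setVar (by omega) (by omega)
      (by omega)).setVar (by omega) (by omega) (by omega)).setVar (by omega) (by omega)
      (by omega)).setVar (by omega) (by omega) (by omega), by simpa using hO, ?_, ?_,
      startOf n t (z.rotate o) + (t - o), hpos.1, ?_, hpos.2⟩))) le_rfl
    · simpa [hv.var1] using ht
    · simp [hv.var1]
    · simp only [Store.setVar_var, eval_var, eval_sub, eval_zero, if_true, hv.var1, hO, reduceIte,
        Nat.reduceEqDiff]
      rw [List.take_of_length_le (by simp; omega), Nat.sub_zero, add_right_comm, Nat.add_mod_right,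
        Nat.mod_eq_of_lt hpos.1]
  · intro hcond
    have hrt : r = t := by
      simp [hv.var1] at hcond
      omega
    rw [if_pos (hrot.mp hrt)] at hpos
    refine Triple.weaken (Triple.assign_seq (by omega) rfl (by simp) (Triple.assign (by omega) rfl
      (by simp) ⟨((hv.setVar (by omega) (by omega) (by omega)).setVar (by omega) (by omega)
      (by omega)).setVar (by omega) (by omega) (by omega), by simpa using hO, ?_, ?_,
      _, Nat.mod_lt _ ?_, ?_, hpos.2⟩)) (by omega)
    · simp [hv.var1, hA]
      omega
    · simp [hv.var1, hA]
    · rwa [numStrings_eq hn ht]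
    · simp [hv.var1, hA, Nat.add_sub_assoc hpos.1]
  rintro v' ⟨hv', h7, h11, h11', i, hi, hidx, hwin⟩
  refine Triple.weaken (Triple.seq (triple_copyPrefix hn hv' (by omega) h11')
    (T' := 1200 + t * 400 + countTime n t) ?_) (by omega)
  rintro v'' ⟨hv'', hsame, hy⟩
  rw [h7] at hy
  have htk := take_rotate hl o h11'
  refine Triple.weaken (Triple.seq (triple_increasePeriod hn hv'' (hsame 11 (by omega)) h11 h11' hy
    fun q p hper hpq hq => ?_) (T' := 300 + countTime n t) ?_) (by omega)
  · have := hmax.getElem_le_sub hper hpq (by simp; omega) (take_rotate hl o (by omega))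
    rwa [getElem_rotate_eq hl, getElem_rotate_eq hl] at this
  rintro w ⟨p, hper, hpl, hw, h10', h12', h2, hyw⟩
  have hppos := hper.pos
  refine Triple.weaken (Triple.seq (triple_count ⟨hw.var0, hw.var1, h2, fun j hj => hyw j (by omega),
    by omega⟩ hn ht hper.isPre_update) (T' := 200) ?_) (by omega)
  rintro w' ⟨hsw, hcount⟩
  have hw' := hw.of_sameMain hsw
  have hsum := startOf_add_countBelow (n := n) (t := t) hper hpl h11'
  rw [← hcount, ← htk] at hsum
  have e10 : w'.var 10 = v'.var 10 := by rw [hsw.var 10 (by omega), h10', hsame 10 (by omega)]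
  have e12 : w'.var 12 = v'.var 12 := by rw [hsw.var 12 (by omega), h12', hsame 12 (by omega)]
  refine Triple.assign_seq (by omega) rfl (by simp) (Triple.assign (by omega) rfl (by simp)
    ⟨hw'.out, i, by rwa [← numStrings_eq hn ht], hwin, ?_⟩)
  simp only [Store.setVar_var, eval_add, eval_sub, eval_mul, eval_div, eval_var, eval_one, eval_ofNat,
    if_true, if_neg (show ¬ (6 : ℕ) = 15 by decide), hw'.var6, e10, e12]
  -- Twice the total minus the count is the start plus one total; the extra total keeps the
  -- subtraction of the leading zeros from truncating.
  rw [← hidx, show numStrings n t * 2 - w'.var 23 = startOf n t ((z.rotate o).take (v'.var 11)) +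
    numStrings n t by omega, Nat.add_right_cancel_iff, mul_comm]
  exact (Nat.mod_eq_sub_mul_div).symm

theorem triple_rankProgram {e : Expr} {f : ℕ → ℕ → ℕ} (he : e.ok = true)
    (hs : ∀ v B, e.Safe B v) (hf : ∀ v, e.eval v = f (v.var 5) (v.var 4)) (hn : 1 ≤ n) (ht : 1 ≤ t)
    (hx : x.length = t) {m : Multiset ℕ} (hm : m ∈ multisets n t) (hd : decode f 0 x = diffRep m) :
    Triple ((t + 1) * (n + 1)) (rankProgram e) ⟨fun _ => 0, fun _ _ => 0, n :: t :: x, []⟩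
      (rankTime n t) fun v => v.out = [rank (cycleLE n t (n + t - 1)) (shiftedDiffRep m)] := by
  have hB := two_mul_lt (t := t) hn
  have hpos := length_diffCycle_pos hn ht
  have hl := length_diffRep hm
  have hsum := sum_diffRep hn hm
  refine Triple.weaken (Triple.seq (triple_setup hn ht) (T' := 4000 + t * 3000 +
    t * (700 + t * 200) + countTime n t) ?_) (by rw [rankTime]; omega)
  rintro v ⟨h0, h1, h6, hi, ho⟩
  refine Triple.weaken (Triple.seq (triple_readString he hs hf hn hx h0 h1 h6 hi ho)
    (T' := 3700 + t * 2000 + t * (700 + t * 200) + countTime n t) ?_) (by omega)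
  intro v hv
  rw [hd] at hv
  refine Triple.weaken (Triple.seq (triple_leadingZeros hn hv)
    (T' := 3200 + t * 1000 + t * (700 + t * 200) + countTime n t) ?_) (by omega)
  rintro v ⟨hv, h10, hm0, hm1⟩
  refine Triple.weaken (Triple.seq (Triple.ifElse (T := 3000 + t * 1000 + t * (700 + t * 200) +
    countTime n t) (Q := fun v' => v'.out = [] ∧ ∃ i < (diffCycle n t).length,
      window (diffCycle n t) t i = diffRep m ∧ v'.var 14 = i + 1) rfl (by simp) ?_ ?_)
    (T' := 100) ?_) (by omega)
  · intro hcond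
    simp [hv.var1] at hcond
    exact triple_locate hn ht hl hsum hv (by omega) hm0 (hm1 (by omega))
  · intro hcond
    simp [hv.var1] at hcond
    have hz : diffRep m = List.replicate t 0 := by
      refine List.ext_getElem (by simp [hl]) fun i h1 h2 => ?_
      have := hm0 i (by omega)
      rw [List.getD_eq_getElem _ _ h1] at this
      simpa using this
    refine Triple.weaken (Triple.assign (by omega) rfl (by simp) ⟨hv.out,
      (diffCycle n t).length - t, by omega, by rw [window_zeros hn ht, hz], ?_⟩) (by omega)
    simp [hv.var1, hv.var6, numStrings_eq hn ht]
  · rintro v ⟨hout, i, hi, hwin, h14⟩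
    refine Triple.print rfl (by simp) ?_
    simp [hout, h14, rank_eq hn ht hm hi hwin]

end

end Ram

/-! ### Extending a prenecklace -/

namespace UCycle

section

variable {n t c q p : ℕ} {y : ℕ → ℕ}

/-- The string `y` with symbol `c` at position `q`. -/
def extend (y : ℕ → ℕ) (q c : ℕ) (i : ℕ) : ℕ := if i = q then c else y i

theorem extend_of_lt {i : ℕ} (h : i < q) : extend y q c i = y i := if_neg (by omega)

@[simp] theorem extend_self : extend y q c q = c := if_pos rfl

theorem IsPeriodic.congr {y' : ℕ → ℕ} (h : IsPeriodic y q p) (hpq : p ≤ q)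
    (hy : ∀ i < q, y' i = y i) : IsPeriodic y' q p := by
  refine ⟨h.pos, fun i h1 h2 => ?_, fun i h1 h2 => ?_⟩
  · obtain ⟨r, h3, h4, h5⟩ := h.lyndon i h1 h2
    refine ⟨r, h3, fun r' hr' => ?_, ?_⟩
    · rw [hy _ (by omega), hy _ (by omega), h4 r' hr']
    · rwa [hy _ (by omega), hy _ (by omega)]
  · rw [hy _ h2, hy _ (by omega), h.eq i h1 h2]

/-- `y 0, …, y (q - 1)` is a prenecklace for which `p` is the length of the repeated part (`1`, if the
string is empty), and `c` is the largest symbol that may follow. -/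
structure Extendable (y : ℕ → ℕ) (q p c : ℕ) : Prop where
  per : 0 < q → IsPeriodic y q p
  le : p ≤ max q 1
  eq_one : q = 0 → p = 1
  symbol : 0 < q → c = y (q - p)

namespace Extendable

variable {d : ℕ}

theorem eq (h : Extendable y q p c) : IsPeriodic (extend y q c) (q + 1) p := by
  rcases Nat.eq_zero_or_pos q with rfl | hq
  · rw [h.eq_one rfl]
    exact isPeriodic_one _
  · have hle := h.le
    have hpos := (h.per hq).pos
    refine ((h.per hq).congr (by omega) fun i hi => extend_of_lt hi).succ_of_eq ?_
    rw [extend_self, extend_of_lt (by omega), h.symbol hq]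

theorem lt (h : Extendable y q p c) (hd : d < c) :
    IsPeriodic (extend y q d) (q + 1) (q + 1) := by
  rcases Nat.eq_zero_or_pos q with rfl | hq
  · exact isPeriodic_one _
  · have hle := h.le
    have hpos := (h.per hq).pos
    refine ((h.per hq).congr (by omega) fun i hi => extend_of_lt hi).succ_of_lt (by omega) ?_
    rwa [extend_self, extend_of_lt (by omega), ← h.symbol hq]

theorem isPre (h : Extendable y q p c) (hd : d ≤ c) : IsPre (extend y q d) (q + 1) := by
  rcases hd.lt_or_eq with hd | rfl
  · exact (h.lt hd).isPre
  · exact h.eq.isPre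

/-- With the largest admissible symbol the repetition continues, so `startOf_succ` applies; the
search can begin without a new count for the start. For the empty prefix, the hypothesis `hc` makes
the start zero. -/
theorem startOf_extend (h : Extendable y q p c) (ht : 1 ≤ t) (hq : q < t)
    (hc : q = 0 → n ≤ c + 1) :
    startOf n t (prefixOf (extend y q c) (q + 1)) = startOf n t (prefixOf y q) := by
  rcases Nat.eq_zero_or_pos q with rfl | hq0
  · rw [startOf_one ht (by simpa using hc rfl)]
    symm
    simp [startOf, classes, prefixOf]
  · have hle := h.le
    have hpos := (h.per hq0).pos
    rw [startOf_succ ((h.per hq0).congr (by omega) fun i hi => extend_of_lt hi) (by omega) hq,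
      prefixOf_congr fun i hi => extend_of_lt hi]
    rw [extend_self, extend_of_lt (by omega), h.symbol hq0]

end Extendable

/-- When the search lowers the symbol, the end just computed becomes the new start. -/
theorem startOf_extend_eq_endOf (hq : q < t) :
    startOf n t (prefixOf (extend y q c) (q + 1)) =
      endOf n t (prefixOf (extend y q (c + 1)) (q + 1)) :=
  startOf_eq_endOf hq (fun i hi => by rw [extend_of_lt hi, extend_of_lt hi]) (by simp)

theorem endOf_extend_zero (hq : q < t) :
    endOf n t (prefixOf (extend y q 0) (q + 1)) = endOf n t (prefixOf y q) := by
  rw [endOf_succ hq extend_self, prefixOf_congr fun i hi => extend_of_lt hi]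

end

end UCycle

/-! ### Unranking

Variables: `0` holds `n`, `1` holds `t`, `6` holds the length of the cycle, `7` holds the index of the
first symbol of the string, `8` holds the index of the current symbol. Array `1` holds a prenecklace,
starting at index `1`. -/

namespace Ram

open UCycle Ram.Expr

/-- Compute the end of the part of the cycle that belongs to a prefix. -/
def computeEnd : Program := .seq count (assign 11 (var 6 - var 23))

/-- Extend the prefix by one symbol. -/
def extendPrefix : Program :=
  .seq (put 1 (var 9 + 1) (get 1 (var 9 + 1 - var 13))) (.seq (assign 2 (var 9 + 1))
  (.seq computeEnd (.seq (whileDo (var 8 + 1 - var 11) (.seq (assign 10 (var 11))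
    (.seq (put 1 (var 9 + 1) (get 1 (var 9 + 1) - 1)) computeEnd)))
  (.seq (ifElse (get 1 (var 9 + 1 - var 13) - get 1 (var 9 + 1)) (assign 13 (var 9 + 1)) .skip)
  (assign 9 (var 9 + 1))))))

/-- Find the symbol whose index is in variable `8`. -/
def findSymbol : Program :=
  .seq (assign 10 0) (.seq (assign 13 1) (.seq (put 1 0 (var 0 - 1)) (.seq (assign 9 0)
  (.seq (whileDo (var 1 - var 9) extendPrefix) (assign 14 (get 1 (var 8 - var 10 + 1)))))))

/-- Print `e` for the consecutive symbols, where variable `14` holds the symbol and variable `16` the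
sum of the symbols so far. -/
def unrankProgram (e : Expr) : Program :=
  .seq setup (.seq (.read 7) (.seq (assign 7 (var 7 - 1)) (.seq (assign 3 0) (.seq (assign 16 0)
  (whileDo (var 1 - var 3) (.seq (assign 15 (var 7 + var 3))
    (.seq (assign 8 (var 15 - var 15 / var 6 * var 6)) (.seq findSymbol
    (.seq (assign 16 (var 16 + var 14)) (.seq (print e) (assign 3 (var 3 + 1))))))))))))

section

variable {n t q r : ℕ} {y : ℕ → ℕ} {v v₀ : Store}

/-- The stores agree on the variables that are not used for finding a symbol. -/
structure SameOuter (v v' : Store) : Prop where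
  var : ∀ x < 20, x ≠ 2 → (x < 9 ∨ 14 < x) → v'.var x = v.var x
  inp : v'.inp = v.inp
  out : v'.out = v.out

namespace SameOuter

theorem refl (v : Store) : SameOuter v v := ⟨fun _ _ _ _ => rfl, rfl, rfl⟩

theorem trans {v v' v'' : Store} (h : SameOuter v v') (h' : SameOuter v' v'') : SameOuter v v'' :=
  ⟨fun x h1 h2 h3 => (h'.var x h1 h2 h3).trans (h.var x h1 h2 h3), h'.inp.trans h.inp,
    h'.out.trans h.out⟩

theorem setVar {v v' : Store} (h : SameOuter v v') {x a : ℕ} (hx : x = 2 ∨ 9 ≤ x ∧ x ≤ 14) :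
    SameOuter v (v'.setVar x a) :=
  ⟨fun y h1 h2 h3 => (if_neg (by omega)).trans (h.var y h1 h2 h3), h.inp, h.out⟩

theorem setArr {v v' : Store} (h : SameOuter v v') {k i a : ℕ} : SameOuter v (v'.setArr k i a) :=
  ⟨h.var, h.inp, h.out⟩

end SameOuter

theorem SameMain.sameOuter {v v' : Store} (h : SameMain v v') : SameOuter v v' :=
  ⟨fun x hx _ _ => h.var x hx, h.inp, h.out⟩

/-- The contents of the variables while a symbol is sought. -/
structure UnrankState (n t r : ℕ) (v : Store) : Prop where
  var0 : v.var 0 = n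
  var1 : v.var 1 = t
  var6 : v.var 6 = numStrings n t
  var8 : v.var 8 = r

theorem UnrankState.of_sameOuter {v v' : Store} (h : UnrankState n t r v) (hv : SameOuter v v') :
    UnrankState n t r v' :=
  ⟨by rw [hv.var 0 (by omega) (by omega) (by omega), h.var0],
    by rw [hv.var 1 (by omega) (by omega) (by omega), h.var1],
    by rw [hv.var 6 (by omega) (by omega) (by omega), h.var6],
    by rw [hv.var 8 (by omega) (by omega) (by omega), h.var8]⟩

theorem triple_computeEnd (hn : 1 ≤ n) (ht : 1 ≤ t) (h : UnrankState n t r v) (h2 : v.var 2 = q + 1)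
    (hq : q < t) (hy : ∀ i < q + 1, v.arr 1 (i + 1) = y i) (hpre : IsPre y (q + 1)) :
    Triple ((t + 1) * (n + 1)) computeEnd v (countTime n t + 100) fun v' =>
      SameOuter v v' ∧ v'.var 2 = q + 1 ∧ v'.var 9 = v.var 9 ∧ v'.var 10 = v.var 10 ∧
      v'.var 13 = v.var 13 ∧ v'.arr 1 = v.arr 1 ∧ v'.var 11 = endOf n t (prefixOf y (q + 1)) := by
  refine Triple.seq (triple_count ⟨h.var0, h.var1, h2, hy, hq⟩ hn ht hpre) ?_
  rintro v' ⟨hs, hc⟩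
  have h3 := endOf_add_countBelow (n := n) (y := y) (l := q + 1) (t := t) hq
  refine Triple.assign (by omega) rfl (by simp) ⟨hs.sameOuter.setVar (by omega), ?_, ?_, ?_, ?_,
    hs.arr1, ?_⟩
  · simp [hs.var 2, h2]
  · simp [hs.var 9]
  · simp [hs.var 10]
  · simp [hs.var 13]
  · simp [hs.var 6, h.var6, hc]
    omega

/-- The first `q` symbols of the necklace that contributes the symbol with index `r` are known. -/
structure PrefixFound (n t r q : ℕ) (v₀ v : Store) : Prop where
  same : SameOuter v₀ v
  var9 : v.var 9 = q
  sentinel : v.arr 1 0 = n - 1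
  le : ∀ i ≤ q, v.arr 1 i ≤ n - 1
  ext : Extendable (fun i => v.arr 1 (i + 1)) q (v.var 13) (v.arr 1 (q + 1 - v.var 13))
  start : v.var 10 = startOf n t (prefixOf (fun i => v.arr 1 (i + 1)) q)
  start_le : v.var 10 ≤ r
  lt_end : r < endOf n t (prefixOf (fun i => v.arr 1 (i + 1)) q)

/-- Each lowering of the symbol costs one count, and `le` limits the number of lowerings by `n - 1`.
As the prefix is stored from index `1`, the largest admissible symbol is at `q + 1 - p`; for the
empty prefix, with `p = 1`, this is the sentinel `n - 1` at index `0`. -/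
theorem triple_extendPrefix (hn : 1 ≤ n) (ht : 1 ≤ t) (h₀ : UnrankState n t r v₀) (hq : q < t)
    (hv : PrefixFound n t r q v₀ v) :
    Triple ((t + 1) * (n + 1)) extendPrefix v (1000 + countTime n t + n * (countTime n t + 500))
      (PrefixFound n t r (q + 1) v₀) := by
  have hB := two_mul_lt (t := t) hn
  have h := h₀.of_sameOuter hv.same
  have h9 := hv.var9
  have hext := hv.ext
  generalize hy : (fun i => v.arr 1 (i + 1)) = y at hext
  have hyi : ∀ i, v.arr 1 (i + 1) = y i := fun i => congrFun hy i
  generalize hp : v.var 13 = p at hext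
  generalize hc : v.arr 1 (q + 1 - p) = c at hext
  have hple := hext.le
  have hp0 : 0 < p := by
    rcases Nat.eq_zero_or_pos q with h0 | h0
    · rw [hext.eq_one h0]
      exact one_pos
    · exact (hext.per h0).pos
  have hcn : c ≤ n - 1 := hc ▸ hv.le _ (by omega)
  have hc0 : q = 0 → n ≤ c + 1 := by
    rintro rfl
    rw [← hc, hext.eq_one rfl]
    have := hv.sentinel
    simp only [zero_add, Nat.sub_self]
    omega
  have hend := hv.lt_end
  have hstart := hv.start
  rw [hy] at hend hstart
  rw [← endOf_extend_zero hq] at hend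
  classical
  -- The search succeeds at symbol `0` at the latest, since appending a zero does not change the
  -- end.
  have hex : ∃ i, r < endOf n t (prefixOf (extend y q (c - i)) (q + 1)) :=
    ⟨c, by rwa [Nat.sub_self]⟩
  obtain ⟨N, hN, hmin, hNc⟩ : ∃ N, r < endOf n t (prefixOf (extend y q (c - N)) (q + 1)) ∧
      (∀ i < N, endOf n t (prefixOf (extend y q (c - i)) (q + 1)) ≤ r) ∧ N ≤ c :=
    ⟨Nat.find hex, Nat.find_spec hex, fun i hi => not_lt.mp (Nat.find_min hex hi),
      Nat.find_min' hex (by rwa [Nat.sub_self])⟩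
  refine Triple.weaken (Triple.put_seq (by omega) rfl rfl (by simp) ?_ ?_ (Triple.assign_seq
    (by omega) rfl (by simp) (Triple.seq (triple_computeEnd (y := extend y q c) (q := q) hn ht
    (h.of_sameOuter ((SameOuter.refl v).setArr.setVar (by omega))) ?_ hq ?_ (hext.isPre le_rfl))
    (T' := 400 + (N * (countTime n t + 400 + 100) + 100)) ?_))) ?_
  · simp [h9]
    omega
  · simp [h9]
    omega
  · simp [h9]
  · intro i hi
    simp only [Store.setVar_arr, Store.setArr_arr, eval_add, eval_sub, eval_var, eval_one, eval_get,
      h9, hp, hc, true_and, Nat.add_right_cancel_iff]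
    rw [extend, hyi]
  · rintro v₁ ⟨hs, h2', h9', h10', h13', harr, hend₁⟩
    have hs' : SameOuter v v₁ := ((SameOuter.refl v).setArr.setVar (by omega)).trans hs
    have harr' : ∀ i, v₁.arr 1 i = if i = q + 1 then c else v.arr 1 i := by
      intro i
      rw [harr]
      simp only [Store.setVar_arr, Store.setArr_arr, eval_add, eval_sub, eval_var, eval_one, eval_get,
        h9, hp, hc, true_and]
    refine Triple.weaken (Triple.seq (Triple.whileDo (fun i v' => SameOuter v v' ∧ v'.var 2 = q + 1 ∧
      v'.var 9 = q ∧ v'.var 13 = p ∧ v'.var 11 = endOf n t (prefixOf (extend y q (c - i)) (q + 1)) ∧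
      v'.var 10 = startOf n t (prefixOf (extend y q (c - i)) (q + 1)) ∧ v'.var 10 ≤ r ∧
      ∀ j, v'.arr 1 j = if j = q + 1 then c - i else v.arr 1 j) N (T := countTime n t + 400)
      rfl ?_ ?_ ?_ ?_ fun _ h => h) (T' := 300) ?_) (by omega)
    · intro i _ v _
      simp
    · rintro i hi v' ⟨hs, h2, h9, h13, h11, h10, hle, ha⟩
      have hv' := h.of_sameOuter hs
      have hlt := hmin i hi
      refine ⟨by simp [hv'.var8, h11]; omega, Triple.weaken (Triple.assign_seq (by omega) rfl
        (by simp) (Triple.put_seq (by omega) rfl rfl (by simp) ?_ ?_ (Triple.mono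
        (triple_computeEnd (y := extend y q (c - (i + 1))) (q := q) hn ht
        (hv'.of_sameOuter ((SameOuter.refl v').setVar (by omega)).setArr) ?_ hq ?_
        (hext.isPre (by omega))) le_rfl ?_))) (by omega)⟩
      · simp [h9]; omega
      · simp [h9]; omega
      · simp [h2]
      · intro j hj
        simp only [Store.setVar_arr, Store.setVar_var, Store.setArr_arr, eval_add, eval_sub, eval_var,
          eval_one, eval_get, if_neg (show ¬ (9 : ℕ) = 10 by decide), h9, ha, true_and, if_true,
          Nat.add_right_cancel_iff, extend, hyi]
        split_ifs
        · omega
        · rfl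
      · rintro w ⟨hs'', h2'', h9'', h10'', h13'', ha'', h11''⟩
        refine ⟨hs.trans (((SameOuter.refl v').setVar (by omega)).setArr.trans hs''), h2'',
          by simpa [h9] using h9'', by simpa [h13] using h13'', h11'', ?_, ?_, ?_⟩
        · rw [h10'', startOf_extend_eq_endOf hq, show c - (i + 1) + 1 = c - i by omega]
          simpa using h11
        · rw [h10'']
          simpa [h11] using hlt
        · intro j
          rw [ha'']
          simp only [Store.setVar_arr, Store.setVar_var, Store.setArr_arr, eval_add, eval_sub,
            eval_var, eval_one, eval_get, if_neg (show ¬ (9 : ℕ) = 10 by decide), h9, ha, true_and,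
            if_true]
          split_ifs
          · omega
          · rfl
    · rintro v' ⟨hs, h2, h9, h13, h11, h10, hle, ha⟩
      simp [(h.of_sameOuter hs).var8, h11]
      omega
    · refine ⟨hs', h2', by simpa [h9] using h9', by simpa [hp] using h13', hend₁, ?_, ?_, harr'⟩
      · rw [h10', Nat.sub_zero, hext.startOf_extend ht hq hc0, ← hstart]
        simp
      · rw [h10']
        simpa using hv.start_le
    · rintro v' ⟨hs, h2, h9, h13, h11, h10, hle, ha⟩
      have hpc : v'.arr 1 (q + 1 - p) = c := by rw [ha, if_neg (by omega), hc]
      have hcq : v'.arr 1 (q + 1) = c - N := by rw [ha, if_pos rfl]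
      have hfun : (fun i => v'.arr 1 (i + 1)) = extend y q (c - N) := by
        funext i
        rw [ha, extend, hyi]
        simp
      refine Triple.weaken (Triple.seq (Triple.ifElse (T := 100) (Q := fun w => SameOuter v w ∧ w.var 9 = q ∧
        w.arr 1 = v'.arr 1 ∧ w.var 10 = v'.var 10 ∧
        IsPeriodic (extend y q (c - N)) (q + 1) (w.var 13) ∧ w.var 13 ≤ q + 1) rfl ?_ ?_ ?_)
        (T' := 100) ?_) (by omega)
      · simp [h9, h13]
        omega
      · intro hcond
        simp only [eval_sub, eval_get, eval_add, eval_var, eval_one, h9, h13, hpc, hcq] at hcond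
        refine Triple.assign (by omega) rfl (by simp) ⟨hs.setVar (by omega), by simpa using h9, rfl,
          by simp, ?_, by simp [h9]⟩
        simpa [h9] using hext.lt (d := c - N) (by omega)
      · intro hcond
        simp only [eval_sub, eval_get, eval_add, eval_var, eval_one, h9, h13, hpc, hcq] at hcond
        refine Triple.weaken (Triple.skip ⟨hs, h9, rfl, rfl, ?_, by omega⟩) (by omega)
        rw [h13, show c - N = c by omega]
        exact hext.eq
      · rintro w ⟨hs, h9, ha', h10', hper, hle13⟩
        have hpos := hper.pos
        refine Triple.assign (by omega) rfl (by simp) ⟨hv.same.trans (hs.setVar (by omega)),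
          by simp [h9], ?_, ?_, ⟨fun _ => ?_, ?_, by simp, fun _ => ?_⟩, ?_, ?_, ?_⟩
        · simp only [Store.setVar_arr, ha', ha]
          rw [if_neg (by omega), hv.sentinel]
        · intro i hi
          simp only [Store.setVar_arr, ha', ha]
          split_ifs with hiq
          · omega
          · exact hv.le i (by omega)
        · simp only [Store.setVar_arr, ha', hfun]
          simpa using hper
        · simp
          omega
        · simp only [Store.setVar_arr, Store.setVar_var, if_neg (show ¬ (13 : ℕ) = 9 by decide)]
          congr 1
          omega
        · simp only [Store.setVar_arr, ha', hfun]
          simpa [h10'] using h10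
        · simpa [h10'] using hle
        · simp only [Store.setVar_arr, ha', hfun]
          exact hN
  · have h1 : N * (countTime n t + 400 + 100) ≤ n * (countTime n t + 500) :=
      Nat.mul_le_mul (by omega) (by omega)
    omega

/-- The time for finding a symbol. -/
def symbolTime (n t : ℕ) : ℕ :=
  1000 + t * (1100 + countTime n t + n * (countTime n t + 500))

/-- After `t` extensions the position `r` lies between start and end of a full string, so
`getD_diffCycle` reads the symbol at offset `r` minus the start. -/
theorem triple_findSymbol (hn : 1 ≤ n) (ht : 1 ≤ t) (h : UnrankState n t r v)
    (hr : r < numStrings n t) :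
    Triple ((t + 1) * (n + 1)) findSymbol v (symbolTime n t) fun v' =>
      SameOuter v v' ∧ v'.var 14 = (diffCycle n t).getD r 0 := by
  have hB := two_mul_lt (t := t) hn
  refine Triple.weaken (Triple.assign_seq (by omega) rfl (by simp) (Triple.assign_seq (by omega) rfl
    (by simp) (Triple.put_seq (by omega) rfl rfl (by simp) (by simp) (by simp)
    (Triple.assign_seq (by omega) rfl (by simp) (Triple.seq (Triple.whileDo
    (fun q v' => PrefixFound n t r q v v') t
    (T := 1000 + countTime n t + n * (countTime n t + 500)) rfl ?_ ?_ ?_ ?_ fun _ h => h)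
    (T' := 100) ?_))))) ?_
  · intro q _ v _
    simp
  · intro q hq v' hv'
    refine ⟨?_, triple_extendPrefix hn ht h hq hv'⟩
    simp [hv'.var9, (h.of_sameOuter hv'.same).var1]
    omega
  · intro v' hv'
    simp [hv'.var9, (h.of_sameOuter hv'.same).var1]
  · refine ⟨((((SameOuter.refl v).setVar (by omega)).setVar (by omega)).setArr).setVar (by omega),
      by simp, by simp [h.var0], ?_, ⟨by simp, by simp, by simp, by simp⟩, ?_, by simp, ?_⟩
    · intro i hi
      simp [show i = 0 by omega, h.var0]
    · simp [startOf, classes, prefixOf]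
    · rwa [endOf_zero]
  · intro v' hv'
    have h1 := hv'.start_le
    have h2 := hv'.lt_end
    have h3 := hv'.start
    rw [h3] at h1
    rw [endOf, length_prefixOf] at h2
    obtain ⟨h4, h5⟩ := getD_diffCycle hn ht h1 h2
    refine Triple.assign (by omega) rfl ?_ ⟨hv'.same.setVar (by omega), ?_⟩
    · simp [(h.of_sameOuter hv'.same).var8, h3]
      omega
    · simp [(h.of_sameOuter hv'.same).var8, h3]
      rw [← List.getD_eq_getElem?_getD, h5]
  · have : t * (1000 + countTime n t + n * (countTime n t + 500) + 100) =
      t * (1100 + countTime n t + n * (countTime n t + 500)) := by ring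
    rw [symbolTime]
    omega

/-- The time for unranking. -/
def unrankTime (n t : ℕ) : ℕ := 2000 + countTime n t + t * (1000 + symbolTime n t)

/-- The list of the `f (p + x₁ + ⋯ + xᵢ) xᵢ` for the numbers `x₁, x₂, …` -/
def encode (f : ℕ → ℕ → ℕ) : ℕ → List ℕ → List ℕ
  | _, [] => []
  | p, x :: l => f (p + x) x :: encode f (p + x) l

theorem encode_append_singleton (f : ℕ → ℕ → ℕ) (p : ℕ) (l : List ℕ) (x : ℕ) :
    encode f p (l ++ [x]) = encode f p l ++ [f (p + l.sum + x) x] := by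
  induction l generalizing p with
  | nil => simp [encode]
  | cons a l ih => simp [encode, ih, add_assoc]

/-- The symbols at `r - 1 + k`, reduced modulo the length of the cycle, are found independently.
Variable 16 keeps their sum, so either the representative or the multiset itself can be printed on
the way. -/
theorem triple_unrankProgram {e : Expr} {f : ℕ → ℕ → ℕ} (he : e.ok = true)
    (hs : ∀ v B, e.Safe B v) (hf : ∀ v, e.eval v = f (v.var 16) (v.var 14)) (hn : 1 ≤ n)
    (ht : 1 ≤ t) (r : ℕ) :
    Triple ((t + 1) * (n + 1)) (unrankProgram e) ⟨fun _ => 0, fun _ _ => 0, [n, t, r], []⟩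
      (unrankTime n t) fun v => v.out = encode f 0 (window (diffCycle n t) t (r - 1)) := by
  have hlen := length_diffCycle_pos hn ht
  rw [← numStrings_eq hn ht] at hlen
  refine Triple.weaken (Triple.seq (triple_setup hn ht) (T' := 401 + (t * (700 + symbolTime n t) +
    100)) ?_) ?_
  · rintro v ⟨h0, h1, h6, hi, ho⟩
    refine Triple.weaken (Triple.read_seq (by omega) hi (Triple.assign_seq (by omega) rfl (by simp)
      (Triple.assign_seq (by omega) rfl (by simp) (Triple.assign_seq (by omega) rfl (by simp)
      (Triple.whileDo (fun k v => v.var 0 = n ∧ v.var 1 = t ∧ v.var 6 = numStrings n t ∧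
        v.var 7 = r - 1 ∧ v.var 3 = k ∧ v.var 16 = (window (diffCycle n t) k (r - 1)).sum ∧
        v.out = encode f 0 (window (diffCycle n t) k (r - 1))) t (T := 600 + symbolTime n t)
        rfl ?_ ?_ ?_ ?_ ?_))))) ?_
    · intro k _ v _
      simp
    · rintro k hk v ⟨h0, h1, h6, h7, h3, h16, ho⟩
      refine ⟨by simp [h1, h3]; omega, Triple.weaken (Triple.assign_seq (by omega) rfl (by simp)
        (Triple.assign_seq (by omega) rfl (by simp) (Triple.seq (triple_findSymbol
        (r := (r - 1 + k) % numStrings n t) hn ht ⟨?_, ?_, ?_, ?_⟩ (Nat.mod_lt _ hlen))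
        (T' := 300) ?_))) (by omega)⟩
      · simp [h0]
      · simp [h1]
      · simp [h6]
      · simp only [Store.setVar_var, eval_add, eval_sub, eval_mul, eval_div, eval_var, if_true,
          if_neg (show ¬ (6 : ℕ) = 15 by decide), h6, h7, h3]
        rw [mul_comm]
        exact Nat.mod_eq_sub_mul_div.symm
      · rintro v' ⟨hv, h14⟩
        have hw : window (diffCycle n t) (k + 1) (r - 1) = window (diffCycle n t) k (r - 1) ++
            [v'.var 14] := by
          rw [h14, numStrings_eq hn ht]
          simp [window, List.range_succ]
        have e0 := hv.var 0 (by omega) (by omega) (by omega)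
        have e1 := hv.var 1 (by omega) (by omega) (by omega)
        have e3 := hv.var 3 (by omega) (by omega) (by omega)
        have e6 := hv.var 6 (by omega) (by omega) (by omega)
        have e7 := hv.var 7 (by omega) (by omega) (by omega)
        have e16 := hv.var 16 (by omega) (by omega) (by omega)
        have eo := hv.out
        simp only [Store.setVar_var, Store.setVar_out] at e0 e1 e3 e6 e7 e16 eo
        refine Triple.weaken (Triple.assign_seq (by omega) rfl (by simp) (Triple.seq (Triple.print
          (Q := fun w => w.var 0 = n ∧ w.var 1 = t ∧ w.var 6 = numStrings n t ∧
          w.var 7 = r - 1 ∧ w.var 3 = k ∧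
          w.var 16 = (window (diffCycle n t) (k + 1) (r - 1)).sum ∧
          w.out = encode f 0 (window (diffCycle n t) (k + 1) (r - 1))) he (hs _ _) ?_)
          (T' := 100) ?_)) le_rfl
        · refine ⟨by simp [e0, h0], by simp [e1, h1], by simp [e6, h6], by simp [e7, h7],
            by simp [e3, h3], by simp [e16, h16, hw], ?_⟩
          rw [hw, encode_append_singleton]
          simp [hf, eo, ho, e16, h16]
        · rintro w ⟨h0, h1, h6, h7, h3, h16, ho⟩
          exact Triple.assign (by omega) rfl (by simp) ⟨by simpa using h0, by simpa using h1,
            by simpa using h6, by simpa using h7, by simp [h3], by simpa using h16,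
            by simpa using ho⟩
    · rintro v ⟨h0, h1, h6, h7, h3, h16, ho⟩
      simp [h1, h3]
    · exact ⟨by simpa using h0, by simpa using h1, by simpa using h6, by simp, by simp,
        by simp [window], by simpa [window, encode] using ho⟩
    · rintro v ⟨-, -, -, -, -, -, ho⟩
      exact ho
    · have : t * (600 + symbolTime n t + 100) = t * (700 + symbolTime n t) := by ring
      omega
  · have : t * (700 + symbolTime n t) ≤ t * (1000 + symbolTime n t) :=
      Nat.mul_le_mul_left _ (by omega)
    rw [unrankTime]
    omega

end

end Ram

/-! ### Input and output formats, and the final bounds. -/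

namespace Ram

open UCycle Ram.Expr

theorem decode_sub (p : ℕ) (l : List ℕ) : decode (fun p x => x - p) p l = diffs p l := by
  induction l generalizing p with
  | nil => rfl
  | cons a l ih => rw [decode, diffs, ih]

theorem decode_map_succ (p : ℕ) (l : List ℕ) :
    decode (fun _ x => x - 1) p (l.map (· + 1)) = l := by
  induction l generalizing p with
  | nil => rfl
  | cons a l ih => simp [decode, ih]

theorem encode_sum (p : ℕ) (l : List ℕ) : encode (fun s _ => s) p l = partialSums p l := by
  induction l generalizing p with
  | nil => rfl
  | cons a l ih => rw [encode, partialSums, ih]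

theorem encode_succ (p : ℕ) (l : List ℕ) : encode (fun _ x => x + 1) p l = l.map (· + 1) := by
  induction l generalizing p with
  | nil => rfl
  | cons a l ih => rw [encode, ih, List.map_cons]

section

variable {n t : ℕ}

/-- Shifting `n` and `t` by one turns this into a comparison of polynomials with natural
coefficients, which after `ring_nf` is linear in the monomials. -/
theorem countTime_le (hn : 1 ≤ n) (ht : 1 ≤ t) : countTime n t ≤ 4000 * (n * t ^ 2) := by
  obtain ⟨n, rfl⟩ := Nat.exists_eq_add_of_le' hn
  obtain ⟨t, rfl⟩ := Nat.exists_eq_add_of_le' ht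
  rw [countTime]
  ring_nf
  omega

theorem rankTime_le (hn : 1 ≤ n) (ht : 1 ≤ t) : rankTime n t ≤ 22000 * (n ^ 2 * t ^ 3) := by
  have h := countTime_le hn ht
  have h1 : n * t ^ 2 ≤ n ^ 2 * t ^ 3 :=
    Nat.mul_le_mul (Nat.le_self_pow (by omega) n) (Nat.pow_le_pow_right ht (by omega))
  have h2 : 1 ≤ n ^ 2 * t ^ 3 := Nat.mul_pos (by positivity) (by positivity)
  have h3 : t ^ 2 ≤ n * t ^ 2 := Nat.le_mul_of_pos_left _ hn
  have h4 : t ≤ t ^ 2 := Nat.le_self_pow (by omega) t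
  have h5 : t * (700 + t * 200) = 700 * t + 200 * t ^ 2 := by ring
  rw [rankTime]
  omega

theorem symbolTime_le (hn : 1 ≤ n) (ht : 1 ≤ t) : symbolTime n t ≤ 10600 * (n ^ 2 * t ^ 3) := by
  have h := countTime_le hn ht
  calc symbolTime n t
      ≤ 1000 + t * (1100 + 4000 * (n * t ^ 2) + n * (4000 * (n * t ^ 2) + 500)) := by
        rw [symbolTime]
        gcongr
    _ ≤ 10600 * (n ^ 2 * t ^ 3) := by
        obtain ⟨n, rfl⟩ := Nat.exists_eq_add_of_le' hn
        obtain ⟨t, rfl⟩ := Nat.exists_eq_add_of_le' ht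
        ring_nf
        omega

theorem unrankTime_le (hn : 1 ≤ n) (ht : 1 ≤ t) : unrankTime n t ≤ 20000 * (n ^ 2 * t ^ 4) := by
  have h := countTime_le hn ht
  have h' := symbolTime_le hn ht
  have h1 : n * t ^ 2 ≤ n ^ 2 * t ^ 4 :=
    Nat.mul_le_mul (Nat.le_self_pow (by omega) n) (Nat.pow_le_pow_right ht (by omega))
  have h2 : 1 ≤ n ^ 2 * t ^ 4 := Nat.mul_pos (by positivity) (by positivity)
  have h3 : t ≤ n ^ 2 * t ^ 4 :=
    (Nat.le_self_pow (by omega) t).trans (Nat.le_mul_of_pos_left _ (by positivity))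
  have h4 : t * symbolTime n t ≤ 10600 * (n ^ 2 * t ^ 4) :=
    (Nat.mul_le_mul_left t h').trans_eq (by ring)
  rw [unrankTime, Nat.mul_add]
  omega

theorem space_le (hn : 1 ≤ n) (ht : 1 ≤ t) :
    40 + 3 * ((t + 1) * (n + 1)) ≤ 40000 * (n * t ^ 3) := by
  have h1 : n * t ≤ n * t ^ 3 := Nat.mul_le_mul_left n (Nat.le_self_pow (by omega) t)
  have h2 : n ≤ n * t := Nat.le_mul_of_pos_right n ht
  have h3 : t ≤ n * t := Nat.le_mul_of_pos_left t hn
  have h4 : (t + 1) * (n + 1) = n * t + t + n + 1 := by ring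
  omega

theorem computes_rankProgram {e : Expr} {f : ℕ → ℕ → ℕ} (he : e.ok = true)
    (hs : ∀ v B, e.Safe B v) (hf : ∀ v, e.eval v = f (v.var 5) (v.var 4)) (hn : 1 ≤ n) (ht : 1 ≤ t)
    {x : List ℕ} (hx : x.length = t) {m : Multiset ℕ} (hm : m ∈ multisets n t)
    (hd : decode f 0 x = diffRep m) :
    Computes (rankProgram e) (n :: t :: x) [rank (cycleLE n t (n + t - 1)) (shiftedDiffRep m)]
      (40000 * (n ^ 2 * t ^ 3)) (40000 * (n * t ^ 3)) := by
  refine computes_of_triple (triple_rankProgram he hs hf hn ht hx hm hd) ?_ ?_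
  · have h : (rankTime n t : ℝ) ≤ 22000 * (n ^ 2 * t ^ 3) := mod_cast rankTime_le hn ht
    have : (0 : ℝ) ≤ n ^ 2 * t ^ 3 := by positivity
    linarith
  · exact mod_cast space_le hn ht

theorem computes_unrankProgram {e : Expr} {f : ℕ → ℕ → ℕ} (he : e.ok = true)
    (hs : ∀ v B, e.Safe B v) (hf : ∀ v, e.eval v = f (v.var 16) (v.var 14)) (hn : 1 ≤ n)
    (ht : 1 ≤ t) (r : ℕ) :
    Computes (unrankProgram e) [n, t, r] (encode f 0 (window (diffCycle n t) t (r - 1)))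
      (40000 * (n ^ 2 * t ^ 4 * Real.log (n + 1))) (40000 * (n * t ^ 3)) := by
  refine computes_of_triple (triple_unrankProgram he hs hf hn ht r) ?_ ?_
  · have h : (unrankTime n t : ℝ) ≤ 20000 * (n ^ 2 * t ^ 4) := mod_cast unrankTime_le hn ht
    have h0 : (0 : ℝ) ≤ n ^ 2 * t ^ 4 := by positivity
    -- The linear search for symbols gives a bound without logarithm, so the logarithm only has to
    -- be bounded below. The factor `2` lost here is why the constant is 40000 rather than 20000.
    have hlog : 1 / 2 ≤ Real.log (n + 1) := by
      have h2 : Real.log 2 ≤ Real.log (n + 1) := by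
        refine Real.log_le_log (by norm_num) ?_
        have : (1 : ℝ) ≤ n := mod_cast hn
        linarith
      linarith [Real.log_two_gt_d9]
    have := mul_le_mul_of_nonneg_left hlog h0
    linarith
  · exact mod_cast space_le hn ht

end

end Ram

open UCycle Ram in
theorem mainTheorem4 :
    (∀ n t : ℕ, 1 ≤ n → 1 ≤ t →
      IsUniversalCycle (cycleLE n t (n + t - 1)) (multisets n t) shiftedDiffRep) ∧
    -- decoding of the representatives
    (∃ (rankProg unrankProg : Program) (C : ℝ), ∀ n t : ℕ, 1 ≤ n → 1 ≤ t →
      (∀ m ∈ multisets n t,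
        Computes rankProg (n :: t :: shiftedDiffRep m)
          [rank (cycleLE n t (n + t - 1)) (shiftedDiffRep m)]
          (C * (n ^ 2 * t ^ 3)) (C * (n * t ^ 3))) ∧
      (∀ r : ℕ, 1 ≤ r → r ≤ (multisets n t).ncard →
        Computes unrankProg [n, t, r]
          (unrank (cycleLE n t (n + t - 1)) t r)
          (C * (n ^ 2 * t ^ 4 * Real.log (n + 1))) (C * (n * t ^ 3)))) ∧
    -- decoding of the multisets, listed in non-decreasing order
    (∃ (rankProg unrankProg : Program) (C : ℝ), ∀ n t : ℕ, 1 ≤ n → 1 ≤ t →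
      (∀ m ∈ multisets n t,
        Computes rankProg (n :: t :: listing m)
          [rank (cycleLE n t (n + t - 1)) (shiftedDiffRep m)]
          (C * (n ^ 2 * t ^ 3)) (C * (n * t ^ 3))) ∧
      (∀ r : ℕ, 1 ≤ r → r ≤ (multisets n t).ncard →
        ∃ m ∈ multisets n t,
          shiftedDiffRep m = unrank (cycleLE n t (n + t - 1)) t r ∧
          Computes unrankProg [n, t, r] (listing m)
            (C * (n ^ 2 * t ^ 4 * Real.log (n + 1))) (C * (n * t ^ 3)))) := by
  -- Only the input and output expressions differ between the two formats: subtract one or the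
  -- previous element on reading, and print the symbol plus one or the running sum.
  refine ⟨fun n t hn ht => isUniversalCycle_cycleLE hn ht,
    ⟨rankProgram (.var 4 - 1), unrankProgram (.var 14 + 1), 40000, fun n t hn ht =>
      ⟨fun m hm => ?_, fun r _ _ => ?_⟩⟩,
    ⟨rankProgram (.var 4 - .var 5), unrankProgram (.var 16), 40000, fun n t hn ht =>
      ⟨fun m hm => ?_, fun r h1 h2 => ?_⟩⟩⟩
  · exact computes_rankProgram (f := fun _ x => x - 1) rfl (by simp) (by simp) hn ht
      (by rw [shiftedDiffRep, List.length_map, length_diffRep hm]) hm (decode_map_succ 0 _)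
  · rw [unrank_eq hn ht, ← encode_succ 0]
    exact computes_unrankProgram rfl (by simp) (by simp) hn ht r
  · exact computes_rankProgram (f := fun p x => x - p) rfl (by simp) (by simp) hn ht
      (length_listing hm) hm (decode_sub 0 _)
  · obtain ⟨m, hm, h, h'⟩ := exists_multiset_unrank hn ht h1 h2
    refine ⟨m, hm, h, ?_⟩
    rw [h', ← encode_sum]
    exact computes_unrankProgram rfl (by simp) (by simp) hn ht r
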